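/- **Setting.** Let $\Gamma$ be a countable discrete group, $X$ a compact Hausdorff space with an action of $\Gamma$ by homeomorphisms, and $Z$ a proper metric space with a right action of $\Gamma$ by isometries which is proper and cocompact. Let $H$ be a separable Hilbert space with a unitary representation $U$ of $\Gamma$. The $C^*$-algebra $C_0(Z\times X)$ carries the action $(\gamma g)(z,x)=g(z\gamma,\gamma^{-1}x)$, and $C(X)\otimes H=C(X,H)$ the action $(\gamma\xi)(x)=U_\gamma\xi(\gamma^{-1}x)$. Let $\pi:C_0(Z\times X)\to\mathcal L_{C(X)}(C(X)\otimes H)$ be a fibrewise non-degenerate $\Gamma$-equivariant $C(X)$-linear $*$-representation. An admissible crossed product functor $\rtimes\Gamma$ is fixed: it assigns to each $\Gamma$-$C^*$-algebra $A$ a $C^*$-completion $A\rtimes\Gamma$ of the convolution algebra $C_c(\Gamma,A)$, for a norm between the reduced and the maximal one, such that equivariant $*$-homomorphisms $A\to B$ induce $*$-homomorphisms $A\rtimes\Gamma\to B\rtimes\Gamma$. Put $C^*(\mathcal G)=C(X)\rtimes\Gamma$. Let $(C(X)\otimes H)\rtimes\Gamma$ be the Hilbert $C^*(\mathcal G)$-module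 completion of $C_c(X\times\Gamma,H)$ for $\langle\xi,\eta\rangle(x,\gamma)=\sum_\mu\langle\xi(\mu x,\mu),\eta(\mu x,\mu\gamma)\rangle$. For $T\in\mathcal L_{C(X)}(C(X)\otimes H)$ the operator $T\rtimes\Gamma$ on it is given by $(T\rtimes\Gamma)(\xi)(x,\gamma)=T_x\xi(x,\gamma)$, and the representation $\pi\rtimes\Gamma$ of $C_0(Z\times X)\rtimes\Gamma$ by $(\pi\rtimes\Gamma)(f)(\xi)(x,\gamma)=\sum_\mu\pi_x(f(\bullet,x,\mu))U_\mu\xi(\mu^{-1}x,\mu^{-1}\gamma)$. The Connes–Skandalis module $\mathcal E^H$ is the Hilbert $C^*(\mathcal G)$-module completion of $\mathcal E^H_c=\pi(C_c(Z\times X))(C(X)\otimes H)$ for $\langle\xi,\eta\rangle(x,\gamma)=\langle\xi(x),U_\gamma\eta(\gamma^{-1}x)\rangle$ and the right action $(\xi f)(x)=\sum_\gamma f(\gamma x,\gamma)U_{\gamma^{-1}}\xi(\gamma x)$. A cut-off function is a continuous compactly supported $c:Z\to[0,1]$ with $\sum_\gamma c(z\gamma)^2=1$ for all $z$; its Mishchenko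 projection is $e(\gamma)(z,x)=c(z)c(z\gamma)$. It gives an isomorphism of Hilbert modules $\phi:\mathcal E^H\to(\pi\rtimes\Gamma)(e)\big((C(X)\otimes H)\rtimes\Gamma\big)$, $\phi(\xi)(x,\gamma)=\pi_x(c)U_\gamma\xi(\gamma^{-1}x)$ for $\xi\in\mathcal E^H_c$. For $f\in e(C_0(Z\times X)\rtimes\Gamma)$ put $L_f=\phi^{-1}\circ(\pi\rtimes\Gamma)(f):(C(X)\otimes H)\rtimes\Gamma\to\mathcal E^H$. An operator $S\in\mathcal L_{C^*(\mathcal G)}(\mathcal E^H)$ is a *lift* of $T$ if, for some cut-off function, $S L_f-L_f(T\rtimes\Gamma)$ and $L_f^*S-(T\rtimes\Gamma)L_f^*$ are compact for all $f\in e(C_0(Z\times X)\rtimes\Gamma)$. Finally $T_e=\phi^{-1}(\pi\rtimes\Gamma)(e)(T\rtimes\Gamma)(\pi\rtimes\Gamma)(e)\,\phi\in\mathcal L_{C^*(\mathcal G)}(\mathcal E^H)$. Let $D^*_\Gamma(X,Z,H)$ (resp. $C^*_\Gamma(X,Z,H)$) be the norm closure of the set of $\Gamma$-equivariant finite propagation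 operators $T\in\mathcal L_{C(X)}(C(X)\otimes H)$ which are pseudolocal (resp. locally compact), i.e. $[T,\pi(g)]$ is compact (resp. $T\pi(g)$ and $\pi(g)T$ are compact) for all $g\in C_0(Z\times X)$; finite propagation means that for some $R>0$ one has $\pi(\varphi)T\pi(\psi)=0$ whenever $\varphi,\psi\in C_c(Z)$ have supports at distance $>R$. Let $C^*_\Gamma(\mathcal E^H)$ be the set of lifts of elements of $C^*_\Gamma(X,Z,H)$. **Proposition.** 1. For every $T\in D^*_\Gamma(X,Z,H)$ and every cut-off function, with Mishchenko projection $e$, the operator $T_e$ is a lift of $T$, and every lift $S$ of $T$ is a compact perturbation of $T_e$, i.e. $S-T_e\in\mathcal K_{C^*(\mathcal G)}(\mathcal E^H)$. 2. $C^*_\Gamma(\mathcal E^H)=\mathcal K_{C^*(\mathcal G)}(\mathcal E^H)$. -/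

import Mathlib

open scoped InnerProductSpace ZeroAtInfty
set_option linter.unusedSectionVars false
set_option linter.checkUnivs false

universe u v w t

noncomputable section

namespace RoeLift

/-! ### Hilbert modules, adjointable and compact operators -/

/-- A (right) Hilbert module `E` over the `C⋆`-algebra `B`: a complex Banach space with a
`B`-valued inner product, conjugate linear in the first variable, and a right action of `B`. (The
remaining axioms of a right module follow from these.) -/
class HilbertModule (B E : Type*) [NonUnitalCStarAlgebra B] [NormedAddCommGroup E]
    [NormedSpace ℂ E] [CompleteSpace E] where
  ip : E → E → B
  rsmul : E → B → E
  ip_add_right (x y z : E) : ip x (y + z) = ip x y + ip x z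
  ip_smul_right (a : ℂ) (x y : E) : ip x (a • y) = a • ip x y
  star_ip (x y : E) : star (ip x y) = ip y x
  ip_rsmul_right (x y : E) (b : B) : ip x (rsmul y b) = ip x y * b
  ip_self_nonneg (x : E) : ∃ b : B, ip x x = star b * b
  norm_sq (x : E) : ‖x‖ ^ 2 = ‖ip x x‖

section Operators

variable (B : Type*) [NonUnitalCStarAlgebra B]
  {E : Type*} [NormedAddCommGroup E] [NormedSpace ℂ E] [CompleteSpace E] [HilbertModule B E]
  {E' : Type*} [NormedAddCommGroup E'] [NormedSpace ℂ E'] [CompleteSpace E'] [HilbertModule B E']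

/-- `T` is an adjointable operator of Hilbert `B`-modules. -/
def IsAdjointable (T : E →L[ℂ] E') : Prop :=
  ∃ S : E' →L[ℂ] E, ∀ x y, HilbertModule.ip (B := B) (T x) y = HilbertModule.ip x (S y)

/-- The compact operators: the norm closure of the finite sums of the operators
`θ_{u, v} : z ↦ u ⟨v, z⟩`. -/
def compactOps (E E' : Type*) [NormedAddCommGroup E] [NormedSpace ℂ E] [CompleteSpace E]
    [HilbertModule B E] [NormedAddCommGroup E'] [NormedSpace ℂ E'] [CompleteSpace E']
    [HilbertModule B E'] : Set (E →L[ℂ] E') :=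
  closure {T | ∃ (n : ℕ) (u : Fin n → E') (v : Fin n → E),
    ∀ z, T z = ∑ i, HilbertModule.rsmul (u i) (HilbertModule.ip (B := B) (v i) z)}

end Operators

/-! ### Completion of a pre-Hilbert module -/

/-- A pre-Hilbert module `V` over a dense subalgebra of the `C⋆`-algebra `B`; the subalgebra is
given as the image of a linear map `ι : R → B` and the inner product takes its values in it. -/
structure PreHilbertModule {R B : Type*} [AddCommGroup R] [Module ℂ R] [NonUnitalCStarAlgebra B]
    (ι : R →ₗ[ℂ] B) (V : Type*) [AddCommGroup V] [Module ℂ V] where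
  form : V →ₗ⋆[ℂ] V →ₗ[ℂ] R
  act : V →ₗ[ℂ] R →ₗ[ℂ] V
  dense : DenseRange ι
  star_form (x y : V) : star (ι (form x y)) = ι (form y x)
  form_act (x y : V) (r : R) : ι (form x (act y r)) = ι (form x y) * ι r
  form_self (x : V) : ∃ b : B, ι (form x x) = star b * b

namespace PreHilbertModule

variable {R B : Type*} [AddCommGroup R] [Module ℂ R] [NonUnitalCStarAlgebra B]
  {ι : R →ₗ[ℂ] B} {V : Type*} [AddCommGroup V] [Module ℂ V] (P : PreHilbertModule ι V)

theorem form_act_left (x y : V) (r : R) :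
    ι (P.form (P.act x r) y) = star (ι r) * ι (P.form x y) := by
  rw [← P.star_form, P.form_act, star_mul, P.star_form]

theorem cauchy_schwarz (x y : V) :
    ‖ι (P.form x y)‖ ^ 2 ≤ ‖ι (P.form x x)‖ * ‖ι (P.form y y)‖ := by
  let _ := CStarAlgebra.spectralOrder B
  have := CStarAlgebra.spectralOrderedRing B
  have pos : ∀ z : V, 0 ≤ ι (P.form z z) := by
    intro z
    obtain ⟨b, hb⟩ := P.form_self z
    rw [hb]; exact star_mul_self_nonneg b
  have key : ∀ c : ℝ, ‖ι (P.form x x)‖ < c →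
      ‖ι (P.form x y)‖ ^ 2 ≤ c * ‖ι (P.form y y)‖ := by
    intro c hc
    have hc0 : 0 < c := (norm_nonneg _).trans_lt hc
    set a := ι (P.form x y) with ha
    have h1 := pos (P.act x (P.form x y) - (c : ℂ) • y)
    have h2 : ι (P.form (P.act x (P.form x y) - (c : ℂ) • y)
        (P.act x (P.form x y) - (c : ℂ) • y)) =
        star a * ι (P.form x x) * a - (c : ℂ) • (star a * a) - (c : ℂ) • (star a * a)
          + ((c : ℂ) * c) • ι (P.form y y) := by
      simp only [map_sub, map_smulₛₗ, LinearMap.sub_apply, LinearMap.smul_apply, P.form_act,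
        P.form_act_left, RingHom.id_apply, Complex.conj_ofReal, ← ha]
      rw [show ι (P.form y x) = star a by rw [ha, P.star_form]]
      simp only [smul_sub, smul_smul, mul_assoc]
      abel
    rw [h2] at h1
    have h3 : star a * ι (P.form x x) * a ≤ (c : ℂ) • (star a * a) := by
      have := CStarAlgebra.star_left_conjugate_le_norm_smul (a := a) (b := ι (P.form x x))
        (IsSelfAdjoint.of_nonneg (pos x))
      refine this.trans ?_
      have h4 : (0 : B) ≤ ((c - ‖ι (P.form x x)‖ : ℝ)) • (star a * a) :=
        smul_nonneg (by linarith) (star_mul_self_nonneg a)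
      rw [sub_smul] at h4
      have := sub_nonneg.mp h4
      simpa using this
    have h5 : (c : ℂ) • (star a * a) ≤ ((c : ℂ) * c) • ι (P.form y y) := by
      have := add_nonneg h1 (sub_nonneg.mpr h3)
      rw [← sub_nonneg]
      convert this using 1
      abel
    have h6 : (0 : B) ≤ (c : ℂ) • (star a * a) := by
      have : (0 : B) ≤ (c : ℝ) • (star a * a) :=
        smul_nonneg hc0.le (star_mul_self_nonneg a)
      simpa using this
    have h7 := CStarAlgebra.norm_le_norm_of_nonneg_of_le h6 h5
    rw [norm_smul, norm_smul, CStarRing.norm_star_mul_self] at h7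
    simp only [Complex.norm_real, norm_mul, Real.norm_eq_abs, abs_of_pos hc0] at h7
    nlinarith
  refine le_of_forall_pos_le_add fun ε hε => ?_
  have hy := norm_nonneg (ι (P.form y y))
  have := key (‖ι (P.form x x)‖ + ε / (‖ι (P.form y y)‖ + 1)) (by
    have : 0 < ε / (‖ι (P.form y y)‖ + 1) := by positivity
    linarith)
  have h8 : ε / (‖ι (P.form y y)‖ + 1) * ‖ι (P.form y y)‖ ≤ ε := by
    rw [div_mul_eq_mul_div, div_le_iff₀ (by positivity)]
    nlinarith
  nlinarith

/-- The vector space `V`, regarded as a seminormed space with `‖x‖ = ‖⟨x, x⟩‖ ^ (1 / 2)`. -/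
def Space (_ : PreHilbertModule ι V) : Type _ := V

instance : AddCommGroup P.Space := inferInstanceAs (AddCommGroup V)
instance : Module ℂ P.Space := inferInstanceAs (Module ℂ V)
instance : Norm P.Space := ⟨fun x => √‖ι (P.form x x)‖⟩

theorem norm_def (x : P.Space) : ‖x‖ = √‖ι (P.form x x)‖ := rfl

theorem norm_form_le (x y : P.Space) : ‖ι (P.form x y)‖ ≤ ‖x‖ * ‖y‖ := by
  rw [norm_def, norm_def, ← Real.sqrt_mul (norm_nonneg _)]
  exact Real.le_sqrt_of_sq_le (P.cauchy_schwarz x y)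

theorem norm_sq_def (x : P.Space) : ‖x‖ ^ 2 = ‖ι (P.form x x)‖ := by
  rw [norm_def, Real.sq_sqrt (norm_nonneg _)]

theorem norm_smul_space (a : ℂ) (x : V) :
    √‖ι (P.form (a • x) (a • x))‖ = ‖a‖ * √‖ι (P.form x x)‖ := by
  have h : ι (P.form (a • x) (a • x)) = (starRingEnd ℂ a * a) • ι (P.form x x) := by
    simp only [map_smulₛₗ, LinearMap.smul_apply, RingHom.id_apply, smul_smul, mul_comm]
  rw [h, norm_smul, norm_mul, RCLike.norm_conj, Real.sqrt_mul (by positivity),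
    Real.sqrt_mul_self (norm_nonneg _)]

theorem norm_add_space (x y : V) :
    √‖ι (P.form (x + y) (x + y))‖ ≤ √‖ι (P.form x x)‖ + √‖ι (P.form y y)‖ := by
  refine Real.sqrt_le_iff.mpr ⟨by positivity, ?_⟩
  have h1 : _ ≤ √‖ι (P.form x x)‖ * √‖ι (P.form y y)‖ := P.norm_form_le x y
  have h2 : _ ≤ √‖ι (P.form y y)‖ * √‖ι (P.form x x)‖ := P.norm_form_le y x
  have h : ι (P.form (x + y) (x + y)) = ι (P.form x x) + ι (P.form x y) + (ι (P.form y x)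
      + ι (P.form y y)) := by
    simp only [map_add, LinearMap.add_apply]; abel
  rw [h, add_sq, Real.sq_sqrt (norm_nonneg _), Real.sq_sqrt (norm_nonneg _)]
  refine (norm_add_le _ _).trans ?_
  have h3 := norm_add_le (ι (P.form x x)) (ι (P.form x y))
  have h4 := norm_add_le (ι (P.form y x)) (ι (P.form y y))
  linarith

theorem core : SeminormedSpace.Core ℂ P.Space where
  norm_nonneg _ := Real.sqrt_nonneg _
  norm_smul a x := P.norm_smul_space a x
  norm_triangle x y := P.norm_add_space x y

instance : SeminormedAddCommGroup P.Space := SeminormedAddCommGroup.ofCore P.core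
instance : NormedSpace ℂ P.Space := { norm_smul_le := fun a x => (P.norm_smul_space a x).le }

/-- The completion of the pre-Hilbert module. -/
abbrev Hilbert : Type _ := UniformSpace.Completion P.Space

/-- The canonical map of the pre-Hilbert module to its completion. -/
def toHilbert : V →ₗ[ℂ] P.Hilbert where
  toFun x := ((show P.Space from x : P.Space) : P.Hilbert)
  map_add' x y := UniformSpace.Completion.coe_add (α := P.Space) x y
  map_smul' a x := UniformSpace.Completion.coe_smul (X := P.Space) a x

theorem norm_toHilbert (x : V) : ‖P.toHilbert x‖ = √‖ι (P.form x x)‖ :=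
  UniformSpace.Completion.norm_coe (E := P.Space) x

theorem norm_sq_toHilbert (x : V) : ‖P.toHilbert x‖ ^ 2 = ‖ι (P.form x x)‖ := by
  rw [norm_toHilbert, Real.sq_sqrt (norm_nonneg _)]

theorem denseRange_toHilbert : DenseRange P.toHilbert :=
  UniformSpace.Completion.denseRange_coe (α := P.Space)

theorem norm_form_le_toHilbert (x y : V) :
    ‖ι (P.form x y)‖ ≤ ‖P.toHilbert x‖ * ‖P.toHilbert y‖ := by
  rw [norm_toHilbert, norm_toHilbert]; exact P.norm_form_le x y

theorem norm_act_le (x : V) (r : R) :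
    ‖P.toHilbert (P.act x r)‖ ≤ ‖ι r‖ * ‖P.toHilbert x‖ := by
  refine le_of_sq_le_sq ?_ (by positivity)
  rw [norm_sq_toHilbert, P.form_act, P.form_act_left, mul_pow, norm_sq_toHilbert]
  refine (norm_mul_le _ _).trans ?_
  have := norm_mul_le (star (ι r)) (ι (P.form x x))
  rw [norm_star] at this
  nlinarith [norm_nonneg (ι r)]

/-- The inner product with a fixed vector of `V`, extended to the completion. -/
def ipRight (x : V) : P.Hilbert →L[ℂ] B := (ι ∘ₗ P.form x).extendOfNorm P.toHilbert

theorem ipRight_coe (x y : V) : P.ipRight x (P.toHilbert y) = ι (P.form x y) :=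
  LinearMap.extendOfNorm_eq P.denseRange_toHilbert
    ⟨‖P.toHilbert x‖, fun y => P.norm_form_le_toHilbert x y⟩ y

theorem norm_ipRight_le (x : V) : ‖P.ipRight x‖ ≤ ‖P.toHilbert x‖ :=
  LinearMap.opNorm_extendOfNorm_le P.denseRange_toHilbert (norm_nonneg _)
    fun y => P.norm_form_le_toHilbert x y

theorem clm_ext {F : Type*} [NormedAddCommGroup F] [NormedSpace ℂ F] {f g : P.Hilbert →L[ℂ] F}
    (h : ∀ x, f (P.toHilbert x) = g (P.toHilbert x)) : f = g :=
  ContinuousLinearMap.coeFn_injective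
    (P.denseRange_toHilbert.equalizer f.continuous g.continuous (funext h))

/-- The inner product as a map on `V` with values in the operators on the completion. -/
def ipRightLinear : V →ₗ⋆[ℂ] P.Hilbert →L[ℂ] B where
  toFun := P.ipRight
  map_add' x y := P.clm_ext fun z => by simp [ipRight_coe]
  map_smul' a x := P.clm_ext fun z => by simp [ipRight_coe]

/-- The inner product of the completion, by continuous extension. -/
def ipCompletion : P.Hilbert →L⋆[ℂ] P.Hilbert →L[ℂ] B :=
  P.ipRightLinear.extendOfNorm P.toHilbert

theorem ipCompletion_coe (x y : V) :
    P.ipCompletion (P.toHilbert x) (P.toHilbert y) = ι (P.form x y) := by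
  rw [← ipRight_coe, ipCompletion, LinearMap.extendOfNorm_eq P.denseRange_toHilbert
    ⟨1, fun x => by rw [one_mul]; exact P.norm_ipRight_le x⟩]
  rfl

/-- The action of an element of `R`, extended to the completion. -/
def actRight (r : R) : P.Hilbert →L[ℂ] P.Hilbert :=
  (P.toHilbert ∘ₗ P.act.flip r).extendOfNorm P.toHilbert

theorem actRight_coe (r : R) (x : V) :
    P.actRight r (P.toHilbert x) = P.toHilbert (P.act x r) :=
  LinearMap.extendOfNorm_eq P.denseRange_toHilbert ⟨‖ι r‖, fun y => P.norm_act_le y r⟩ x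

theorem norm_actRight_le (r : R) : ‖P.actRight r‖ ≤ ‖ι r‖ :=
  LinearMap.opNorm_extendOfNorm_le P.denseRange_toHilbert (norm_nonneg _)
    fun y => P.norm_act_le y r

/-- The action of `R` on the completion, as a linear map. -/
def actLinear : R →ₗ[ℂ] P.Hilbert →L[ℂ] P.Hilbert where
  toFun := P.actRight
  map_add' x y := P.clm_ext fun z => by simp [actRight_coe]
  map_smul' a x := P.clm_ext fun z => by simp [actRight_coe]

/-- The right action of `B` on the completion, by continuous extension. -/
def actCompletion : B →L[ℂ] P.Hilbert →L[ℂ] P.Hilbert := P.actLinear.extendOfNorm ι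

theorem actCompletion_coe (r : R) (x : V) :
    P.actCompletion (ι r) (P.toHilbert x) = P.toHilbert (P.act x r) := by
  rw [← actRight_coe, actCompletion, LinearMap.extendOfNorm_eq P.dense
    ⟨1, fun r => by rw [one_mul]; exact P.norm_actRight_le r⟩]
  rfl

instance : HilbertModule B P.Hilbert where
  ip x y := P.ipCompletion x y
  rsmul x b := P.actCompletion b x
  ip_add_right x y z := map_add _ _ _
  ip_smul_right a x y := map_smul _ _ _
  star_ip x y := by
    refine P.denseRange_toHilbert.induction_on₂ (p := fun x y =>
      star (P.ipCompletion x y) = P.ipCompletion y x) ?_ (fun x y => ?_) x y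
    · exact isClosed_eq (by fun_prop) (by fun_prop)
    · rw [ipCompletion_coe, ipCompletion_coe, P.star_form]
  ip_rsmul_right x y b := by
    refine P.dense.induction_on (p := fun b =>
      P.ipCompletion x (P.actCompletion b y) = P.ipCompletion x y * b) b ?_ fun r => ?_
    · exact isClosed_eq (by fun_prop) (by fun_prop)
    refine P.denseRange_toHilbert.induction_on₂ (p := fun x y =>
      P.ipCompletion x (P.actCompletion (ι r) y) = P.ipCompletion x y * ι r) ?_ (fun x y => ?_) x y
    · exact isClosed_eq (by fun_prop) (by fun_prop)
    · rw [actCompletion_coe, ipCompletion_coe, ipCompletion_coe, P.form_act]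
  ip_self_nonneg x := by
    let _ := CStarAlgebra.spectralOrder B
    have := CStarAlgebra.spectralOrderedRing B
    refine CStarAlgebra.nonneg_iff_eq_star_mul_self.mp ?_
    refine P.denseRange_toHilbert.induction_on (p := fun x => 0 ≤ P.ipCompletion x x) x ?_
      fun x => ?_
    · have h : Continuous fun x => P.ipCompletion x x := by fun_prop
      exact CStarAlgebra.isClosed_nonneg.preimage h
    · rw [ipCompletion_coe]
      exact CStarAlgebra.nonneg_iff_eq_star_mul_self.mpr (P.form_self x)
  norm_sq x := by
    refine P.denseRange_toHilbert.induction_on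
      (p := fun x => ‖x‖ ^ 2 = ‖P.ipCompletion x x‖) x ?_ fun x => ?_
    · exact isClosed_eq (by fun_prop) (by fun_prop)
    · rw [ipCompletion_coe, norm_sq_toHilbert]

end PreHilbertModule

/-! ### The Hilbert `C(X)`-module `C(X) ⊗ H = C(X, H)` -/

section FunctionModule

variable {X H : Type*} [TopologicalSpace X] [NormedAddCommGroup H] [InnerProductSpace ℂ H]

/-- The `C(X)`-valued inner product of `C(X, H)`. -/
def fip (ξ η : C(X, H)) : C(X, ℂ) := ⟨fun x => ⟪ξ x, η x⟫_ℂ, by fun_prop⟩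

@[simp] theorem fip_apply (ξ η : C(X, H)) (x : X) : fip ξ η x = ⟪ξ x, η x⟫_ℂ := rfl

theorem fip_add_right (ξ η ζ : C(X, H)) : fip ξ (η + ζ) = fip ξ η + fip ξ ζ := by
  ext x; simp

theorem fip_add_left (ξ η ζ : C(X, H)) : fip (ξ + η) ζ = fip ξ ζ + fip η ζ := by
  ext x; simp

theorem fip_smul_right (a : ℂ) (ξ η : C(X, H)) : fip ξ (a • η) = a • fip ξ η := by
  ext x; simp

theorem fip_smul_left (a : ℂ) (ξ η : C(X, H)) : fip (a • ξ) η = starRingEnd ℂ a • fip ξ η := by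
  ext x; simp [mul_comm]

theorem star_fip (ξ η : C(X, H)) : star (fip ξ η) = fip η ξ := by
  ext x; simp

theorem fip_mul_right (ξ η : C(X, H)) (f : C(X, ℂ)) : fip ξ (f • η) = fip ξ η * f := by
  ext x; simp [mul_comm]

@[simp] theorem fip_zero_right (ξ : C(X, H)) : fip ξ 0 = 0 := by ext x; simp
@[simp] theorem fip_zero_left (ξ : C(X, H)) : fip 0 ξ = 0 := by ext x; simp

theorem fip_sum_left {ι : Type*} (s : Finset ι) (f : ι → C(X, H)) (η : C(X, H)) :
    fip (∑ i ∈ s, f i) η = ∑ i ∈ s, fip (f i) η := by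
  classical
  induction s using Finset.induction_on with
  | empty => simp
  | insert a s ha ih => rw [Finset.sum_insert ha, Finset.sum_insert ha, fip_add_left, ih]

instance [CompactSpace X] [CompleteSpace H] : HilbertModule C(X, ℂ) C(X, H) where
  ip := fip
  rsmul ξ f := f • ξ
  ip_add_right := fip_add_right
  ip_smul_right := fip_smul_right
  star_ip := star_fip
  ip_rsmul_right ξ η f := fip_mul_right ξ η f
  ip_self_nonneg ξ := ⟨⟨fun x => (‖ξ x‖ : ℂ), by fun_prop⟩, by
    ext x; simp [inner_self_eq_norm_sq_to_K, sq]⟩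
  norm_sq ξ := by
    refine le_antisymm ?_ ?_
    · have : ‖ξ‖ ≤ √‖fip ξ ξ‖ := by
        refine (ContinuousMap.norm_le _ (Real.sqrt_nonneg _)).mpr fun x => Real.le_sqrt_of_sq_le ?_
        have := (fip ξ ξ).norm_coe_le_norm x
        rwa [fip_apply, inner_self_eq_norm_sq_to_K, norm_pow, RCLike.norm_ofReal,
          abs_of_nonneg (norm_nonneg _)] at this
      calc ‖ξ‖ ^ 2 ≤ (√‖fip ξ ξ‖) ^ 2 := by gcongr
        _ = _ := Real.sq_sqrt (norm_nonneg _)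
    · refine (ContinuousMap.norm_le _ (by positivity)).mpr fun x => ?_
      rw [fip_apply, inner_self_eq_norm_sq_to_K, norm_pow, RCLike.norm_ofReal,
          abs_of_nonneg (norm_nonneg _)]
      gcongr
      exact ξ.norm_coe_le_norm x

end FunctionModule

/-! ### Crossed products -/

/-- An action of the discrete group `Γ` on the `C⋆`-algebra `A` by `⋆`-automorphisms. -/
structure CStarAction (Γ A : Type*) [Group Γ] [NonUnitalCStarAlgebra A] where
  act : Γ → A →⋆ₙₐ[ℂ] A
  act_one (a : A) : act 1 a = a
  act_mul (γ μ : Γ) (a : A) : act (γ * μ) a = act γ (act μ a)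

namespace CStarAction

variable {Γ A : Type*} [Group Γ] [NonUnitalCStarAlgebra A] (α : CStarAction Γ A)

/-- The convolution product `(f * g)(γ) = ∑ μ, f(μ) μ(g(μ⁻¹γ))` of `C_c(Γ, A)`. -/
def conv (f g : Γ →₀ A) : Γ →₀ A :=
  f.sum fun μ a => g.sum fun ν b => Finsupp.single (μ * ν) (a * α.act μ b)

/-- The involution `f⋆(γ) = γ(f(γ⁻¹))⋆` of `C_c(Γ, A)`. -/
def invol (f : Γ →₀ A) : Γ →₀ A :=
  f.sum fun μ a => Finsupp.single μ⁻¹ (α.act μ⁻¹ (star a))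

theorem conv_add_left (f f' g : Γ →₀ A) : α.conv (f + f') g = α.conv f g + α.conv f' g := by
  classical
  refine Finsupp.sum_add_index' (fun μ => ?_) fun μ a b => ?_
  · simp
  · simp [add_mul]

theorem conv_add_right (f g g' : Γ →₀ A) : α.conv f (g + g') = α.conv f g + α.conv f g' := by
  classical
  rw [conv, conv, conv, ← Finsupp.sum_add]
  refine Finsupp.sum_congr fun μ _ => ?_
  refine Finsupp.sum_add_index' (fun ν => ?_) fun ν a b => ?_
  · simp
  · simp [mul_add]

theorem conv_single (μ ν : Γ) (a b : A) :
    α.conv (.single μ a) (.single ν b) = .single (μ * ν) (a * α.act μ b) := by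
  simp [conv]

@[simp] theorem conv_zero_left (g : Γ →₀ A) : α.conv 0 g = 0 := by simp [conv]
@[simp] theorem conv_zero_right (g : Γ →₀ A) : α.conv g 0 = 0 := by simp [conv]

theorem conv_single_right_apply (f : Γ →₀ A) (ν : Γ) (b : A) (γ : Γ) :
    α.conv f (.single ν b) γ = f (γ * ν⁻¹) * α.act (γ * ν⁻¹) b := by
  classical
  induction f using Finsupp.induction_linear with
  | zero => simp
  | add f g hf hg => simp [conv_add_left, hf, hg, add_mul]
  | single μ a =>
    rw [conv_single, Finsupp.single_apply, Finsupp.single_apply]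
    by_cases h : μ * ν = γ
    · subst h; simp
    · have : ¬ μ = γ * ν⁻¹ := fun h' => h (by rw [h']; group)
      simp [h, this]

theorem invol_add (f g : Γ →₀ A) : α.invol (f + g) = α.invol f + α.invol g := by
  classical
  refine Finsupp.sum_add_index' (fun μ => ?_) fun μ a b => ?_
  · simp
  · simp

@[simp] theorem invol_zero : α.invol 0 = 0 := by simp [invol]

theorem invol_single (μ : Γ) (a : A) :
    α.invol (.single μ a) = .single μ⁻¹ (α.act μ⁻¹ (star a)) := by
  simp [invol]

theorem invol_apply (f : Γ →₀ A) (γ : Γ) : α.invol f γ = α.act γ (star (f γ⁻¹)) := by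
  classical
  induction f using Finsupp.induction_linear with
  | zero => simp
  | add f g hf hg => simp [invol_add, hf, hg]
  | single μ a =>
    rw [invol_single, Finsupp.single_apply, Finsupp.single_apply]
    by_cases h : μ⁻¹ = γ
    · subst h; simp
    · have : ¬ μ = γ⁻¹ := fun h' => h (by rw [h']; group)
      simp [h, this]

end CStarAction

/-- A `C⋆`-completion `A ⋊ Γ` of the convolution `⋆`-algebra `C_c(Γ, A)`: a `C⋆`-algebra with a
`⋆`-homomorphism `ι` of dense range from `C_c(Γ, A)`, whose norm dominates the reduced norm. The
latter is the operator norm of the left convolution by `f` on the Hilbert `A`-module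
`L²(Γ, A)`, which is the completion of `C_c(Γ, A)` for the inner product
`⟨ξ, η⟩ = (ξ⋆ * η)(1)`. In particular `ι` is injective. The norm of a `C⋆`-completion is
automatically dominated by the maximal norm, by definition of the latter. -/
structure CrossedProduct {Γ : Type v} {A : Type u} [Group Γ] [NonUnitalCStarAlgebra A]
    (α : CStarAction Γ A) where
  carrier : Type t
  [cstar : NonUnitalCStarAlgebra carrier]
  ι : (Γ →₀ A) →ₗ[ℂ] carrier
  ι_conv (f g : Γ →₀ A) : ι (α.conv f g) = ι f * ι g
  ι_invol (f : Γ →₀ A) : ι (α.invol f) = star (ι f)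
  dense : DenseRange ι
  reduced_le (f ξ : Γ →₀ A) :
    ‖α.conv (α.invol (α.conv f ξ)) (α.conv f ξ) 1‖ ≤ ‖ι f‖ ^ 2 * ‖α.conv (α.invol ξ) ξ 1‖

attribute [instance] CrossedProduct.cstar

/-- An admissible crossed product functor for `Γ`: a `C⋆`-completion of `C_c(Γ, A)`, lying between
the maximal and the reduced crossed products, for every `Γ`-algebra `A`, such that every equivariant
`⋆`-homomorphism `A → B` induces a `⋆`-homomorphism `A ⋊ Γ → B ⋊ Γ`. -/
structure CrossedProductFunctor (Γ : Type v) [Group Γ] where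
  obj {A : Type u} [NonUnitalCStarAlgebra A] (α : CStarAction Γ A) : CrossedProduct.{u, v, t} α
  map_le {A B : Type u} [NonUnitalCStarAlgebra A] [NonUnitalCStarAlgebra B]
    (α : CStarAction Γ A) (β : CStarAction Γ B) (φ : A →⋆ₙₐ[ℂ] B)
    (hφ : ∀ γ a, φ (α.act γ a) = β.act γ (φ a)) (f : Γ →₀ A) :
    ‖(obj β).ι (f.mapRange φ (map_zero φ))‖ ≤ ‖(obj α).ι f‖

/-! ### The free module `(C(X) ⊗ H) ⋊ Γ` -/

section FreeModule

variable {Γ : Type v} {X : Type u} {H : Type w} [Group Γ] [TopologicalSpace X] [CompactSpace X]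
  [MulAction Γ X] [ContinuousConstSMul Γ X]
  [NormedAddCommGroup H] [InnerProductSpace ℂ H]

variable (Γ X) in
/-- The action `(γ f)(x) = f(γ⁻¹ x)` of `Γ` on `C(X)`. -/
def actX : CStarAction Γ C(X, ℂ) where
  act γ :=
    { toFun := fun f => ⟨fun x => f (γ⁻¹ • x), by fun_prop⟩
      map_smul' := fun _ _ => rfl
      map_zero' := rfl
      map_add' := fun _ _ => rfl
      map_mul' := fun _ _ => rfl
      map_star' := fun _ => rfl }
  act_one f := by ext x; change f ((1 : Γ)⁻¹ • x) = f x; simp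
  act_mul γ μ f := by
    ext x
    change f ((γ * μ)⁻¹ • x) = f (μ⁻¹ • γ⁻¹ • x)
    rw [mul_inv_rev, mul_smul]

@[simp] theorem actX_apply (γ : Γ) (f : C(X, ℂ)) (x : X) :
    (actX Γ X).act γ f x = f (γ⁻¹ • x) := rfl

/-- The `C_c(X × Γ)`-valued inner product
`⟨ξ, η⟩(x, γ) = ∑ μ, ⟨ξ(μ x, μ), η(μ x, μ γ)⟩` of `C_c(X × Γ, H) = C_c(Γ, C(X, H))`. -/
def freeForm (ξ η : Γ →₀ C(X, H)) : Γ →₀ C(X, ℂ) :=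
  ξ.sum fun μ a => η.sum fun ν b => .single (μ⁻¹ * ν) ((actX Γ X).act μ⁻¹ (fip a b))

/-- The right action `(ξ f)(x, γ) = ∑ μ, ξ(x, μ) f(μ⁻¹ x, μ⁻¹ γ)` of `C_c(X × Γ)` on
`C_c(X × Γ, H)`. -/
def freeAct (ξ : Γ →₀ C(X, H)) (f : Γ →₀ C(X, ℂ)) : Γ →₀ C(X, H) :=
  ξ.sum fun μ a => f.sum fun ν b => .single (μ * ν) ((actX Γ X).act μ b • a)

theorem freeForm_single (μ ν : Γ) (a b : C(X, H)) : freeForm (.single μ a) (.single ν b) =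
    .single (μ⁻¹ * ν) ((actX Γ X).act μ⁻¹ (fip a b)) := by
  simp [freeForm]

theorem freeAct_single (μ ν : Γ) (a : C(X, H)) (b : C(X, ℂ)) :
    freeAct (.single μ a) (.single ν b) = .single (μ * ν) ((actX Γ X).act μ b • a) := by
  simp [freeAct]

theorem freeForm_add_left (ξ ξ' η : Γ →₀ C(X, H)) :
    freeForm (ξ + ξ') η = freeForm ξ η + freeForm ξ' η := by
  classical
  refine Finsupp.sum_add_index' (fun μ => ?_) fun μ a b => ?_
  · simp
  · simp [fip_add_left]

theorem freeForm_add_right (ξ η η' : Γ →₀ C(X, H)) :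
    freeForm ξ (η + η') = freeForm ξ η + freeForm ξ η' := by
  classical
  rw [freeForm, freeForm, freeForm, ← Finsupp.sum_add]
  refine Finsupp.sum_congr fun μ _ => ?_
  refine Finsupp.sum_add_index' (fun ν => ?_) fun ν a b => ?_
  · simp
  · simp [fip_add_right]

@[simp] theorem freeForm_zero_left (η : Γ →₀ C(X, H)) : freeForm 0 η = 0 := by simp [freeForm]
@[simp] theorem freeForm_zero_right (η : Γ →₀ C(X, H)) : freeForm η 0 = 0 := by simp [freeForm]

theorem freeForm_smul_left (c : ℂ) (ξ η : Γ →₀ C(X, H)) :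
    freeForm (c • ξ) η = starRingEnd ℂ c • freeForm ξ η := by
  induction ξ using Finsupp.induction_linear with
  | zero => simp
  | add ξ ξ' h h' => rw [smul_add, freeForm_add_left, h, h', freeForm_add_left, smul_add]
  | single μ a =>
    induction η using Finsupp.induction_linear with
    | zero => simp
    | add η η' h h' => rw [freeForm_add_right, h, h', freeForm_add_right, smul_add]
    | single ν b => simp [freeForm_single, fip_smul_left]

theorem freeForm_smul_right (c : ℂ) (ξ η : Γ →₀ C(X, H)) :
    freeForm ξ (c • η) = c • freeForm ξ η := by
  induction ξ using Finsupp.induction_linear with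
  | zero => simp
  | add ξ ξ' h h' => rw [freeForm_add_left, h, h', freeForm_add_left, smul_add]
  | single μ a =>
    induction η using Finsupp.induction_linear with
    | zero => simp
    | add η η' h h' => rw [smul_add, freeForm_add_right, h, h', freeForm_add_right, smul_add]
    | single ν b => simp [freeForm_single, fip_smul_right]

theorem freeAct_add_left (ξ ξ' : Γ →₀ C(X, H)) (f : Γ →₀ C(X, ℂ)) :
    freeAct (ξ + ξ') f = freeAct ξ f + freeAct ξ' f := by
  classical
  refine Finsupp.sum_add_index' (fun μ => ?_) fun μ a b => ?_
  · simp
  · simp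

theorem freeAct_add_right (ξ : Γ →₀ C(X, H)) (f f' : Γ →₀ C(X, ℂ)) :
    freeAct ξ (f + f') = freeAct ξ f + freeAct ξ f' := by
  classical
  rw [freeAct, freeAct, freeAct, ← Finsupp.sum_add]
  refine Finsupp.sum_congr fun μ _ => ?_
  refine Finsupp.sum_add_index' (fun ν => ?_) fun ν a b => ?_
  · simp
  · simp [add_smul]

@[simp] theorem freeAct_zero_left (f : Γ →₀ C(X, ℂ)) : freeAct (0 : Γ →₀ C(X, H)) f = 0 := by
  simp [freeAct]
@[simp] theorem freeAct_zero_right (ξ : Γ →₀ C(X, H)) : freeAct ξ 0 = 0 := by simp [freeAct]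

theorem freeAct_smul_left (c : ℂ) (ξ : Γ →₀ C(X, H)) (f : Γ →₀ C(X, ℂ)) :
    freeAct (c • ξ) f = c • freeAct ξ f := by
  induction ξ using Finsupp.induction_linear with
  | zero => simp
  | add ξ ξ' h h' => rw [smul_add, freeAct_add_left, h, h', freeAct_add_left, smul_add]
  | single μ a =>
    induction f using Finsupp.induction_linear with
    | zero => simp
    | add η η' h h' => rw [freeAct_add_right, h, h', freeAct_add_right, smul_add]
    | single ν b => rw [Finsupp.smul_single, freeAct_single, freeAct_single, Finsupp.smul_single,
        show ∀ f : C(X, ℂ), f • c • a = c • f • a from fun f => by ext x; simp [smul_comm c]]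

theorem freeAct_smul_right (c : ℂ) (ξ : Γ →₀ C(X, H)) (f : Γ →₀ C(X, ℂ)) :
    freeAct ξ (c • f) = c • freeAct ξ f := by
  induction ξ using Finsupp.induction_linear with
  | zero => simp
  | add ξ ξ' h h' => rw [freeAct_add_left, h, h', freeAct_add_left, smul_add]
  | single μ a =>
    induction f using Finsupp.induction_linear with
    | zero => simp
    | add η η' h h' => rw [smul_add, freeAct_add_right, h, h', freeAct_add_right, smul_add]
    | single ν b => rw [Finsupp.smul_single, freeAct_single, freeAct_single, Finsupp.smul_single,
        map_smul, show ∀ f : C(X, ℂ), (c • f) • a = c • f • a from fun f => by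
          ext x; simp [mul_smul]]

theorem invol_freeForm (ξ η : Γ →₀ C(X, H)) : (actX Γ X).invol (freeForm ξ η) = freeForm η ξ := by
  induction ξ using Finsupp.induction_linear with
  | zero => simp
  | add ξ ξ' h h' => rw [freeForm_add_left, CStarAction.invol_add, h, h', freeForm_add_right]
  | single μ a =>
    induction η using Finsupp.induction_linear with
    | zero => simp
    | add η η' h h' => rw [freeForm_add_right, CStarAction.invol_add, h, h', freeForm_add_left]
    | single ν b =>
      rw [freeForm_single, freeForm_single, CStarAction.invol_single, ← map_star, star_fip,
        ← CStarAction.act_mul]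
      simp

theorem freeForm_freeAct (ξ η : Γ →₀ C(X, H)) (f : Γ →₀ C(X, ℂ)) :
    freeForm ξ (freeAct η f) = (actX Γ X).conv (freeForm ξ η) f := by
  induction ξ using Finsupp.induction_linear with
  | zero => simp
  | add ξ ξ' h h' => rw [freeForm_add_left, freeForm_add_left, CStarAction.conv_add_left, h, h']
  | single μ a =>
    induction η using Finsupp.induction_linear with
    | zero => simp
    | add η η' h h' => rw [freeForm_add_right, freeAct_add_left, freeForm_add_right,
        CStarAction.conv_add_left, h, h']
    | single ν b =>
      induction f using Finsupp.induction_linear with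
      | zero => simp
      | add f f' h h' => rw [freeAct_add_right, freeForm_add_right, CStarAction.conv_add_right, h, h']
      | single κ f =>
        rw [freeAct_single, freeForm_single, freeForm_single, CStarAction.conv_single,
          fip_mul_right, map_mul, ← CStarAction.act_mul, mul_assoc]

theorem freeForm_apply (ξ η : Γ →₀ C(X, H)) (γ : Γ) :
    freeForm ξ η γ = ξ.sum fun μ a => (actX Γ X).act μ⁻¹ (fip a (η (μ * γ))) := by
  classical
  induction ξ using Finsupp.induction_linear with
  | zero => simp
  | add ξ ξ' h h' =>
    rw [freeForm_add_left, Finsupp.add_apply, h, h']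
    refine (Finsupp.sum_add_index' (fun μ => ?_) fun μ a b => ?_).symm
    · simp
    · simp [fip_add_left]
  | single μ a =>
    rw [Finsupp.sum_single_index (by simp)]
    induction η using Finsupp.induction_linear with
    | zero => simp
    | add η η' h h' => simp [freeForm_add_right, h, h', fip_add_right]
    | single ν b =>
      rw [freeForm_single, Finsupp.single_apply, Finsupp.single_apply]
      by_cases h : ν = μ * γ
      · subst h; simp
      · have : ¬ μ⁻¹ * ν = γ := fun h' => h (by rw [← h']; group)
        simp [h, this]

/-- Elements of `C(X, H)` are uniformly approximated by their projections to finite dimensional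
subspaces of `H`. -/
theorem exists_finiteDimensional_approx (s : Finset C(X, H)) {ε : ℝ} (hε : 0 < ε) :
    ∃ K : Submodule ℂ H, ∃ _ : FiniteDimensional ℂ K, ∀ ξ ∈ s, ∀ x,
      ‖ξ x - K.starProjection (ξ x)‖ ≤ ε := by
  have hc : IsCompact (⋃ ξ ∈ s, Set.range ξ) :=
    s.finite_toSet.isCompact_biUnion fun ξ _ => isCompact_range ξ.continuous
  obtain ⟨t, -, ht, hcov⟩ := hc.finite_cover_balls hε
  refine ⟨Submodule.span ℂ t, FiniteDimensional.span_of_finite ℂ ht, fun ξ hξ x => ?_⟩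
  have hx : ξ x ∈ ⋃ ξ ∈ s, Set.range ξ := Set.mem_biUnion hξ ⟨x, rfl⟩
  obtain ⟨y, hy, hxy⟩ := Set.mem_iUnion₂.mp (hcov hx)
  have := FiniteDimensional.span_of_finite ℂ ht
  rw [Submodule.starProjection_minimal]
  refine (ciInf_le ⟨0, by rintro _ ⟨z, rfl⟩; positivity⟩
    (⟨y, Submodule.subset_span hy⟩ : Submodule.span ℂ t)).trans ?_
  rw [Metric.mem_ball, dist_eq_norm] at hxy
  exact hxy.le

variable (C : CrossedProduct.{u, v, t} (actX Γ X))

theorem norm_ι_single_le {A : Type u} [NonUnitalCStarAlgebra A] {α : CStarAction Γ A}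
    (C : CrossedProduct.{u, v, t} α) (γ : Γ) (a : A) : ‖C.ι (.single γ a)‖ ≤ ‖a‖ := by
  let j : A →⋆ₙₐ[ℂ] C.carrier :=
    { toFun := fun a => C.ι (.single 1 a)
      map_smul' := fun c a => by simp [← map_smul]
      map_zero' := by simp
      map_add' := fun a b => by simp
      map_mul' := fun a b => by
        rw [← C.ι_conv, CStarAction.conv_single, α.act_one, one_mul]
      map_star' := fun a => by
        rw [← C.ι_invol, CStarAction.invol_single, inv_one, α.act_one] }
  have h1 : ∀ a, ‖C.ι (.single 1 a)‖ ≤ ‖a‖ := NonUnitalStarAlgHom.norm_apply_le j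
  have h2 : C.ι (.single γ a) * star (C.ι (.single γ a)) = C.ι (.single 1 (a * star a)) := by
    rw [← C.ι_invol, ← C.ι_conv, CStarAction.invol_single, CStarAction.conv_single,
      ← α.act_mul, mul_inv_cancel, α.act_one]
  refine le_of_sq_le_sq ?_ (norm_nonneg _)
  rw [sq, ← CStarRing.norm_self_mul_star, h2, sq, ← CStarRing.norm_self_mul_star]
  exact h1 _

theorem norm_act_le {A : Type u} [NonUnitalCStarAlgebra A] (α : CStarAction Γ A) (γ : Γ) (a : A) :
    ‖α.act γ a‖ ≤ ‖a‖ := NonUnitalStarAlgHom.norm_apply_le (α.act γ) a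

/-- Composition of the elements of `C(X, H)` with the orthogonal projection to `K`. -/
def compress (K : Submodule ℂ H) [FiniteDimensional ℂ K] (a : C(X, H)) : C(X, H) :=
  ⟨fun x => K.starProjection (a x), by fun_prop⟩

/-- The coordinate of the elements of `C(X, H)` along `h`. -/
def coord (h : H) (a : C(X, H)) : C(X, ℂ) := ⟨fun x => ⟪h, a x⟫_ℂ, by fun_prop⟩

theorem fip_compress (K : Submodule ℂ H) [FiniteDimensional ℂ K] (a b : C(X, H)) :
    fip (compress K a) (compress K b) = ∑ i, star (coord (stdOrthonormalBasis ℂ K i : H) a) *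
      coord (stdOrthonormalBasis ℂ K i : H) b := by
  ext x
  have h := (stdOrthonormalBasis ℂ K).sum_inner_mul_inner (K.orthogonalProjectionOnto (a x))
    (K.orthogonalProjectionOnto (b x))
  have h1 : fip (compress K a) (compress K b) x =
      ⟪K.orthogonalProjectionOnto (a x), K.orthogonalProjectionOnto (b x)⟫_ℂ := rfl
  rw [h1, ← h, ContinuousMap.sum_apply]
  refine Finset.sum_congr rfl fun i _ => ?_
  simp [coord]

theorem freeForm_compress_nonneg [PartialOrder C.carrier] [StarOrderedRing C.carrier]
    (K : Submodule ℂ H) [FiniteDimensional ℂ K] (ξ : Γ →₀ C(X, H)) (h0 : compress K 0 = (0 : C(X, H))) :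
    0 ≤ C.ι (freeForm (ξ.mapRange (compress K) h0) (ξ.mapRange (compress K) h0)) := by
  have hc0 : ∀ h : H, coord h (0 : C(X, H)) = 0 := fun h => by ext x; simp [coord]
  have hadd : ∀ a b : C(X, H), compress K (a + b) = compress K a + compress K b := fun a b => by
    ext x; simp [compress]
  have hcadd : ∀ (h : H) (a b : C(X, H)), coord h (a + b) = coord h a + coord h b :=
    fun h a b => by ext x; simp [coord]
  have key : ∀ ξ η : Γ →₀ C(X, H),
      freeForm (ξ.mapRange (compress K) h0) (η.mapRange (compress K) h0) =
      ∑ i, (actX Γ X).conv ((actX Γ X).invol (ξ.mapRange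
        (coord (stdOrthonormalBasis ℂ K i : H)) (hc0 _)))
        (η.mapRange (coord (stdOrthonormalBasis ℂ K i : H)) (hc0 _)) := by
    intro ξ η
    induction ξ using Finsupp.induction_linear with
    | zero => simp
    | add ξ ξ' h h' =>
      simp only [Finsupp.mapRange_add (hf := h0) hadd, Finsupp.mapRange_add (hf := hc0 _) (hcadd _),
        freeForm_add_left, h, h', CStarAction.invol_add, CStarAction.conv_add_left,
        Finset.sum_add_distrib]
    | single μ a =>
      induction η using Finsupp.induction_linear with
      | zero => simp
      | add η η' h h' =>
        simp only [Finsupp.mapRange_add (hf := h0) hadd,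
          Finsupp.mapRange_add (hf := hc0 _) (hcadd _), freeForm_add_right, h, h',
          CStarAction.conv_add_right, Finset.sum_add_distrib]
      | single ν b =>
        simp only [Finsupp.mapRange_single, freeForm_single, CStarAction.invol_single,
          CStarAction.conv_single, fip_compress, ← map_mul, map_sum]
        exact map_sum (Finsupp.singleAddHom (μ⁻¹ * ν)) _ _
  rw [key, map_sum]
  refine Finset.sum_nonneg fun i _ => ?_
  rw [C.ι_conv, C.ι_invol]
  exact star_mul_self_nonneg _

theorem continuous_fip [T2Space X] :
    Continuous fun p : C(X, H) × C(X, H) => fip p.1 p.2 := by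
  refine ContinuousMap.continuous_of_continuous_uncurry _ ?_
  change Continuous fun q : (C(X, H) × C(X, H)) × X => ⟪q.1.1 q.2, q.1.2 q.2⟫_ℂ
  fun_prop

/-- The inner product of `C_c(X × Γ, H)` is positive in every completion of `C_c(X × Γ)`. -/
theorem freeForm_self [T2Space X] (ξ : Γ →₀ C(X, H)) :
    ∃ b, C.ι (freeForm ξ ξ) = star b * b := by
  let _ := CStarAlgebra.spectralOrder C.carrier
  have := CStarAlgebra.spectralOrderedRing C.carrier
  rw [← CStarAlgebra.nonneg_iff_eq_star_mul_self]
  classical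
  let Φ : (Γ → C(X, H)) → C.carrier := fun a => ∑ μ ∈ ξ.support, ∑ ν ∈ ξ.support,
    C.ι (.single (μ⁻¹ * ν) ((actX Γ X).act μ⁻¹ (fip (a μ) (a ν))))
  have hΦ : Continuous Φ := by
    refine continuous_finsetSum _ fun μ _ => continuous_finsetSum _ fun ν _ => ?_
    let j : C(X, ℂ) →L[ℂ] C.carrier := LinearMap.mkContinuous
      { toFun := fun a => C.ι (.single (μ⁻¹ * ν) ((actX Γ X).act μ⁻¹ a))
        map_add' := fun a b => by simp
        map_smul' := fun c a => by
          rw [map_smul, ← Finsupp.smul_single, map_smul, RingHom.id_apply] } 1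
      fun a => by
        rw [one_mul]
        exact (norm_ι_single_le C _ _).trans (norm_act_le _ _ _)
    have h := (continuous_fip (X := X) (H := H)).comp
      ((continuous_apply (A := fun _ : Γ => C(X, H)) μ).prodMk (continuous_apply ν))
    exact j.continuous.comp h
  have hξ : ∀ f : C(X, H) → C(X, H), ∀ h0 : f 0 = 0,
      C.ι (freeForm (ξ.mapRange f h0) (ξ.mapRange f h0)) = Φ (fun μ => f (ξ μ)) := by
    intro f h0
    have hs : (ξ.mapRange f h0).support ⊆ ξ.support := Finsupp.support_mapRange
    have : freeForm (ξ.mapRange f h0) (ξ.mapRange f h0) =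
        ∑ μ ∈ ξ.support, ∑ ν ∈ ξ.support,
          Finsupp.single (μ⁻¹ * ν) ((actX Γ X).act μ⁻¹ (fip (f (ξ μ)) (f (ξ ν)))) := by
      rw [freeForm, Finsupp.sum_of_support_subset _ hs _ (by simp)]
      refine Finset.sum_congr rfl fun μ _ => ?_
      rw [Finsupp.sum_of_support_subset _ hs _ (by simp)]
      rfl
    rw [this, map_sum]
    simp only [map_sum]
    rfl
  have hid := hξ id rfl
  rw [Finsupp.mapRange_id] at hid
  rw [hid]
  have h0 : ∀ (K : Submodule ℂ H) [FiniteDimensional ℂ K], compress K 0 = (0 : C(X, H)) :=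
    fun K _ => by ext x; simp [compress]
  choose K hK hKξ using fun n : ℕ =>
    exists_finiteDimensional_approx (ξ.support.image ξ) (Nat.one_div_pos_of_nat (n := n) (α := ℝ))
  have hlim : Filter.Tendsto (fun n μ => compress (K n) (ξ μ)) Filter.atTop (nhds fun μ => ξ μ) := by
    refine tendsto_pi_nhds.mpr fun μ => tendsto_iff_dist_tendsto_zero.mpr ?_
    refine squeeze_zero (fun _ => dist_nonneg) (fun n => ?_) tendsto_one_div_add_atTop_nhds_zero_nat
    rw [dist_comm, ContinuousMap.dist_le (by positivity)]
    intro x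
    by_cases hμ : μ ∈ ξ.support
    · rw [dist_eq_norm]
      exact hKξ n _ (Finset.mem_image_of_mem _ hμ) x
    · rw [Finsupp.notMem_support_iff.mp hμ, h0, dist_self]
      positivity
  have hmem : (fun μ => ξ μ) ∈ closure {a : Γ → C(X, H) | 0 ≤ Φ a} := by
    refine mem_closure_of_tendsto hlim (Filter.Eventually.of_forall fun n => ?_)
    change 0 ≤ Φ _
    rw [← hξ (compress (K n)) (h0 _)]
    exact freeForm_compress_nonneg C (K n) ξ (h0 _)
  exact (CStarAlgebra.isClosed_nonneg.preimage hΦ).closure_subset hmem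

/-- `C_c(X × Γ, H)` as a pre-Hilbert module over `C_c(X × Γ)`, relative to the completion `C`. -/
def freePreHilbert [T2Space X] : PreHilbertModule C.ι (Γ →₀ C(X, H)) where
  form := LinearMap.mk₂'ₛₗ (starRingEnd ℂ) (RingHom.id ℂ) freeForm freeForm_add_left
    freeForm_smul_left freeForm_add_right freeForm_smul_right
  act := LinearMap.mk₂ ℂ freeAct freeAct_add_left freeAct_smul_left freeAct_add_right
    freeAct_smul_right
  dense := C.dense
  star_form ξ η := by
    change star (C.ι (freeForm ξ η)) = C.ι (freeForm η ξ)
    rw [← C.ι_invol, invol_freeForm]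
  form_act ξ η f := by
    change C.ι (freeForm ξ (freeAct η f)) = C.ι (freeForm ξ η) * C.ι f
    rw [← C.ι_conv, freeForm_freeAct]
  form_self ξ := freeForm_self C ξ

variable (H) in
/-- The Hilbert `C(X) ⋊ Γ`-module `(C(X) ⊗ H) ⋊ Γ`. -/
abbrev FreeHilbert [T2Space X] : Type _ := (freePreHilbert (H := H) C).Hilbert

end FreeModule

/-! ### Equivariant representations of `C₀(Z × X)` -/

section Representation

variable {Γ : Type v} {X Z : Type u} {H : Type w} [Group Γ]
  [TopologicalSpace X] [CompactSpace X] [T2Space X] [MulAction Γ X] [ContinuousConstSMul Γ X]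
  [MetricSpace Z] [ProperSpace Z] [MulAction Γᵐᵒᵖ Z] [IsIsometricSMul Γᵐᵒᵖ Z]
  [NormedAddCommGroup H] [InnerProductSpace ℂ H] [CompleteSpace H]

variable (Γ X Z) in
/-- The action `(γ g)(z, x) = g(z γ, γ⁻¹ x)` of `Γ` on `C₀(Z × X)`. The right action of `Γ` on `Z`
is an action of the opposite group `Γᵐᵒᵖ`. -/
def actZX : CStarAction Γ C₀(Z × X, ℂ) where
  act γ :=
    { toFun := fun g => g.comp
        ⟨⟨fun p => (MulOpposite.op γ • p.1, γ⁻¹ • p.2), by fun_prop⟩,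
          ((Homeomorph.smul (MulOpposite.op γ)).prodCongr
            (Homeomorph.smul γ⁻¹)).isClosedEmbedding.tendsto_cocompact⟩
      map_smul' := fun _ _ => rfl
      map_zero' := rfl
      map_add' := fun _ _ => rfl
      map_mul' := fun _ _ => rfl
      map_star' := fun _ => rfl }
  act_one g := by
    ext p
    change g (MulOpposite.op (1 : Γ) • p.1, (1 : Γ)⁻¹ • p.2) = g p
    simp
  act_mul γ μ g := by
    ext p
    change g (MulOpposite.op (γ * μ) • p.1, (γ * μ)⁻¹ • p.2) =
      g (MulOpposite.op μ • MulOpposite.op γ • p.1, μ⁻¹ • γ⁻¹ • p.2)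
    rw [mul_inv_rev, MulOpposite.op_mul, mul_smul, mul_smul]

@[simp] theorem actZX_apply (γ : Γ) (g : C₀(Z × X, ℂ)) (z : Z) (x : X) :
    (actZX Γ X Z).act γ g (z, x) = g (MulOpposite.op γ • z, γ⁻¹ • x) := rfl

/-- The product `(f g)(z, x) = f(x) g(z, x)` of `f ∈ C(X)` and `g ∈ C₀(Z × X)`. -/
def mulX (f : C(X, ℂ)) (g : C₀(Z × X, ℂ)) : C₀(Z × X, ℂ) where
  toFun p := f p.2 * g p
  continuous_toFun := by fun_prop
  zero_at_infty' := by
    have h : Filter.Tendsto (fun p => ‖f‖ * ‖g p‖) (Filter.cocompact (Z × X)) (nhds 0) := by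
      simpa using (zero_at_infty g).norm.const_mul ‖f‖
    refine squeeze_zero_norm (fun p => ?_) h
    rw [norm_mul]
    gcongr
    exact f.norm_coe_le_norm _

/-- A compactly supported function on `Z`, regarded as an element of `C₀(Z × X)`. -/
def pullZ (φ : CompactlySupportedContinuousMap Z ℂ) : C₀(Z × X, ℂ) where
  toFun p := φ p.1
  continuous_toFun := by fun_prop
  zero_at_infty' := by
    have : HasCompactSupport fun p : Z × X => φ p.1 := by
      refine HasCompactSupport.intro (φ.hasCompactSupport.isCompact.prod isCompact_univ) ?_
      rintro ⟨z, x⟩ h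
      exact image_eq_zero_of_notMem_tsupport fun hz => h ⟨hz, trivial⟩
    exact this.is_zero_at_infty

/-- The action `(γ ξ)(x) = U_γ ξ(γ⁻¹ x)` of `Γ` on `C(X) ⊗ H = C(X, H)` attached to a unitary
representation `U` of `Γ` in `H`. -/
def translate (U : Γ →* (H ≃ₗᵢ[ℂ] H)) (γ : Γ) : C(X, H) →ₗ[ℂ] C(X, H) where
  toFun ξ := ⟨fun x => U γ (ξ (γ⁻¹ • x)), by fun_prop⟩
  map_add' _ _ := by ext; simp
  map_smul' _ _ := by ext; simp

@[simp] theorem translate_apply (U : Γ →* (H ≃ₗᵢ[ℂ] H)) (γ : Γ) (ξ : C(X, H)) (x : X) :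
    translate U γ ξ x = U γ (ξ (γ⁻¹ • x)) := rfl

variable (Γ X Z H) in
/-- A unitary representation `U` of `Γ` in `H` together with a fibrewise non-degenerate
`Γ`-equivariant `C(X)`-representation `π` of `C₀(Z × X)` in the Hilbert `C(X)`-module
`C(X) ⊗ H`. -/
structure EquivariantRep where
  U : Γ →* (H ≃ₗᵢ[ℂ] H)
  π : C₀(Z × X, ℂ) →ₙₐ[ℂ] (C(X, H) →L[ℂ] C(X, H))
  π_star (g : C₀(Z × X, ℂ)) (ξ η : C(X, H)) : fip (π (star g) ξ) η = fip ξ (π g η)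
  π_mulX (f : C(X, ℂ)) (g : C₀(Z × X, ℂ)) (ξ : C(X, H)) : π (mulX f g) ξ = π g (f • ξ)
  equivariant (γ : Γ) (g : C₀(Z × X, ℂ)) (ξ : C(X, H)) :
    π ((actZX Γ X Z).act γ g) (translate U γ ξ) = translate U γ (π g ξ)
  nondegenerate (x : X) :
    Dense (Submodule.span ℂ {h : H | ∃ g ξ, h = π g ξ x} : Set H)

/-- A cut-off function: a continuous compactly supported `c : Z → [0, 1]` with
`∑ γ, c(z γ) ^ 2 = 1` for all `z`. -/
structure Cutoff (Γ Z : Type*) [Group Γ] [TopologicalSpace Z] [MulAction Γᵐᵒᵖ Z] where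
  c : CompactlySupportedContinuousMap Z ℂ
  real (z : Z) : ∃ r : ℝ, 0 ≤ r ∧ r ≤ 1 ∧ c z = r
  sum_sq (z : Z) : HasSum (fun γ : Γ => c (MulOpposite.op γ • z) ^ 2) 1

end Representation

/-! ### The pre-Hilbert module `π(C_c(Z × X))(C(X) ⊗ H)` -/

section ConnesSkandalis

variable {Γ : Type v} {X Z : Type u} {H : Type w} [Group Γ]
  [TopologicalSpace X] [CompactSpace X] [T2Space X] [MulAction Γ X] [ContinuousConstSMul Γ X]
  [MetricSpace Z] [ProperSpace Z] [MulAction Γᵐᵒᵖ Z] [IsIsometricSMul Γᵐᵒᵖ Z]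
  [NormedAddCommGroup H] [InnerProductSpace ℂ H] [CompleteSpace H]

theorem translate_one (U : Γ →* (H ≃ₗᵢ[ℂ] H)) (ξ : C(X, H)) : translate U 1 ξ = ξ := by
  ext x; simp

theorem translate_mul (U : Γ →* (H ≃ₗᵢ[ℂ] H)) (γ μ : Γ) (ξ : C(X, H)) :
    translate U (γ * μ) ξ = translate U γ (translate U μ ξ) := by
  ext x; simp [mul_smul]

theorem translate_smul (U : Γ →* (H ≃ₗᵢ[ℂ] H)) (γ : Γ) (f : C(X, ℂ)) (ξ : C(X, H)) :
    translate U γ (f • ξ) = (actX Γ X).act γ f • translate U γ ξ := by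
  ext x; simp

theorem fip_translate (U : Γ →* (H ≃ₗᵢ[ℂ] H)) (γ : Γ) (ξ η : C(X, H)) :
    fip (translate U γ ξ) (translate U γ η) = (actX Γ X).act γ (fip ξ η) := by
  ext x; simp

theorem finite_mul_act_ne_zero [ProperlyDiscontinuousSMul Γᵐᵒᵖ Z] {g h : C₀(Z × X, ℂ)}
    (hg : HasCompactSupport g) (hh : HasCompactSupport h) :
    {γ : Γ | g * (actZX Γ X Z).act γ h ≠ 0}.Finite := by
  have hK := hg.isCompact.image continuous_fst
  have hL := hh.isCompact.image continuous_fst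
  refine ((ProperlyDiscontinuousSMul.finite_disjoint_inter_image (Γ := Γᵐᵒᵖ) hK hL).preimage
    (f := MulOpposite.op) MulOpposite.op_injective.injOn).subset ?_
  intro γ hγ
  obtain ⟨⟨z, x⟩, hp⟩ : ∃ p, (g * (actZX Γ X Z).act γ h) p ≠ 0 := by
    by_contra! hall
    exact hγ (ZeroAtInftyContinuousMap.ext hall)
  rw [ZeroAtInftyContinuousMap.mul_apply, actZX_apply] at hp
  have h1 := subset_tsupport g (left_ne_zero_of_mul hp)
  have h2 := subset_tsupport h (right_ne_zero_of_mul hp)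
  exact ⟨MulOpposite.op γ • z, ⟨z, ⟨_, h1, rfl⟩, rfl⟩, ⟨_, h2, rfl⟩⟩

theorem hasCompactSupport_act (γ : Γ) {g : C₀(Z × X, ℂ)} (hg : HasCompactSupport g) :
    HasCompactSupport ((actZX Γ X Z).act γ g) :=
  hg.comp_homeomorph ((Homeomorph.smul (MulOpposite.op γ)).prodCongr (Homeomorph.smul γ⁻¹))

theorem hasCompactSupport_pullZ (φ : CompactlySupportedContinuousMap Z ℂ) :
    HasCompactSupport (pullZ φ : C₀(Z × X, ℂ)) := by
  refine HasCompactSupport.intro (φ.hasCompactSupport.isCompact.prod isCompact_univ) ?_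
  rintro ⟨z, x⟩ h
  change φ z = 0
  exact image_eq_zero_of_notMem_tsupport fun hz => h ⟨hz, trivial⟩

variable (ρ : EquivariantRep Γ X Z H)

namespace EquivariantRep

theorem π_mulX' (f : C(X, ℂ)) (g : C₀(Z × X, ℂ)) (ξ : C(X, H)) :
    ρ.π (mulX f g) ξ = f • ρ.π g ξ := by
  have h : star (mulX (star f) (star g)) = mulX f g := by
    ext p
    change star (star (f p.2) * star (g p)) = f p.2 * g p
    simp
  have key : ∀ η, fip η (ρ.π (mulX f g) ξ) = fip η (f • ρ.π g ξ) := by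
    intro η
    rw [fip_mul_right, ← ρ.π_star, ← ρ.π_star, ← h, star_star, ρ.π_mulX]
    have : fip (star f • η) (ρ.π g ξ) = fip η (ρ.π g ξ) * f := by
      ext x; simp [mul_comm]
    rw [ρ.π_star, this, ρ.π_star]
  have := key (ρ.π (mulX f g) ξ - f • ρ.π g ξ)
  ext x
  have h2 := congrArg (fun F : C(X, ℂ) => F x) this
  simp only [fip_apply] at h2
  rw [← sub_eq_zero, ← inner_sub_right] at h2
  exact sub_eq_zero.mp (inner_self_eq_zero.mp h2)

/-- The subspace `π(C_c(Z × X))(C(X) ⊗ H)` of `C(X) ⊗ H`. -/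
def coreSpace : Submodule ℂ C(X, H) :=
  Submodule.span ℂ {v | ∃ g : C₀(Z × X, ℂ), HasCompactSupport g ∧ ∃ ξ, v = ρ.π g ξ}

theorem translate_mem (γ : Γ) {v : C(X, H)} (hv : v ∈ ρ.coreSpace) :
    translate ρ.U γ v ∈ ρ.coreSpace := by
  induction hv using Submodule.span_induction with
  | mem v hv =>
    obtain ⟨g, hg, ξ, rfl⟩ := hv
    rw [← ρ.equivariant]
    exact Submodule.subset_span ⟨_, hasCompactSupport_act γ hg, _, rfl⟩
  | zero => simp
  | add v w _ _ h h' => rw [map_add]; exact add_mem h h'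
  | smul a v _ h => rw [map_smul]; exact Submodule.smul_mem _ _ h

theorem smul_mem (f : C(X, ℂ)) {v : C(X, H)} (hv : v ∈ ρ.coreSpace) :
    f • v ∈ ρ.coreSpace := by
  induction hv using Submodule.span_induction with
  | mem v hv =>
    obtain ⟨g, hg, ξ, rfl⟩ := hv
    rw [← π_mulX', ρ.π_mulX]
    exact Submodule.subset_span ⟨_, hg, _, rfl⟩
  | zero => simp
  | add v w _ _ h h' => rw [smul_add]; exact add_mem h h'
  | smul a v _ h =>
    rw [show f • a • v = a • f • v by ext x; simp [smul_comm a]]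
    exact Submodule.smul_mem _ _ h

variable [ProperlyDiscontinuousSMul Γᵐᵒᵖ Z]

theorem finite_π_translate {g : C₀(Z × X, ℂ)} (hg : HasCompactSupport g) {v : C(X, H)}
    (hv : v ∈ ρ.coreSpace) : {γ : Γ | ρ.π g (translate ρ.U γ v) ≠ 0}.Finite := by
  induction hv using Submodule.span_induction with
  | mem v hv =>
    obtain ⟨h, hh, ξ, rfl⟩ := hv
    refine (finite_mul_act_ne_zero (Γ := Γ) hg hh).subset fun γ hγ h0 => hγ ?_
    rw [← ρ.equivariant, ← mul_apply_eq_comp, ← map_mul, h0, map_zero]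
    rfl
  | zero => simp
  | add v w _ _ h h' =>
    refine (h.union h').subset fun γ hγ => ?_
    by_contra hcon
    simp only [Set.mem_union, Set.mem_ofPred_eq, not_or, not_not] at hcon
    exact hγ (by rw [map_add, map_add, hcon.1, hcon.2, add_zero])
  | smul a v _ h =>
    refine h.subset fun γ hγ h0 => hγ ?_
    rw [map_smul, map_smul, h0, smul_zero]

theorem finite_fip_translate {v w : C(X, H)} (hv : v ∈ ρ.coreSpace) (hw : w ∈ ρ.coreSpace) :
    (Function.support fun γ : Γ => fip v (translate ρ.U γ w)).Finite := by
  induction hv using Submodule.span_induction with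
  | mem v hv =>
    obtain ⟨g, hg, ξ, rfl⟩ := hv
    have hg' : HasCompactSupport (star g : C₀(Z × X, ℂ)) :=
      hg.comp_left (g := star) (star_zero ℂ)
    refine (ρ.finite_π_translate hg' hw).subset fun γ hγ h0 => hγ ?_
    change fip _ _ = 0
    rw [← star_star g, ρ.π_star, h0, fip_zero_right]
  | zero => simp
  | add v v' _ _ h h' =>
    refine (h.union h').subset fun γ hγ => ?_
    by_contra hcon
    simp only [Set.mem_union, Function.mem_support, not_or, not_not] at hcon
    exact hγ (by change fip _ _ = 0; rw [fip_add_left, hcon.1, hcon.2, add_zero])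
  | smul a v _ h =>
    refine h.subset fun γ hγ h0 => hγ ?_
    change fip _ _ = 0
    change fip _ _ = 0 at h0
    rw [fip_smul_left, h0, smul_zero]

/-- The `C_c(X × Γ)`-valued inner product `⟨ξ, η⟩(x, γ) = ⟨ξ(x), U_γ η(γ⁻¹ x)⟩`. -/
def coreForm (v w : ρ.coreSpace) : Γ →₀ C(X, ℂ) :=
  Finsupp.ofSupportFinite (fun γ => fip (v : C(X, H)) (translate ρ.U γ w))
    (ρ.finite_fip_translate v.2 w.2)

theorem coreForm_apply (v w : ρ.coreSpace) (γ : Γ) :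
    ρ.coreForm v w γ = fip (v : C(X, H)) (translate ρ.U γ w) := rfl

/-- The right action `(ξ f)(x) = ∑ γ, f(γ x, γ) U_{γ⁻¹} ξ(γ x)` of `C_c(X × Γ)`. -/
def coreAct (v : ρ.coreSpace) (f : Γ →₀ C(X, ℂ)) : ρ.coreSpace :=
  f.sum fun γ a => ⟨translate ρ.U γ⁻¹ (a • (v : C(X, H))), ρ.translate_mem _ (ρ.smul_mem _ v.2)⟩

theorem coreAct_single (v : ρ.coreSpace) (γ : Γ) (a : C(X, ℂ)) :
    (ρ.coreAct v (.single γ a) : C(X, H)) = translate ρ.U γ⁻¹ (a • (v : C(X, H))) := by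
  rw [coreAct, Finsupp.sum_single_index]
  simp

theorem coreAct_add_right (v : ρ.coreSpace) (f f' : Γ →₀ C(X, ℂ)) :
    ρ.coreAct v (f + f') = ρ.coreAct v f + ρ.coreAct v f' := by
  classical
  refine Finsupp.sum_add_index' (fun μ => ?_) fun μ a b => ?_
  · simp
  · ext1; simp [add_smul]

@[simp] theorem coreAct_zero_right (v : ρ.coreSpace) : ρ.coreAct v 0 = 0 := by simp [coreAct]

theorem coreAct_smul_right (c : ℂ) (v : ρ.coreSpace) (f : Γ →₀ C(X, ℂ)) :
    ρ.coreAct v (c • f) = c • ρ.coreAct v f := by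
  induction f using Finsupp.induction_linear with
  | zero => simp
  | add η η' h h' => rw [smul_add, coreAct_add_right, h, h', coreAct_add_right, smul_add]
  | single ν b =>
    ext1
    rw [Finsupp.smul_single, coreAct_single, Submodule.coe_smul, coreAct_single, ← map_smul]
    congr 1
    ext x; simp [mul_smul]

theorem coreAct_add_left (v v' : ρ.coreSpace) (f : Γ →₀ C(X, ℂ)) :
    ρ.coreAct (v + v') f = ρ.coreAct v f + ρ.coreAct v' f := by
  induction f using Finsupp.induction_linear with
  | zero => simp
  | add η η' h h' => rw [coreAct_add_right, h, h', coreAct_add_right, coreAct_add_right]; abel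
  | single ν b => ext1; simp [coreAct_single]

theorem coreAct_smul_left (c : ℂ) (v : ρ.coreSpace) (f : Γ →₀ C(X, ℂ)) :
    ρ.coreAct (c • v) f = c • ρ.coreAct v f := by
  induction f using Finsupp.induction_linear with
  | zero => simp
  | add η η' h h' => rw [coreAct_add_right, h, h', coreAct_add_right, smul_add]
  | single ν b =>
    ext1
    rw [coreAct_single, Submodule.coe_smul, Submodule.coe_smul, coreAct_single, ← map_smul]
    congr 1
    ext x; simp [smul_comm c]

theorem invol_coreForm (v w : ρ.coreSpace) :
    (actX Γ X).invol (ρ.coreForm v w) = ρ.coreForm w v := by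
  ext1 γ
  rw [CStarAction.invol_apply, coreForm_apply, coreForm_apply, star_fip, ← fip_translate ρ.U,
    ← translate_mul, mul_inv_cancel, translate_one]

theorem coreForm_coreAct (v w : ρ.coreSpace) (f : Γ →₀ C(X, ℂ)) :
    ρ.coreForm v (ρ.coreAct w f) = (actX Γ X).conv (ρ.coreForm v w) f := by
  have hadd : ∀ a b, ρ.coreForm v (a + b) = ρ.coreForm v a + ρ.coreForm v b := by
    intro a b
    ext1 γ
    rw [Finsupp.add_apply, coreForm_apply, coreForm_apply, coreForm_apply, Submodule.coe_add,
      map_add, fip_add_right]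
  induction f using Finsupp.induction_linear with
  | zero => ext1 γ; simp [coreForm_apply]
  | add f f' h h' => rw [coreAct_add_right, hadd, h, h', CStarAction.conv_add_right]
  | single ν b =>
    ext1 γ
    rw [CStarAction.conv_single_right_apply, coreForm_apply, coreForm_apply, coreAct_single,
      ← translate_mul, translate_smul, fip_mul_right]

/-! The isometry `φ`, and the positivity of the inner product. -/

/-- The map `φ(ξ)(x, γ) = π_x(c) U_γ ξ(γ⁻¹ x)` attached to the cut-off function `c`. -/
def preIso (c : Cutoff Γ Z) (v : ρ.coreSpace) : Γ →₀ C(X, H) :=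
  Finsupp.ofSupportFinite (fun γ => ρ.π (pullZ c.c) (translate ρ.U γ v))
    (ρ.finite_π_translate (hasCompactSupport_pullZ c.c) v.2)

theorem preIso_apply (c : Cutoff Γ Z) (v : ρ.coreSpace) (γ : Γ) :
    ρ.preIso c v γ = ρ.π (pullZ c.c) (translate ρ.U γ v) := rfl

theorem star_pullZ_cutoff (c : Cutoff Γ Z) : star (pullZ c.c : C₀(Z × X, ℂ)) = pullZ c.c := by
  ext p
  obtain ⟨r, -, -, hr⟩ := c.real p.1
  change star (c.c p.1) = c.c p.1
  rw [hr]; simp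

theorem exists_sum_eq (c : Cutoff Γ Z) {v : C(X, H)} (hv : v ∈ ρ.coreSpace) :
    ∃ S : Finset Γ, ∀ T, S ⊆ T → ∑ μ ∈ T, ρ.π ((actZX Γ X Z).act μ⁻¹
      (pullZ c.c * pullZ c.c)) v = v := by
  classical
  induction hv using Submodule.span_induction with
  | mem v hv =>
    obtain ⟨g, hg, ξ, rfl⟩ := hv
    have hfin := (finite_mul_act_ne_zero (Γ := Γ) hg (hasCompactSupport_pullZ c.c)).preimage
      (f := fun γ : Γ => γ⁻¹) inv_injective.injOn
    refine ⟨hfin.toFinset, fun T hT => ?_⟩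
    have hz : ∀ μ ∉ T, g * (actZX Γ X Z).act μ⁻¹ (pullZ c.c) = 0 := by
      intro μ hμ
      by_contra hne
      exact hμ (hT (hfin.mem_toFinset.mpr hne))
    have : ∑ μ ∈ T, (actZX Γ X Z).act μ⁻¹ (pullZ c.c * pullZ c.c) * g = g := by
      ext ⟨z, x⟩
      have h1 : HasSum (fun μ : Γ => c.c (MulOpposite.op μ⁻¹ • z) ^ 2 * g (z, x)) (g (z, x)) := by
        have := ((Equiv.inv Γ).hasSum_iff.mpr (c.sum_sq z)).mul_right (g (z, x))
        rwa [one_mul] at this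
      have h2 : ∀ μ ∉ T, c.c (MulOpposite.op μ⁻¹ • z) ^ 2 * g (z, x) = 0 := by
        intro μ hμ
        have := congrArg (fun F : C₀(Z × X, ℂ) => F (z, x)) (hz μ hμ)
        have h3 : g (z, x) * c.c (MulOpposite.op μ⁻¹ • z) = 0 := this
        rw [sq, mul_assoc, mul_comm _ (g (z, x)), h3, mul_zero]
      have h3 := (hasSum_sum_of_ne_finset_zero h2).unique h1
      have h4 : ∀ F : Γ → C₀(Z × X, ℂ), (∑ μ ∈ T, F μ) (z, x) = ∑ μ ∈ T, F μ (z, x) := by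
        intro F
        exact map_sum (⟨⟨fun f : C₀(Z × X, ℂ) => f (z, x), rfl⟩, fun _ _ => rfl⟩ :
          C₀(Z × X, ℂ) →+ ℂ) F T
      rw [h4, ← h3]
      refine Finset.sum_congr rfl fun μ _ => ?_
      rw [sq]; rfl
    have h5 := congrArg (fun F => ρ.π F ξ) this
    simp only [map_sum, map_mul] at h5
    simpa using h5
  | zero => exact ⟨∅, by simp⟩
  | add v w _ _ h h' =>
    obtain ⟨S, hS⟩ := h
    obtain ⟨S', hS'⟩ := h'
    refine ⟨S ∪ S', fun T hT => ?_⟩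
    simp only [map_add, Finset.sum_add_distrib]
    rw [hS T (Finset.union_subset_left hT), hS' T (Finset.union_subset_right hT)]
  | smul a v _ h =>
    obtain ⟨S, hS⟩ := h
    refine ⟨S, fun T hT => ?_⟩
    simp only [map_smul, ← Finset.smul_sum]
    rw [hS T hT]

theorem freeForm_preIso (c : Cutoff Γ Z) (v w : ρ.coreSpace) :
    freeForm (ρ.preIso c v) (ρ.preIso c w) = ρ.coreForm v w := by
  classical
  ext1 γ
  obtain ⟨S, hS⟩ := ρ.exists_sum_eq c v.2
  have hv := hS _ (Finset.subset_union_right (s₁ := (ρ.preIso c v).support))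
  rw [freeForm_apply, coreForm_apply,
    Finsupp.sum_of_support_subset _ (Finset.subset_union_left (s₂ := S)) _ (by simp)]
  refine Eq.trans ?_ (congrArg (fun a => fip a (translate ρ.U γ (w : C(X, H)))) hv)
  rw [fip_sum_left]
  refine Finset.sum_congr rfl fun μ _ => ?_
  have h1 : ρ.π ((actZX Γ X Z).act μ⁻¹ (pullZ c.c * pullZ c.c)) (v : C(X, H)) =
      translate ρ.U μ⁻¹ (ρ.π (star (pullZ c.c)) (ρ.π (pullZ c.c) (translate ρ.U μ v))) := by
    rw [star_pullZ_cutoff, ← mul_apply_eq_comp, ← map_mul, ← ρ.equivariant, ← translate_mul,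
      inv_mul_cancel, translate_one]
  have h2 : translate ρ.U γ (w : C(X, H)) = translate ρ.U μ⁻¹ (translate ρ.U (μ * γ) w) := by
    rw [← translate_mul, inv_mul_cancel_left]
  rw [h1, h2, fip_translate, ρ.π_star, preIso_apply, preIso_apply]

end EquivariantRep

/-- A proper cocompact action on a proper metric space admits a cut-off function. -/
theorem exists_cutoff [ProperlyDiscontinuousSMul Γᵐᵒᵖ Z]
    [CompactSpace (Quotient (MulAction.orbitRel Γᵐᵒᵖ Z))] : Nonempty (Cutoff Γ Z) := by
  classical
  -- a compact set meeting all orbits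
  obtain ⟨K, hK, hKcov⟩ : ∃ K : Set Z, IsCompact K ∧ ∀ z, ∃ γ : Γ, MulOpposite.op γ • z ∈ K := by
    let q : Z → Quotient (MulAction.orbitRel Γᵐᵒᵖ Z) := Quotient.mk _
    have hq : IsOpenMap q := isOpenMap_quotient_mk'_mul
    obtain ⟨t, ht⟩ := isCompact_univ.elim_finite_subcover (fun z : Z => q '' Metric.ball z 1)
      (fun z => hq _ Metric.isOpen_ball) (by
        intro y _
        obtain ⟨z, rfl⟩ := Quotient.exists_rep y
        exact Set.mem_iUnion.mpr ⟨z, z, Metric.mem_ball_self one_pos, rfl⟩)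
    refine ⟨⋃ z ∈ t, Metric.closedBall z 1,
      t.finite_toSet.isCompact_biUnion fun z _ => isCompact_closedBall z 1, fun z => ?_⟩
    obtain ⟨w, hw, y, hy, hyz⟩ := Set.mem_iUnion₂.mp (ht (Set.mem_univ (q z)))
    obtain ⟨γ, hγ⟩ := MulAction.orbitRel_apply.mp (Quotient.exact hyz)
    refine ⟨γ.unop, Set.mem_iUnion₂.mpr ⟨w, hw, ?_⟩⟩
    have : γ • z = y := hγ
    rw [MulOpposite.op_unop, this]
    exact Metric.ball_subset_closedBall hy
  obtain ⟨g, hg1, -, hgc, hg01⟩ := exists_continuous_one_zero_of_isCompact hK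
    (isClosed_empty (X := Z)) (Set.disjoint_empty _)
  have hfin : ∀ {L : Set Z}, IsCompact L →
      {γ : Γ | ∃ z ∈ L, g (MulOpposite.op γ • z) ≠ 0}.Finite := by
    intro L hL
    refine ((ProperlyDiscontinuousSMul.finite_disjoint_inter_image (Γ := Γᵐᵒᵖ) hL
      hgc.isCompact).preimage (f := MulOpposite.op) MulOpposite.op_injective.injOn).subset ?_
    rintro γ ⟨z, hz, hne⟩
    exact ⟨_, ⟨z, hz, rfl⟩, subset_tsupport g hne⟩
  let G : Z → ℝ := fun z => ∑ᶠ γ : Γ, g (MulOpposite.op γ • z) ^ 2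
  have hfin1 : ∀ z, (Function.support fun γ : Γ => g (MulOpposite.op γ • z) ^ 2).Finite := by
    intro z
    refine (hfin (isCompact_singleton (x := z))).subset fun γ hγ => ⟨z, rfl, fun h => hγ ?_⟩
    change g (MulOpposite.op γ • z) ^ 2 = 0
    rw [h]; simp
  have hGc : Continuous G := by
    refine continuous_finsum (fun γ => by fun_prop) fun z => ?_
    refine ⟨_, Metric.closedBall_mem_nhds z one_pos,
      (hfin (isCompact_closedBall z 1)).subset ?_⟩
    rintro γ ⟨y, hy, hyb⟩
    refine ⟨y, hyb, fun h => hy ?_⟩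
    change g (MulOpposite.op γ • y) ^ 2 = 0
    rw [h]; simp
  have hGs : ∀ z, HasSum (fun γ : Γ => g (MulOpposite.op γ • z) ^ 2) (G z) := by
    intro z
    change HasSum _ (∑ᶠ γ : Γ, g (MulOpposite.op γ • z) ^ 2)
    rw [finsum_eq_sum _ (hfin1 z)]
    refine hasSum_sum_of_ne_finset_zero fun γ hγ => ?_
    by_contra h
    exact hγ ((hfin1 z).mem_toFinset.mpr h)
  have hGpos : ∀ z, 0 < G z := by
    intro z
    obtain ⟨γ, hγ⟩ := hKcov z
    have h1 := (hGs z).summable.le_tsum γ fun _ _ => sq_nonneg _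
    rw [(hGs z).tsum_eq, hg1 hγ] at h1
    simp at h1
    linarith
  have hGinv : ∀ (γ : Γ) z, G (MulOpposite.op γ • z) = G z := by
    intro γ z
    refine (hGs _).unique ?_
    have := (Equiv.mulLeft γ).hasSum_iff.mpr (hGs z)
    simpa [Function.comp_def, mul_smul] using this
  have hle : ∀ z, g z ^ 2 ≤ G z := by
    intro z
    have h1 := (hGs z).summable.le_tsum 1 fun _ _ => sq_nonneg _
    rw [(hGs z).tsum_eq] at h1
    simpa using h1
  refine ⟨⟨⟨⟨fun z => ((g z / √(G z) : ℝ) : ℂ), ?_⟩, ?_⟩, fun z => ⟨_, ?_, ?_, rfl⟩, fun z => ?_⟩⟩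
  · refine Complex.continuous_ofReal.comp (g.continuous.div (hGc.sqrt) fun z => ?_)
    exact (Real.sqrt_pos.mpr (hGpos z)).ne'
  · refine HasCompactSupport.intro hgc.isCompact fun z hz => ?_
    have : g z = 0 := image_eq_zero_of_notMem_tsupport hz
    simp [this]
  · exact div_nonneg (hg01 z).1 (Real.sqrt_nonneg _)
  · exact div_le_one_of_le₀ (Real.le_sqrt_of_sq_le (hle z)) (Real.sqrt_nonneg _)
  · have h := (hGs z).div_const (G z)
    rw [div_self (hGpos z).ne'] at h
    have h2 := Complex.hasSum_ofReal.mpr h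
    rw [Complex.ofReal_one] at h2
    convert h2 using 2 with γ
    change ((g (MulOpposite.op γ • z) / √(G (MulOpposite.op γ • z)) : ℝ) : ℂ) ^ 2 = _
    rw [hGinv, ← Complex.ofReal_pow, div_pow, Real.sq_sqrt (hGpos z).le]

variable [ProperlyDiscontinuousSMul Γᵐᵒᵖ Z]
  [CompactSpace (Quotient (MulAction.orbitRel Γᵐᵒᵖ Z))]
  (C : CrossedProduct.{u, v, t} (actX Γ X))

/-- `π(C_c(Z × X))(C(X) ⊗ H)` as a pre-Hilbert module over `C_c(X × Γ)`, relative to the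
completion `C`. -/
def corePreHilbert : PreHilbertModule C.ι ρ.coreSpace where
  form := LinearMap.mk₂'ₛₗ (starRingEnd ℂ) (RingHom.id ℂ) ρ.coreForm
    (fun v v' w => by ext1 γ; exact fip_add_left _ _ _)
    (fun a v w => by ext1 γ; exact fip_smul_left _ _ _)
    (fun v w w' => by
      ext1 γ
      rw [Finsupp.add_apply, ρ.coreForm_apply, ρ.coreForm_apply, ρ.coreForm_apply,
        Submodule.coe_add, map_add, fip_add_right])
    (fun a v w => by
      ext1 γ
      rw [Finsupp.smul_apply, ρ.coreForm_apply, ρ.coreForm_apply, Submodule.coe_smul, map_smul,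
        RingHom.id_apply, fip_smul_right])
  act := LinearMap.mk₂ ℂ ρ.coreAct ρ.coreAct_add_left ρ.coreAct_smul_left ρ.coreAct_add_right
    ρ.coreAct_smul_right
  dense := C.dense
  star_form v w := by
    change star (C.ι (ρ.coreForm v w)) = C.ι (ρ.coreForm w v)
    rw [← C.ι_invol, ρ.invol_coreForm]
  form_act v w f := by
    change C.ι (ρ.coreForm v (ρ.coreAct w f)) = C.ι (ρ.coreForm v w) * C.ι f
    rw [← C.ι_conv, ρ.coreForm_coreAct]
  form_self v := by
    obtain ⟨c⟩ := exists_cutoff (Γ := Γ) (Z := Z)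
    change ∃ b, C.ι (ρ.coreForm v v) = star b * b
    rw [← ρ.freeForm_preIso c]
    exact freeForm_self C _

/-- The Connes-Skandalis Hilbert `C(X) ⋊ Γ`-module `ℰ^H`. -/
abbrev ConnesSkandalis : Type _ := (corePreHilbert ρ C).Hilbert

end ConnesSkandalis

/-! ### The operators `T ⋊ Γ` and `(π ⋊ Γ)(f)` -/

namespace PreHilbertModule

variable {R B : Type*} [AddCommGroup R] [Module ℂ R] [NonUnitalCStarAlgebra B]
  {ι : R →ₗ[ℂ] B} {V : Type*} [AddCommGroup V] [Module ℂ V] (P : PreHilbertModule ι V)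

/-- An operator on a pre-Hilbert module which has a formal adjoint `T'` is bounded, if the iterates
of `T' T` grow at most exponentially on each vector. -/
theorem bounded_of_adjoint (T T' : V →ₗ[ℂ] V)
    (hT : ∀ x y, ι (P.form (T x) y) = ι (P.form x (T' y))) {s : ℝ} (hs : 0 < s)
    (hgrowth : ∀ x, ∃ K, ∀ n : ℕ, ‖P.toHilbert (((T' ∘ₗ T) ^ n) x)‖ ≤ K * s ^ n) (x : V) :
    ‖P.toHilbert (T x)‖ ≤ √s * ‖P.toHilbert x‖ := by
  set S := T' ∘ₗ T with hS
  have hT' : ∀ x y, ι (P.form (T' x) y) = ι (P.form x (T y)) := by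
    intro x y
    rw [← P.star_form, ← hT, P.star_form]
  have hsymm : ∀ x y, ι (P.form (S x) y) = ι (P.form x (S y)) := by
    intro x y
    rw [hS, LinearMap.comp_apply, LinearMap.comp_apply, hT', hT]
  have hsymm' : ∀ (n : ℕ) x y, ι (P.form ((S ^ n) x) y) = ι (P.form x ((S ^ n) y)) := by
    intro n
    induction n with
    | zero => intro x y; rfl
    | succ n ih =>
      intro x y
      rw [pow_succ', Module.End.mul_apply, hsymm, ih, ← Module.End.mul_apply, ← pow_succ, pow_succ']
  have hsq : ∀ n : ℕ, ‖P.toHilbert ((S ^ n) x)‖ ^ 2 ≤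
      ‖P.toHilbert x‖ * ‖P.toHilbert ((S ^ (2 * n)) x)‖ := by
    intro n
    rw [norm_sq_toHilbert, hsymm', ← Module.End.mul_apply, ← pow_add, ← two_mul]
    exact P.norm_form_le_toHilbert _ _
  have hSx : ‖P.toHilbert (S x)‖ ≤ s * ‖P.toHilbert x‖ := by
    by_contra! hlt
    have h0 : 0 ≤ ‖P.toHilbert x‖ := norm_nonneg _
    rcases h0.eq_or_lt with h0 | h0
    · have := hsq 1
      rw [← h0, zero_mul, pow_one] at this
      rw [← h0, mul_zero] at hlt
      exact absurd this (not_le.mpr (by positivity))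
    obtain ⟨K, hK⟩ := hgrowth x
    set q := ‖P.toHilbert (S x)‖ / ‖P.toHilbert x‖ with hq
    have hqs : s < q := by rwa [hq, lt_div_iff₀ h0]
    have hpow : ∀ k : ℕ, q ^ (2 ^ k) * ‖P.toHilbert x‖ ≤ ‖P.toHilbert ((S ^ (2 ^ k)) x)‖ := by
      intro k
      induction k with
      | zero =>
        rw [pow_zero, pow_one, pow_one, hq, div_mul_cancel₀ _ h0.ne']
      | succ k ih =>
        have h1 := hsq (2 ^ k)
        rw [← pow_succ'] at h1
        have h2 : (q ^ (2 ^ k) * ‖P.toHilbert x‖) ^ 2 ≤ ‖P.toHilbert ((S ^ (2 ^ k)) x)‖ ^ 2 := by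
          have : 0 < q := hs.trans hqs
          gcongr
        have h3 : ‖P.toHilbert x‖ * (q ^ (2 ^ (k + 1)) * ‖P.toHilbert x‖) ≤
            ‖P.toHilbert x‖ * ‖P.toHilbert ((S ^ (2 ^ (k + 1))) x)‖ := by
          refine le_trans (le_of_eq ?_) (h2.trans h1)
          ring
        exact le_of_mul_le_mul_left h3 h0
    have hbd : ∀ k : ℕ, (q / s) ^ (2 ^ k) ≤ K / ‖P.toHilbert x‖ := by
      intro k
      rw [le_div_iff₀ h0, div_pow, div_mul_eq_mul_div, div_le_iff₀ (by positivity)]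
      exact (hpow k).trans (hK _)
    have htend := (tendsto_pow_atTop_atTop_of_one_lt (r := q / s) (by rwa [one_lt_div hs])).comp
      (tendsto_pow_atTop_atTop_of_one_lt (r := (2 : ℕ)) one_lt_two)
    obtain ⟨k, hk⟩ := (htend.eventually_gt_atTop (K / ‖P.toHilbert x‖)).exists
    exact absurd (hbd k) (not_le.mpr hk)
  refine le_of_sq_le_sq ?_ (by positivity)
  rw [norm_sq_toHilbert, hT, mul_pow, Real.sq_sqrt hs.le]
  refine (P.norm_form_le_toHilbert x (T' (T x))).trans ?_
  have : ‖P.toHilbert (T' (T x))‖ ≤ s * ‖P.toHilbert x‖ := hSx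
  nlinarith [norm_nonneg (P.toHilbert x)]

end PreHilbertModule

section Operators

variable {Γ : Type v} {X Z : Type u} {H : Type w} [Group Γ]
  [TopologicalSpace X] [CompactSpace X] [T2Space X] [MulAction Γ X] [ContinuousConstSMul Γ X]
  [MetricSpace Z] [ProperSpace Z] [MulAction Γᵐᵒᵖ Z] [IsIsometricSMul Γᵐᵒᵖ Z]
  [NormedAddCommGroup H] [InnerProductSpace ℂ H] [CompleteSpace H]
  (C : CrossedProduct.{u, v, t} (actX Γ X))

/-- The canonical map `C_c(X × Γ, H) → (C(X) ⊗ H) ⋊ Γ`. -/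
abbrev toFree : (Γ →₀ C(X, H)) →ₗ[ℂ] FreeHilbert H C := (freePreHilbert (H := H) C).toHilbert

theorem norm_toFree_single_le (γ : Γ) (a : C(X, H)) : ‖toFree C (.single γ a)‖ ≤ ‖a‖ := by
  refine le_of_sq_le_sq ?_ (norm_nonneg _)
  rw [PreHilbertModule.norm_sq_toHilbert]
  change ‖C.ι (freeForm (.single γ a) (.single γ a))‖ ≤ _
  rw [freeForm_single, HilbertModule.norm_sq (B := C(X, ℂ)) a]
  exact (norm_ι_single_le C _ _).trans (norm_act_le _ _ _)

theorem norm_toFree_le (ξ : Γ →₀ C(X, H)) : ‖toFree C ξ‖ ≤ ∑ γ ∈ ξ.support, ‖ξ γ‖ := by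
  conv_lhs => rw [← ξ.sum_single, Finsupp.sum, map_sum]
  exact (norm_sum_le _ _).trans (Finset.sum_le_sum fun γ _ => norm_toFree_single_le C γ _)

/-- The operator `T ⋊ Γ`, given on `C_c(X × Γ, H)` by `(T ⋊ Γ)(ξ)(x, γ) = T_x ξ(x, γ)`. -/
def rtimes (T : C(X, H) →L[ℂ] C(X, H)) : FreeHilbert H C →L[ℂ] FreeHilbert H C :=
  (toFree C ∘ₗ Finsupp.mapRange.linearMap (T : C(X, H) →ₗ[ℂ] C(X, H))).extendOfNorm (toFree C)

theorem rtimes_coe {T : C(X, H) →L[ℂ] C(X, H)} (hT : IsAdjointable C(X, ℂ) T)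
    (ξ : Γ →₀ C(X, H)) :
    rtimes C T (toFree C ξ) = toFree C (Finsupp.mapRange.linearMap (T : C(X, H) →ₗ[ℂ] C(X, H)) ξ) := by
  obtain ⟨T', hT'⟩ := hT
  refine LinearMap.extendOfNorm_eq (PreHilbertModule.denseRange_toHilbert _)
    ⟨√(‖T' ∘L T‖ + 1), fun ξ => ?_⟩ ξ
  refine PreHilbertModule.bounded_of_adjoint (freePreHilbert (H := H) C)
    (Finsupp.mapRange.linearMap (T : C(X, H) →ₗ[ℂ] C(X, H)))
    (Finsupp.mapRange.linearMap (T' : C(X, H) →ₗ[ℂ] C(X, H))) (fun ξ η => ?_)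
    (s := ‖T' ∘L T‖ + 1) (by positivity) (fun ξ => ⟨∑ γ ∈ ξ.support, ‖ξ γ‖, fun n => ?_⟩) ξ
  · change C.ι (freeForm _ _) = C.ι (freeForm _ _)
    congr 1
    have hf : ∀ a b, fip (T a) b = fip a (T' b) := hT'
    induction ξ using Finsupp.induction_linear with
    | zero => simp
    | add ξ ξ' h h' => rw [map_add, freeForm_add_left, h, h', freeForm_add_left]
    | single μ a =>
      induction η using Finsupp.induction_linear with
      | zero => simp
      | add η η' h h' => rw [map_add, freeForm_add_right, h, h', freeForm_add_right]
      | single ν b => simp [freeForm_single, hf]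
  · have hpow : ∀ γ, ((Finsupp.mapRange.linearMap (T' : C(X, H) →ₗ[ℂ] C(X, H)) ∘ₗ
        Finsupp.mapRange.linearMap (T : C(X, H) →ₗ[ℂ] C(X, H))) ^ n) ξ γ =
        ((T' ∘L T) ^ n) (ξ γ) := by
      intro γ
      induction n with
      | zero => rfl
      | succ n ih =>
        rw [pow_succ', pow_succ', Module.End.mul_apply, mul_apply_eq_comp, ← ih]
        rfl
    refine (norm_toFree_le C _).trans ?_
    have hsub : (((Finsupp.mapRange.linearMap (T' : C(X, H) →ₗ[ℂ] C(X, H)) ∘ₗ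
        Finsupp.mapRange.linearMap (T : C(X, H) →ₗ[ℂ] C(X, H))) ^ n) ξ).support ⊆ ξ.support := by
      intro γ hγ
      rw [Finsupp.mem_support_iff, hpow] at hγ
      rw [Finsupp.mem_support_iff]
      rintro h
      exact hγ (by rw [h, map_zero])
    refine (Finset.sum_le_sum_of_subset_of_nonneg hsub fun _ _ _ => norm_nonneg _).trans ?_
    rw [Finset.sum_mul]
    refine Finset.sum_le_sum fun γ _ => ?_
    rw [hpow]
    clear hsub hpow
    induction n with
    | zero => simp
    | succ n ih =>
      rw [pow_succ', mul_apply_eq_comp, pow_succ, ← mul_assoc]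
      refine (ContinuousLinearMap.le_opNorm _ _).trans ?_
      rw [mul_comm]
      gcongr
      linarith

theorem rtimes_ext {S S' : FreeHilbert H C →L[ℂ] FreeHilbert H C}
    (h : ∀ ξ, S (toFree C ξ) = S' (toFree C ξ)) : S = S' :=
  PreHilbertModule.clm_ext _ h

variable (ρ : EquivariantRep Γ X Z H)

/-- The action `(μ ξ)(x, γ) = U_μ ξ(μ⁻¹ x, μ⁻¹ γ)` of `Γ` on `C_c(X × Γ, H)`. -/
def preShift (μ : Γ) : (Γ →₀ C(X, H)) →ₗ[ℂ] (Γ →₀ C(X, H)) :=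
  Finsupp.lmapDomain C(X, H) ℂ (μ * ·) ∘ₗ Finsupp.mapRange.linearMap (translate ρ.U μ)

theorem preShift_single (μ ν : Γ) (a : C(X, H)) :
    preShift ρ μ (.single ν a) = .single (μ * ν) (translate ρ.U μ a) := by
  simp [preShift]

/-- The unitary action of `Γ` on `(C(X) ⊗ H) ⋊ Γ`. -/
def shift (μ : Γ) : FreeHilbert H C →L[ℂ] FreeHilbert H C :=
  (toFree C ∘ₗ preShift ρ μ).extendOfNorm (toFree C)

theorem shift_coe (μ : Γ) (ξ : Γ →₀ C(X, H)) :
    shift C ρ μ (toFree C ξ) = toFree C (preShift ρ μ ξ) := by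
  refine LinearMap.extendOfNorm_eq (PreHilbertModule.denseRange_toHilbert _)
    ⟨1, fun ξ => ?_⟩ ξ
  rw [one_mul, LinearMap.comp_apply]
  refine le_of_sq_le_sq (le_of_eq ?_) (norm_nonneg _)
  rw [PreHilbertModule.norm_sq_toHilbert, PreHilbertModule.norm_sq_toHilbert]
  change ‖C.ι (freeForm _ _)‖ = ‖C.ι (freeForm _ _)‖
  congr 2
  have : ∀ ξ η : Γ →₀ C(X, H), freeForm (preShift ρ μ ξ) (preShift ρ μ η) = freeForm ξ η := by
    intro ξ η
    induction ξ using Finsupp.induction_linear with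
    | zero => simp
    | add ξ ξ' h h' => rw [map_add, freeForm_add_left, h, h', freeForm_add_left]
    | single ν a =>
      induction η using Finsupp.induction_linear with
      | zero => simp
      | add η η' h h' => rw [map_add, freeForm_add_right, h, h', freeForm_add_right]
      | single κ b =>
        rw [preShift_single, preShift_single, freeForm_single, freeForm_single, fip_translate,
          ← CStarAction.act_mul]
        rw [show (μ * ν)⁻¹ * (μ * κ) = ν⁻¹ * κ by group, show (μ * ν)⁻¹ * μ = ν⁻¹ by group]
  exact this ξ ξ

theorem isAdjointable_π (g : C₀(Z × X, ℂ)) : IsAdjointable C(X, ℂ) (ρ.π g) := by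
  refine ⟨ρ.π (star g), fun ξ η => ?_⟩
  change fip _ _ = fip _ _
  rw [← ρ.π_star, star_star]

/-- The representation `π ⋊ Γ` on `C_c(Γ, C₀(Z × X))`, which is
`(π ⋊ Γ)(f)(ξ)(x, γ) = ∑ μ, π_x(f(•, x, μ)) U_μ ξ(μ⁻¹ x, μ⁻¹ γ)`. -/
def preInt : (Γ →₀ C₀(Z × X, ℂ)) →ₗ[ℂ] FreeHilbert H C →L[ℂ] FreeHilbert H C :=
  Finsupp.lsum ℂ fun μ =>
    { toFun := fun g => rtimes C (ρ.π g) ∘L shift C ρ μ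
      map_add' := fun g h => rtimes_ext C fun ξ => by
        rw [add_apply, ContinuousLinearMap.comp_apply,
          ContinuousLinearMap.comp_apply, ContinuousLinearMap.comp_apply, shift_coe,
          rtimes_coe _ (isAdjointable_π ρ _), rtimes_coe _ (isAdjointable_π ρ _),
          rtimes_coe _ (isAdjointable_π ρ _), ← map_add]
        congr 1
        ext1 γ
        simp
      map_smul' := fun a g => rtimes_ext C fun ξ => by
        rw [RingHom.id_apply, smul_apply, ContinuousLinearMap.comp_apply,
          ContinuousLinearMap.comp_apply, shift_coe,
          rtimes_coe _ (isAdjointable_π ρ _), rtimes_coe _ (isAdjointable_π ρ _), ← map_smul]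
        congr 1
        ext1 γ
        simp }

end Operators

/-! ### Lifts of operators, and the Roe algebras -/

section Lifts

variable {Γ : Type v} {X Z : Type u} {H : Type w} [Group Γ]
  [TopologicalSpace X] [CompactSpace X] [T2Space X] [MulAction Γ X] [ContinuousConstSMul Γ X]
  [MetricSpace Z] [ProperSpace Z] [MulAction Γᵐᵒᵖ Z] [IsIsometricSMul Γᵐᵒᵖ Z]
  [NormedAddCommGroup H] [InnerProductSpace ℂ H] [CompleteSpace H]
  (ρ : EquivariantRep Γ X Z H) (C : CrossedProduct.{u, v, t} (actX Γ X))
  (P : CrossedProduct.{u, v, t} (actZX Γ X Z))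

/-- The representation `π ⋊ Γ` of `C₀(Z × X) ⋊ Γ` in `(C(X) ⊗ H) ⋊ Γ`, by continuous extension from
`C_c(Γ, C₀(Z × X))`. For a proper action on `Z` the extension exists whatever the completions are:
if the functions `f(γ)` are supported in `K × X` for a compact `K` and `N` is the number of `γ` such
that `K` meets its translate by `γ`, then the norm of `preInt C ρ f` is at most
`∑ γ, ‖f(γ)‖ ≤ N ‖f‖`, and the same bound for the powers of `f⋆ * f` removes the factor `N`. -/
def intRep : P.carrier →L[ℂ] FreeHilbert H C →L[ℂ] FreeHilbert H C :=
  (preInt C ρ).extendOfNorm P.ι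

variable [ProperlyDiscontinuousSMul Γᵐᵒᵖ Z]

/-- The Mishchenko projection `e(γ)(z, x) = c(z) c(z γ)` as an element of `C_c(Γ, C₀(Z × X))`. -/
def mishchenko (c : Cutoff Γ Z) : Γ →₀ C₀(Z × X, ℂ) :=
  Finsupp.ofSupportFinite (fun γ => pullZ c.c * (actZX Γ X Z).act γ (pullZ c.c))
    (finite_mul_act_ne_zero (hasCompactSupport_pullZ c.c) (hasCompactSupport_pullZ c.c))

theorem mishchenko_apply (c : Cutoff Γ Z) (γ : Γ) (z : Z) (x : X) :
    mishchenko c γ (z, x) = c.c z * c.c (MulOpposite.op γ • z) := rfl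

/-- The right ideal `e (C₀(Z × X) ⋊ Γ)`. -/
def mishchenkoIdeal (c : Cutoff Γ Z) : Set P.carrier :=
  {a | ∃ b, a = P.ι (mishchenko c) * b}

/-- The map `φ` on `π(C_c(Z × X))(C(X) ⊗ H)` as a linear map. -/
def preIsoLinear (c : Cutoff Γ Z) : ρ.coreSpace →ₗ[ℂ] (Γ →₀ C(X, H)) where
  toFun := ρ.preIso c
  map_add' v w := by
    ext1 γ
    rw [Finsupp.add_apply, ρ.preIso_apply, ρ.preIso_apply, ρ.preIso_apply, Submodule.coe_add,
      map_add, map_add]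
  map_smul' a v := by
    ext1 γ
    rw [Finsupp.smul_apply, ρ.preIso_apply, ρ.preIso_apply, Submodule.coe_smul, map_smul, map_smul,
      RingHom.id_apply]

variable [CompactSpace (Quotient (MulAction.orbitRel Γᵐᵒᵖ Z))]

/-- The isometry `φ : ℰ^H → (C(X) ⊗ H) ⋊ Γ`, whose range is the range of `(π ⋊ Γ)(e)`. -/
def iso (c : Cutoff Γ Z) : ConnesSkandalis ρ C →L[ℂ] FreeHilbert H C :=
  (toFree C ∘ₗ preIsoLinear ρ c).extendOfNorm (corePreHilbert ρ C).toHilbert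

theorem norm_toFree_preIso (c : Cutoff Γ Z) (v : ρ.coreSpace) :
    ‖toFree C (preIsoLinear ρ c v)‖ = ‖(corePreHilbert ρ C).toHilbert v‖ := by
  rw [PreHilbertModule.norm_toHilbert, PreHilbertModule.norm_toHilbert]
  change √‖C.ι (freeForm (ρ.preIso c v) (ρ.preIso c v))‖ = √‖C.ι (ρ.coreForm v v)‖
  rw [ρ.freeForm_preIso]

theorem iso_coe (c : Cutoff Γ Z) (v : ρ.coreSpace) :
    iso ρ C c ((corePreHilbert ρ C).toHilbert v) = toFree C (preIsoLinear ρ c v) :=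
  LinearMap.extendOfNorm_eq (PreHilbertModule.denseRange_toHilbert _)
    ⟨1, fun v => by rw [one_mul]; exact (norm_toFree_preIso ρ C c v).le⟩ v

theorem norm_iso (c : Cutoff Γ Z) (ξ : ConnesSkandalis ρ C) : ‖iso ρ C c ξ‖ = ‖ξ‖ := by
  refine (PreHilbertModule.denseRange_toHilbert (corePreHilbert ρ C)).induction_on
    (p := fun ξ => ‖iso ρ C c ξ‖ = ‖ξ‖) ξ ?_ fun v => ?_
  · exact isClosed_eq (iso ρ C c).continuous.norm continuous_norm
  · rw [iso_coe, norm_toFree_preIso]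

open Classical in
/-- The composition `φ⁻¹ ∘ S`, for an operator `S` with values in the range of the isometry `φ`. -/
def isoInvComp {E : Type*} [NormedAddCommGroup E] [NormedSpace ℂ E] (c : Cutoff Γ Z)
    (S : E →L[ℂ] FreeHilbert H C) : E →L[ℂ] ConnesSkandalis ρ C :=
  if h : ∃ L : E →L[ℂ] ConnesSkandalis ρ C, iso ρ C c ∘L L = S then h.choose else 0

theorem isoInvComp_eq {E : Type*} [NormedAddCommGroup E] [NormedSpace ℂ E] (c : Cutoff Γ Z)
    (L : E →L[ℂ] ConnesSkandalis ρ C) : isoInvComp ρ C c (iso ρ C c ∘L L) = L := by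
  have h : ∃ L' : E →L[ℂ] ConnesSkandalis ρ C, iso ρ C c ∘L L' = iso ρ C c ∘L L := ⟨L, rfl⟩
  rw [isoInvComp, dif_pos h]
  ext ξ
  have h1 := congrArg (fun S : E →L[ℂ] FreeHilbert H C => S ξ) h.choose_spec
  simp only [ContinuousLinearMap.comp_apply] at h1
  rw [← sub_eq_zero, ← norm_eq_zero, ← norm_iso ρ C c, map_sub, h1, sub_self, norm_zero]

/-- The operator `L_f = φ⁻¹ ∘ (π ⋊ Γ)(f) : (C(X) ⊗ H) ⋊ Γ → ℰ^H`, for `f ∈ e (C₀(Z × X) ⋊ Γ)`. -/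
def leftOp (c : Cutoff Γ Z) (f : P.carrier) : FreeHilbert H C →L[ℂ] ConnesSkandalis ρ C :=
  isoInvComp ρ C c (intRep ρ C P f)

/-- The adjoint `(L_f)⋆ = (π ⋊ Γ)(f⋆) ∘ φ : ℰ^H → (C(X) ⊗ H) ⋊ Γ` of `L_f`. -/
def leftOpAdjoint (c : Cutoff Γ Z) (f : P.carrier) :
    ConnesSkandalis ρ C →L[ℂ] FreeHilbert H C :=
  intRep ρ C P (star f) ∘L iso ρ C c

/-- The adjointable operator `S` on `ℰ^H` is a lift of the operator `T` on `C(X) ⊗ H`: for some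
cut-off function, `S L_f - L_f (T ⋊ Γ)` and `(L_f)⋆ S - (T ⋊ Γ) (L_f)⋆` are compact for all
`f ∈ e (C₀(Z × X) ⋊ Γ)`. -/
def IsLift (S : ConnesSkandalis ρ C →L[ℂ] ConnesSkandalis ρ C) (T : C(X, H) →L[ℂ] C(X, H)) : Prop :=
  IsAdjointable C.carrier S ∧ ∃ c : Cutoff Γ Z, ∀ f ∈ mishchenkoIdeal (X := X) P c,
    S ∘L leftOp ρ C P c f - leftOp ρ C P c f ∘L rtimes C T ∈
      compactOps C.carrier (FreeHilbert H C) (ConnesSkandalis ρ C) ∧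
    leftOpAdjoint ρ C P c f ∘L S - rtimes C T ∘L leftOpAdjoint ρ C P c f ∈
      compactOps C.carrier (ConnesSkandalis ρ C) (FreeHilbert H C)

/-- The operator `(π ⋊ Γ)(e) (T ⋊ Γ) (π ⋊ Γ)(e)` on `(C(X) ⊗ H) ⋊ Γ`. -/
def cutDown (c : Cutoff Γ Z) (T : C(X, H) →L[ℂ] C(X, H)) : FreeHilbert H C →L[ℂ] FreeHilbert H C :=
  intRep ρ C P (P.ι (mishchenko c)) ∘L rtimes C T ∘L intRep ρ C P (P.ι (mishchenko c))

/-- The operator `T_e` on `ℰ^H` which is conjugate to `(π ⋊ Γ)(e) (T ⋊ Γ) (π ⋊ Γ)(e)` by `φ`. -/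
def compression (c : Cutoff Γ Z) (T : C(X, H) →L[ℂ] C(X, H)) :
    ConnesSkandalis ρ C →L[ℂ] ConnesSkandalis ρ C :=
  isoInvComp ρ C c (cutDown ρ C P c T ∘L iso ρ C c)

end Lifts

section RoeAlgebras

variable {Γ : Type v} {X Z : Type u} {H : Type w} [Group Γ]
  [TopologicalSpace X] [CompactSpace X] [T2Space X] [MulAction Γ X] [ContinuousConstSMul Γ X]
  [MetricSpace Z] [ProperSpace Z] [MulAction Γᵐᵒᵖ Z] [IsIsometricSMul Γᵐᵒᵖ Z]
  [NormedAddCommGroup H] [InnerProductSpace ℂ H] [CompleteSpace H]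
  (ρ : EquivariantRep Γ X Z H)

/-- `T` is `Γ`-equivariant: `T_{γ x} = U_γ T_x U_γ⋆`. -/
def IsEquivariant (T : C(X, H) →L[ℂ] C(X, H)) : Prop :=
  ∀ γ ξ, T (translate ρ.U γ ξ) = translate ρ.U γ (T ξ)

/-- `T` has finite propagation: for some `R > 0`, `π(φ) T π(ψ) = 0` for all `φ, ψ ∈ C_c(Z)` with
supports at distance greater than `R`. -/
def HasFinitePropagation (T : C(X, H) →L[ℂ] C(X, H)) : Prop :=
  ∃ R > 0, ∀ φ ψ : CompactlySupportedContinuousMap Z ℂ,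
    (∀ z ∈ tsupport φ, ∀ w ∈ tsupport ψ, R < dist z w) →
      ρ.π (pullZ φ) ∘L T ∘L ρ.π (pullZ ψ) = 0

/-- `T` commutes with the representation of `C₀(Z × X)` up to compact operators. -/
def IsPseudolocal (T : C(X, H) →L[ℂ] C(X, H)) : Prop :=
  ∀ g, T ∘L ρ.π g - ρ.π g ∘L T ∈ compactOps C(X, ℂ) C(X, H) C(X, H)

/-- The products of `T` with the elements of `C₀(Z × X)` are compact operators. -/
def IsLocallyCompact (T : C(X, H) →L[ℂ] C(X, H)) : Prop :=
  ∀ g, ρ.π g ∘L T ∈ compactOps C(X, ℂ) C(X, H) C(X, H) ∧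
    T ∘L ρ.π g ∈ compactOps C(X, ℂ) C(X, H) C(X, H)

/-- The Roe algebra `D⋆_Γ(X, Z, H)`. -/
def roeD : Set (C(X, H) →L[ℂ] C(X, H)) :=
  closure {T | IsAdjointable C(X, ℂ) T ∧ IsEquivariant ρ T ∧ HasFinitePropagation ρ T ∧
    IsPseudolocal ρ T}

/-- The ideal `C⋆_Γ(X, Z, H)` of the Roe algebra. -/
def roeC : Set (C(X, H) →L[ℂ] C(X, H)) :=
  closure {T | IsAdjointable C(X, ℂ) T ∧ IsEquivariant ρ T ∧ HasFinitePropagation ρ T ∧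
    IsLocallyCompact ρ T}

variable [ProperlyDiscontinuousSMul Γᵐᵒᵖ Z]
  [CompactSpace (Quotient (MulAction.orbitRel Γᵐᵒᵖ Z))]
  (C : CrossedProduct.{u, v, t} (actX Γ X)) (P : CrossedProduct.{u, v, t} (actZX Γ X Z))

/-- The Roe ideal `C⋆_Γ(ℰ^H)`: the lifts of the elements of `C⋆_Γ(X, Z, H)`. -/
def roeIdeal : Set (ConnesSkandalis ρ C →L[ℂ] ConnesSkandalis ρ C) :=
  {S | ∃ T ∈ roeC ρ, IsLift ρ C P S T}

end RoeAlgebras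

end RoeLift

end

open RoeLift

/-!
The cut-off function `c` gives an isometry `φ : ℰ^H → (C(X) ⊗ H) ⋊ Γ`. It has an adjoint `φ⋆`, which
maps the vector `a` placed at `μ` to `U_{μ⁻¹} π(c) a` (`adjointPair_isoAdj`), and `φ⋆ φ = 1`, while
for two cut-off functions `c` and `d` the operator `φ_c φ_d⋆` is `π ⋊ Γ` applied to the function
`γ ↦ c γ(d)` (`isoAdj_comp_iso`, `iso_comp_isoAdj`). In particular `φ φ⋆ = (π ⋊ Γ)(e)`, so that
`T_e = φ⋆ (T ⋊ Γ) φ` and `L_f = φ⋆ (π ⋊ Γ)(f)` (`compression_eq`, `leftOp_eq`).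

The decisive fact is that `T ⋊ Γ` commutes with `(π ⋊ Γ)(a)` up to compact operators, for every
`T ∈ D⋆_Γ(X, Z, H)` and `a ∈ C₀(Z × X) ⋊ Γ` (`commutator_intRep_mem_compactOps`): on the generator
`g U_μ` the commutator is `([T, π(g)] ⋊ Γ) U_μ` by equivariance, and `K ⋊ Γ` is compact for compact
`K`, since `θ_{u, v} ⋊ Γ` is the rank one operator of `u` and `v` placed at `1 ∈ Γ` and `T ↦ T ⋊ Γ`
is contractive (`rtimes_mem_compactOps`).

It follows that `T_e L_f - L_f (T ⋊ Γ) = φ⋆ [T ⋊ Γ, (π ⋊ Γ)(f)]` is compact, and likewise for the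
adjoints, so `T_e` is a lift. If `S` is any lift, then the choice `f = e e`, for which `L_f = φ⋆`,
shows that `S - T_e = (S φ⋆ - φ⋆ (T ⋊ Γ)) φ` is compact. The cut-off function can be changed because
`φ_c φ_d⋆` also commutes with `T ⋊ Γ` up to compact operators. If `T` is locally compact, then
`(T ⋊ Γ)(π ⋊ Γ)(e)` is compact and so is `T_e`; conversely the compact operators on `ℰ^H` are the
lifts of `0`.

All this needs that the integrated form `π ⋊ Γ` extends continuously to the given completion of
`C_c(Γ, C₀(Z × X))`, that is `‖(π ⋊ Γ)(f)‖ ≤ ‖f‖` (`norm_preInt_le`). Here properness enters. If `f`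
has coefficients supported over a compact set `K`, then the powers of `f * f⋆` have at most `N`
nonzero coefficients, where `N` is the number of `γ` with `K ∩ K γ ≠ ∅`, and each coefficient is
dominated by the reduced norm (`norm_coeff_le`). So the norms of their images are at most `N` times
their own norms, and the `C⋆`-identity removes the factor `N`.
-/

namespace RoeLift

/-! ### Adjointable and compact operators of Hilbert modules -/

namespace HilbertModule

variable {B : Type*} [NonUnitalCStarAlgebra B]
  {E : Type*} [NormedAddCommGroup E] [NormedSpace ℂ E] [CompleteSpace E] [HilbertModule B E]

theorem ip_sub_right (x y z : E) : ip (B := B) x (y - z) = ip x y - ip x z := by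
  have h := ip_smul_right (B := B) (-1) x z
  rw [neg_one_smul, neg_one_smul] at h
  rw [sub_eq_add_neg, ip_add_right, h, sub_eq_add_neg]

theorem ip_add_left (x y z : E) : ip (B := B) (x + y) z = ip x z + ip y z := by
  rw [← star_ip, ip_add_right, star_add, star_ip, star_ip]

theorem ip_sub_left (x y z : E) : ip (B := B) (x - y) z = ip x z - ip y z := by
  rw [← star_ip, ip_sub_right, star_sub, star_ip, star_ip]

theorem ip_smul_left (a : ℂ) (x y : E) :
    ip (B := B) (a • x) y = starRingEnd ℂ a • ip x y := by
  rw [← star_ip, ip_smul_right, star_smul, star_ip]; rfl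

theorem ip_zero_right (x : E) : ip (B := B) x 0 = 0 := by
  simpa using ip_smul_right (B := B) 0 x 0

theorem ip_sum_right {ι : Type*} (s : Finset ι) (x : E) (f : ι → E) :
    ip (B := B) x (∑ i ∈ s, f i) = ∑ i ∈ s, ip x (f i) :=
  map_sum (⟨⟨fun y => ip (B := B) x y, ip_zero_right x⟩, ip_add_right x⟩ : E →+ B) f s

theorem ip_sum_left {ι : Type*} (s : Finset ι) (f : ι → E) (y : E) :
    ip (B := B) (∑ i ∈ s, f i) y = ∑ i ∈ s, ip (f i) y := by
  rw [← star_ip, ip_sum_right, star_sum]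
  simp only [star_ip]

variable (B) in
theorem ext_ip {y z : E} (h : ∀ x, ip (B := B) x y = ip x z) : y = z := by
  rw [← sub_eq_zero, ← norm_eq_zero, ← sq_eq_zero_iff, norm_sq (B := B), ip_sub_right, h, sub_self,
    norm_zero]

/-- A Hilbert `B`-module as a pre-Hilbert module over `B`. -/
def toPreHilbert (B E : Type*) [NonUnitalCStarAlgebra B] [NormedAddCommGroup E] [NormedSpace ℂ E]
    [CompleteSpace E] [HilbertModule B E] : PreHilbertModule (LinearMap.id : B →ₗ[ℂ] B) E where
  form := LinearMap.mk₂'ₛₗ (starRingEnd ℂ) (RingHom.id ℂ) (fun x y => ip (B := B) x y)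
    ip_add_left ip_smul_left ip_add_right fun a x y => ip_smul_right a x y
  act := LinearMap.mk₂ ℂ (fun x b => rsmul (B := B) x b)
    (fun x y b => ext_ip B fun z => by
      rw [ip_add_right, ip_rsmul_right, ip_rsmul_right, ip_rsmul_right, ip_add_right, add_mul])
    (fun a x b => ext_ip B fun z => by
      rw [ip_smul_right, ip_rsmul_right, ip_rsmul_right, ip_smul_right, smul_mul_assoc])
    (fun x b b' => ext_ip B fun z => by
      rw [ip_add_right, ip_rsmul_right, ip_rsmul_right, ip_rsmul_right, mul_add])
    (fun a x b => ext_ip B fun z => by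
      rw [ip_smul_right, ip_rsmul_right, ip_rsmul_right, mul_smul_comm])
  dense := denseRange_id
  star_form x y := star_ip x y
  form_act x y b := ip_rsmul_right x y b
  form_self x := ip_self_nonneg x

theorem norm_ip_le (x y : E) : ‖ip (B := B) x y‖ ≤ ‖x‖ * ‖y‖ := by
  refine le_of_sq_le_sq ?_ (by positivity)
  rw [mul_pow, norm_sq (B := B) x, norm_sq (B := B) y]
  exact (toPreHilbert B E).cauchy_schwarz x y

theorem norm_rsmul_le (x : E) (b : B) : ‖rsmul x b‖ ≤ ‖b‖ * ‖x‖ := by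
  have h (z : E) : ‖(toPreHilbert B E).toHilbert z‖ = ‖z‖ := by
    rw [PreHilbertModule.norm_toHilbert]
    change √‖ip (B := B) z z‖ = ‖z‖
    rw [← norm_sq (B := B), Real.sqrt_sq (norm_nonneg _)]
  have := (toPreHilbert B E).norm_act_le x b
  rwa [h, h] at this

theorem neg_rsmul (x : E) (b : B) : rsmul (-x) b = -rsmul x b :=
  ((toPreHilbert B E).act.flip b).map_neg x

/-- The operator `θ_{u, v} : z ↦ u ⟨v, z⟩`. -/
noncomputable def rankOne (B : Type*) [NonUnitalCStarAlgebra B] {E E' : Type*}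
    [NormedAddCommGroup E] [NormedSpace ℂ E] [CompleteSpace E] [HilbertModule B E]
    [NormedAddCommGroup E'] [NormedSpace ℂ E'] [CompleteSpace E'] [HilbertModule B E']
    (u : E') (v : E) : E →L[ℂ] E' :=
  LinearMap.mkContinuous ((toPreHilbert B E').act u ∘ₗ (toPreHilbert B E).form v)
    (‖v‖ * ‖u‖) fun z => by
      refine (norm_rsmul_le u (ip (B := B) v z)).trans ?_
      rw [mul_right_comm]
      gcongr
      exact norm_ip_le v z

variable {E' : Type*} [NormedAddCommGroup E'] [NormedSpace ℂ E'] [CompleteSpace E']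
  [HilbertModule B E']

theorem rankOne_apply (u : E') (v z : E) : rankOne B u v z = rsmul u (ip (B := B) v z) := rfl

theorem ip_rankOne (u : E') (v x : E) (y : E') :
    ip (B := B) (rankOne B u v x) y = ip x (rankOne B v u y) := by
  rw [← star_ip, rankOne_apply, rankOne_apply, ip_rsmul_right, ip_rsmul_right, star_mul, star_ip,
    star_ip]

end HilbertModule

open HilbertModule

/-- `S` is the adjoint of the operator `T` of Hilbert `B`-modules. -/
def AdjointPair (B : Type*) [NonUnitalCStarAlgebra B] {E E' : Type*}
    [NormedAddCommGroup E] [NormedSpace ℂ E] [CompleteSpace E] [HilbertModule B E]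
    [NormedAddCommGroup E'] [NormedSpace ℂ E'] [CompleteSpace E'] [HilbertModule B E']
    (T : E →L[ℂ] E') (S : E' →L[ℂ] E) : Prop :=
  ∀ x y, ip (B := B) (T x) y = ip x (S y)

namespace AdjointPair

variable {B : Type*} [NonUnitalCStarAlgebra B]
  {E : Type*} [NormedAddCommGroup E] [NormedSpace ℂ E] [CompleteSpace E] [HilbertModule B E]
  {E' : Type*} [NormedAddCommGroup E'] [NormedSpace ℂ E'] [CompleteSpace E'] [HilbertModule B E']
  {E'' : Type*} [NormedAddCommGroup E''] [NormedSpace ℂ E''] [CompleteSpace E'']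
  [HilbertModule B E'']

theorem isAdjointable {T : E →L[ℂ] E'} {S : E' →L[ℂ] E} (h : AdjointPair B T S) :
    IsAdjointable B T := ⟨S, h⟩

theorem symm {T : E →L[ℂ] E'} {S : E' →L[ℂ] E} (h : AdjointPair B T S) : AdjointPair B S T :=
  fun x y => by rw [← star_ip, ← h, star_ip]

theorem comp {T : E →L[ℂ] E'} {S : E' →L[ℂ] E} {T' : E' →L[ℂ] E''} {S' : E'' →L[ℂ] E'}
    (h' : AdjointPair B T' S') (h : AdjointPair B T S) : AdjointPair B (T' ∘L T) (S ∘L S') :=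
  fun _ _ => (h' _ _).trans (h _ _)

theorem sub {T T' : E →L[ℂ] E'} {S S' : E' →L[ℂ] E}
    (h : AdjointPair B T S) (h' : AdjointPair B T' S') : AdjointPair B (T - T') (S - S') :=
  fun x y => by
    rw [sub_apply, sub_apply, ip_sub_left, ip_sub_right,
      h, h']

theorem map_rsmul {T : E →L[ℂ] E'} {S : E' →L[ℂ] E} (h : AdjointPair B T S) (x : E) (b : B) :
    T (rsmul x b) = rsmul (T x) b :=
  ext_ip B fun z => by rw [← h.symm, ip_rsmul_right, h.symm, ip_rsmul_right]

/-- One half of the `C⋆`-identity `‖T⋆ T‖ = ‖T‖²`, from the Cauchy-Schwarz inequality. -/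
theorem norm_sq_le {T : E →L[ℂ] E'} {S : E' →L[ℂ] E} (h : AdjointPair B T S) :
    ‖T‖ ^ 2 ≤ ‖S ∘L T‖ := by
  refine (Real.le_sqrt (norm_nonneg _) (norm_nonneg _)).mp ?_
  refine T.opNorm_le_bound (Real.sqrt_nonneg _) fun x => le_of_sq_le_sq ?_ (by positivity)
  rw [mul_pow, Real.sq_sqrt (norm_nonneg _), norm_sq (B := B), h]
  calc ‖ip (B := B) x (S (T x))‖ ≤ ‖x‖ * ‖(S ∘L T) x‖ := norm_ip_le _ _
    _ ≤ ‖x‖ * (‖S ∘L T‖ * ‖x‖) := by gcongr; exact (S ∘L T).le_opNorm x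
    _ = _ := by ring

theorem norm_le {T : E →L[ℂ] E'} {S : E' →L[ℂ] E} (h : AdjointPair B T S) : ‖T‖ ≤ ‖S‖ := by
  have h1 := h.norm_sq_le.trans (S.opNorm_comp_le T)
  by_contra! hlt
  nlinarith [norm_nonneg S]

theorem norm_eq {T : E →L[ℂ] E'} {S : E' →L[ℂ] E} (h : AdjointPair B T S) : ‖T‖ = ‖S‖ :=
  le_antisymm h.norm_le h.symm.norm_le

theorem norm_comp {T : E →L[ℂ] E'} {S : E' →L[ℂ] E} (h : AdjointPair B T S) :
    ‖S ∘L T‖ = ‖T‖ ^ 2 := by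
  refine le_antisymm ((S.opNorm_comp_le T).trans ?_) h.norm_sq_le
  rw [← h.norm_eq, sq]

end AdjointPair

section Compact

variable {B : Type*} [NonUnitalCStarAlgebra B]
  {E : Type*} [NormedAddCommGroup E] [NormedSpace ℂ E] [CompleteSpace E] [HilbertModule B E]
  {E' : Type*} [NormedAddCommGroup E'] [NormedSpace ℂ E'] [CompleteSpace E'] [HilbertModule B E']
  {E'' : Type*} [NormedAddCommGroup E''] [NormedSpace ℂ E''] [CompleteSpace E'']
  [HilbertModule B E'']

theorem IsAdjointable.comp {T : E →L[ℂ] E'} {T' : E' →L[ℂ] E''} (h' : IsAdjointable B T')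
    (h : IsAdjointable B T) : IsAdjointable B (T' ∘L T) := by
  obtain ⟨S, hS⟩ := h
  obtain ⟨S', hS'⟩ := h'
  exact (AdjointPair.comp hS' hS).isAdjointable

theorem IsAdjointable.sub {T T' : E →L[ℂ] E'} (h : IsAdjointable B T)
    (h' : IsAdjointable B T') : IsAdjointable B (T - T') := by
  obtain ⟨S, hS⟩ := h
  obtain ⟨S', hS'⟩ := h'
  exact (AdjointPair.sub hS hS').isAdjointable

theorem continuous_ip_left (y : E) : Continuous fun x : E => ip (B := B) x y := by
  have : LipschitzWith ‖y‖₊ fun x : E => ip (B := B) x y := LipschitzWith.of_dist_le_mul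
    fun x x' => by
      rw [dist_eq_norm, dist_eq_norm, ← ip_sub_left, mul_comm]
      exact norm_ip_le _ _
  exact this.continuous

theorem continuous_ip_right (x : E) : Continuous fun y : E => ip (B := B) x y := by
  have h := continuous_star.comp (continuous_ip_left (B := B) x)
  simpa only [Function.comp_def, star_ip] using h

/-- The adjointable operators are norm closed, since the adjoint is isometric. -/
theorem isClosed_isAdjointable : IsClosed {T : E →L[ℂ] E' | IsAdjointable B T} := by
  refine isClosed_of_closure_subset fun T hT => ?_
  obtain ⟨t, ht, hlim⟩ := mem_closure_iff_seq_limit.mp hT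
  choose s hs using ht
  have hs' : ∀ n, AdjointPair B (t n) (s n) := hs
  have hcs : CauchySeq s := by
    refine Metric.cauchySeq_iff'.mpr fun ε hε => ?_
    obtain ⟨N, hN⟩ := Metric.cauchySeq_iff'.mp hlim.cauchySeq ε hε
    refine ⟨N, fun n hn => ?_⟩
    rw [dist_eq_norm, ← ((hs' n).sub (hs' N)).norm_eq, ← dist_eq_norm]
    exact hN n hn
  obtain ⟨S, hS⟩ := cauchySeq_tendsto_of_complete hcs
  refine ⟨S, fun x y => ?_⟩
  have h1 := ((continuous_ip_left (B := B) y).tendsto (T x)).comp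
    ((ContinuousLinearMap.apply ℂ E' x).continuous.tendsto T |>.comp hlim)
  have h2 := ((continuous_ip_right (B := B) x).tendsto (S y)).comp
    ((ContinuousLinearMap.apply ℂ E y).continuous.tendsto S |>.comp hS)
  refine tendsto_nhds_unique h1 (h2.congr fun n => ?_)
  exact (hs n x y).symm

variable (B E E') in
/-- The finite sums of the operators `θ_{u, v}`, whose closure is by definition `compactOps`. -/
def finiteRankOps : AddSubgroup (E →L[ℂ] E') where
  carrier := {T | ∃ (n : ℕ) (u : Fin n → E') (v : Fin n → E),
    ∀ z, T z = ∑ i, rsmul (u i) (ip (B := B) (v i) z)}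
  zero_mem' := ⟨0, Fin.elim0, Fin.elim0, fun z => by simp⟩
  add_mem' := by
    rintro S T ⟨m, u, v, hS⟩ ⟨n, u', v', hT⟩
    refine ⟨m + n, Fin.append u u', Fin.append v v', fun z => ?_⟩
    simp [hS, hT, Fin.sum_univ_add]
  neg_mem' := by
    rintro S ⟨m, u, v, hS⟩
    refine ⟨m, fun i => -u i, v, fun z => ?_⟩
    simp [hS, neg_rsmul]

theorem isClosed_compactOps : IsClosed (compactOps B E E') := isClosed_closure

theorem zero_mem_compactOps : (0 : E →L[ℂ] E') ∈ compactOps B E E' :=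
  (finiteRankOps B E E').topologicalClosure.zero_mem

theorem add_mem_compactOps {S T : E →L[ℂ] E'} (hS : S ∈ compactOps B E E')
    (hT : T ∈ compactOps B E E') : S + T ∈ compactOps B E E' :=
  (finiteRankOps B E E').topologicalClosure.add_mem hS hT

theorem sub_mem_compactOps {S T : E →L[ℂ] E'} (hS : S ∈ compactOps B E E')
    (hT : T ∈ compactOps B E E') : S - T ∈ compactOps B E E' :=
  (finiteRankOps B E E').topologicalClosure.sub_mem hS hT

theorem sub_mem_compactOps_comm {S T : E →L[ℂ] E'} (h : S - T ∈ compactOps B E E') :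
    T - S ∈ compactOps B E E' := by
  rw [← neg_sub]
  exact (finiteRankOps B E E').topologicalClosure.neg_mem h

theorem comp_mem_compactOps {A : E' →L[ℂ] E''} (hA : IsAdjointable B A) {T : E →L[ℂ] E'}
    (hT : T ∈ compactOps B E E') : A ∘L T ∈ compactOps B E E'' := by
  obtain ⟨A', hA'⟩ := hA
  refine map_mem_closure (f := fun T : E →L[ℂ] E' => A ∘L T) (by fun_prop) hT ?_
  rintro T ⟨n, u, v, h⟩
  refine ⟨n, fun i => A (u i), v, fun z => ?_⟩
  rw [ContinuousLinearMap.comp_apply, h, map_sum]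
  exact Finset.sum_congr rfl fun i _ => AdjointPair.map_rsmul hA' _ _

theorem mem_compactOps_comp {A : E →L[ℂ] E'} (hA : IsAdjointable B A) {T : E' →L[ℂ] E''}
    (hT : T ∈ compactOps B E' E'') : T ∘L A ∈ compactOps B E E'' := by
  obtain ⟨A', hA'⟩ := hA
  refine map_mem_closure (f := fun T : E' →L[ℂ] E'' => T ∘L A) (by fun_prop) hT ?_
  rintro T ⟨n, u, v, h⟩
  refine ⟨n, u, fun i => A' (v i), fun z => ?_⟩
  rw [ContinuousLinearMap.comp_apply, h]
  refine Finset.sum_congr rfl fun i _ => ?_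
  rw [← AdjointPair.symm hA']

theorem isAdjointable_of_mem_compactOps {T : E →L[ℂ] E'} (hT : T ∈ compactOps B E E') :
    IsAdjointable B T := by
  refine closure_minimal ?_ isClosed_isAdjointable hT
  rintro T ⟨n, u, v, h⟩
  refine ⟨∑ i, rankOne B (v i) (u i), fun x y => ?_⟩
  rw [h, sum_apply, ip_sum_left, ip_sum_right]
  exact Finset.sum_congr rfl fun i _ => ip_rankOne (u i) (v i) x y

end Compact

section Extension

variable {R B : Type*} [AddCommGroup R] [Module ℂ R] [NonUnitalCStarAlgebra B]
  {ι : R →ₗ[ℂ] B} {V : Type*} [AddCommGroup V] [Module ℂ V] (P : PreHilbertModule ι V)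
  {V' : Type*} [AddCommGroup V'] [Module ℂ V'] (Q : PreHilbertModule ι V')

theorem ip_toHilbert (x y : V) :
    ip (B := B) (P.toHilbert x) (P.toHilbert y) = ι (P.form x y) := P.ipCompletion_coe x y

/-- Adjointness of operators between completions can be tested on the dense pre-Hilbert modules. -/
theorem adjointPair_of_toHilbert {T : P.Hilbert →L[ℂ] Q.Hilbert} {S : Q.Hilbert →L[ℂ] P.Hilbert}
    (h : ∀ x y, ip (B := B) (T (P.toHilbert x)) (Q.toHilbert y) =
      ip (P.toHilbert x) (S (Q.toHilbert y))) : AdjointPair B T S := by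
  intro x y
  refine P.denseRange_toHilbert.induction_on (p := fun x =>
    ip (B := B) (T x) y = ip x (S y)) x ?_ fun x => ?_
  · exact isClosed_eq ((continuous_ip_left y).comp T.continuous) (continuous_ip_left _)
  refine Q.denseRange_toHilbert.induction_on (p := fun y =>
    ip (B := B) (T (P.toHilbert x)) y = ip (P.toHilbert x) (S y)) y ?_ fun y => h x y
  exact isClosed_eq (continuous_ip_right _) ((continuous_ip_right _).comp S.continuous)

end Extension

section Operators

variable {Γ : Type v} {X Z : Type u} {H : Type w} [Group Γ]
  [TopologicalSpace X] [CompactSpace X] [T2Space X] [MulAction Γ X] [ContinuousConstSMul Γ X]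
  [MetricSpace Z] [ProperSpace Z] [MulAction Γᵐᵒᵖ Z] [IsIsometricSMul Γᵐᵒᵖ Z]
  [NormedAddCommGroup H] [InnerProductSpace ℂ H] [CompleteSpace H]
  (C : CrossedProduct.{u, v, t} (actX Γ X))

/-! ### The operators `T ⋊ Γ` -/

theorem ip_toFree_single (μ ν : Γ) (a b : C(X, H)) :
    ip (B := C.carrier) (toFree C (.single μ a)) (toFree C (.single ν b)) =
      C.ι (.single (μ⁻¹ * ν) ((actX Γ X).act μ⁻¹ (fip a b))) := by
  rw [← freeForm_single]
  exact ip_toHilbert _ _ _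

theorem clm_ext_single {F : Type*} [NormedAddCommGroup F] [NormedSpace ℂ F]
    {S T : FreeHilbert H C →L[ℂ] F}
    (h : ∀ μ a, S (toFree C (.single μ a)) = T (toFree C (.single μ a))) : S = T := by
  refine PreHilbertModule.clm_ext _ fun ξ => ?_
  induction ξ using Finsupp.induction_linear with
  | zero => simp
  | add ξ η hξ hη => simp only [map_add, hξ, hη]
  | single μ a => exact h μ a

theorem adjointPair_of_single {V : Type*} [AddCommGroup V] [Module ℂ V]
    {Q : PreHilbertModule C.ι V} {T : FreeHilbert H C →L[ℂ] Q.Hilbert}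
    {S : Q.Hilbert →L[ℂ] FreeHilbert H C}
    (h : ∀ μ a y, ip (B := C.carrier) (T (toFree C (.single μ a))) (Q.toHilbert y) =
      ip (toFree C (.single μ a)) (S (Q.toHilbert y))) : AdjointPair C.carrier T S := by
  refine adjointPair_of_toHilbert _ _ fun ξ y => ?_
  induction ξ using Finsupp.induction_linear with
  | zero =>
    have h0 (x : FreeHilbert H C) : ip (B := C.carrier) 0 x = 0 := by
      rw [← star_ip, ip_zero_right, star_zero]
    have h0' (x : Q.Hilbert) : ip (B := C.carrier) 0 x = 0 := by
      rw [← star_ip, ip_zero_right, star_zero]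
    rw [map_zero, map_zero, h0, h0']
  | add ξ η hξ hη => rw [map_add, map_add, ip_add_left, ip_add_left, hξ, hη]
  | single μ a => exact h μ a y

theorem adjointPair_of_single_single {T S : FreeHilbert H C →L[ℂ] FreeHilbert H C}
    (h : ∀ μ a ν b, ip (B := C.carrier) (T (toFree C (.single μ a))) (toFree C (.single ν b)) =
      ip (toFree C (.single μ a)) (S (toFree C (.single ν b)))) : AdjointPair C.carrier T S := by
  refine adjointPair_of_single C fun μ a η => ?_
  induction η using Finsupp.induction_linear with
  | zero => rw [map_zero, map_zero, ip_zero_right, ip_zero_right]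
  | add ξ η hξ hη => simp only [map_add, ip_add_right, hξ, hη]
  | single ν b => exact h μ a ν b

theorem rtimes_single {T : C(X, H) →L[ℂ] C(X, H)} (hT : IsAdjointable C(X, ℂ) T) (μ : Γ)
    (a : C(X, H)) : rtimes C T (toFree C (.single μ a)) = toFree C (.single μ (T a)) := by
  rw [rtimes_coe C hT]
  simp

theorem adjointPair_rtimes {T T' : C(X, H) →L[ℂ] C(X, H)} (h : AdjointPair C(X, ℂ) T T') :
    AdjointPair C.carrier (rtimes C T) (rtimes C T') := by
  refine adjointPair_of_single_single C fun μ a ν b => ?_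
  have hf : fip (T a) b = fip a (T' b) := h a b
  rw [rtimes_single C h.isAdjointable, rtimes_single C h.symm.isAdjointable, ip_toFree_single,
    ip_toFree_single, hf]

theorem isAdjointable_rtimes {T : C(X, H) →L[ℂ] C(X, H)} (hT : IsAdjointable C(X, ℂ) T) :
    IsAdjointable C.carrier (rtimes C T) := by
  obtain ⟨T', hT'⟩ := hT
  exact (adjointPair_rtimes C hT').isAdjointable

theorem rtimes_comp {S T : C(X, H) →L[ℂ] C(X, H)} (hS : IsAdjointable C(X, ℂ) S)
    (hT : IsAdjointable C(X, ℂ) T) : rtimes C (S ∘L T) = rtimes C S ∘L rtimes C T := by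
  refine clm_ext_single C fun μ a => ?_
  rw [ContinuousLinearMap.comp_apply, rtimes_single C (hS.comp hT), rtimes_single C hT,
    rtimes_single C hS]
  rfl

theorem rtimes_sub {S T : C(X, H) →L[ℂ] C(X, H)} (hS : IsAdjointable C(X, ℂ) S)
    (hT : IsAdjointable C(X, ℂ) T) : rtimes C (S - T) = rtimes C S - rtimes C T := by
  refine clm_ext_single C fun μ a => ?_
  rw [sub_apply, rtimes_single C (hS.sub hT), rtimes_single C hT, rtimes_single C hS, ← map_sub,
    ← Finsupp.single_sub]
  rfl

/-- The operation `T ↦ T ⋊ Γ` is contractive: this is the bound for operators with a formal adjoint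
whose iterates grow at most exponentially on each vector. -/
theorem norm_rtimes_le {T : C(X, H) →L[ℂ] C(X, H)} (hT : IsAdjointable C(X, ℂ) T) :
    ‖rtimes C T‖ ≤ ‖T‖ := by
  obtain ⟨T', hT'⟩ := hT
  have hp : AdjointPair C(X, ℂ) T T' := hT'
  refine le_of_forall_pos_le_add fun ε hε => ?_
  have hs : 0 < ‖T‖ + ε := by positivity
  refine (rtimes C T).opNorm_le_bound hs.le fun ξ => ?_
  refine (PreHilbertModule.denseRange_toHilbert (freePreHilbert (H := H) C)).induction_on
    (p := fun ξ => ‖rtimes C T ξ‖ ≤ (‖T‖ + ε) * ‖ξ‖) ξ ?_ fun ξ => ?_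
  · exact isClosed_le (by fun_prop) (by fun_prop)
  have key := PreHilbertModule.bounded_of_adjoint (freePreHilbert (H := H) C)
    (Finsupp.mapRange.linearMap (T : C(X, H) →ₗ[ℂ] C(X, H)))
    (Finsupp.mapRange.linearMap (T' : C(X, H) →ₗ[ℂ] C(X, H))) (fun ξ η => ?_)
    (s := (‖T‖ + ε) ^ 2) (by positivity) (fun ξ => ?_) ξ
  · rw [Real.sqrt_sq hs.le] at key
    change ‖rtimes C T (toFree C ξ)‖ ≤ _
    rw [rtimes_coe C hp.isAdjointable]
    exact key
  · have := adjointPair_rtimes C hp (toFree C ξ) (toFree C η)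
    rw [rtimes_coe C hp.isAdjointable, rtimes_coe C hp.symm.isAdjointable, ip_toHilbert,
      ip_toHilbert] at this
    exact this
  · have hpow : ∀ (n : ℕ) (μ : Γ) (a : C(X, H)),
        ((Finsupp.mapRange.linearMap (T' : C(X, H) →ₗ[ℂ] C(X, H)) ∘ₗ
          Finsupp.mapRange.linearMap (T : C(X, H) →ₗ[ℂ] C(X, H))) ^ n) (.single μ a) =
        .single μ (((T' ∘L T) ^ n) a) := by
      intro n μ a
      induction n with
      | zero => rfl
      | succ n ih =>
        rw [pow_succ', pow_succ', Module.End.mul_apply, mul_apply_eq_comp, ih]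
        simp
    have hnorm : ‖T' ∘L T‖ ≤ (‖T‖ + ε) ^ 2 := by
      rw [hp.norm_comp]
      gcongr
      linarith
    induction ξ using Finsupp.induction_linear with
    | zero => exact ⟨0, fun n => by simp⟩
    | add ξ η hξ hη =>
      obtain ⟨K, hK⟩ := hξ
      obtain ⟨L, hL⟩ := hη
      refine ⟨K + L, fun n => ?_⟩
      rw [map_add, map_add, add_mul]
      exact (norm_add_le _ _).trans (add_le_add (hK n) (hL n))
    | single μ a =>
      refine ⟨‖a‖, fun n => ?_⟩
      rw [hpow]
      refine (norm_toFree_single_le C _ _).trans ?_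
      rw [mul_comm]
      induction n with
      | zero => simp
      | succ n ih =>
        rw [pow_succ', mul_apply_eq_comp, pow_succ', mul_assoc]
        refine (ContinuousLinearMap.le_opNorm _ _).trans ?_
        gcongr

theorem rtimes_mem_compactOps {K : C(X, H) →L[ℂ] C(X, H)}
    (hK : K ∈ compactOps C(X, ℂ) C(X, H) C(X, H)) :
    rtimes C K ∈ compactOps C.carrier (FreeHilbert H C) (FreeHilbert H C) := by
  have hfin : ∀ T : C(X, H) →L[ℂ] C(X, H), T ∈ finiteRankOps C(X, ℂ) C(X, H) C(X, H) →
      rtimes C T ∈ finiteRankOps C.carrier (FreeHilbert H C) (FreeHilbert H C) := by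
    rintro T ⟨n, u, v, h⟩
    have hT : IsAdjointable C(X, ℂ) T :=
      isAdjointable_of_mem_compactOps (subset_closure ⟨n, u, v, h⟩)
    have hsum : rtimes C T =
        ∑ i, rankOne C.carrier (toFree C (.single 1 (u i))) (toFree C (.single 1 (v i))) := by
      refine clm_ext_single C fun μ a => ?_
      rw [rtimes_single C hT, sum_apply, h]
      simp only [rankOne_apply, ip_toFree_single]
      rw [← Finsupp.singleAddHom_apply, map_sum, map_sum]
      refine Finset.sum_congr rfl fun i _ => ?_
      refine Eq.trans ?_
        (PreHilbertModule.actCompletion_coe (freePreHilbert (H := H) C) _ _).symm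
      change _ = toFree C (freeAct _ _)
      rw [freeAct_single, inv_one, one_mul, one_mul, (actX Γ X).act_one, (actX Γ X).act_one]
      rfl
    exact ⟨n, _, _, fun z => by rw [hsum, sum_apply]; rfl⟩
  refine Metric.mem_closure_iff.mpr fun ε hε => ?_
  obtain ⟨T, hT, hd⟩ := Metric.mem_closure_iff.mp hK ε hε
  refine ⟨rtimes C T, hfin T hT, lt_of_le_of_lt ?_ hd⟩
  have hKa := isAdjointable_of_mem_compactOps hK
  have hTa : IsAdjointable C(X, ℂ) T := isAdjointable_of_mem_compactOps (subset_closure hT)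
  rw [dist_eq_norm, dist_eq_norm, ← rtimes_sub C hKa hTa]
  exact norm_rtimes_le C (hKa.sub hTa)

variable (ρ : EquivariantRep Γ X Z H)

theorem shift_single (μ ν : Γ) (a : C(X, H)) :
    shift C ρ μ (toFree C (.single ν a)) = toFree C (.single (μ * ν) (translate ρ.U μ a)) := by
  rw [shift_coe, preShift_single]

theorem rtimes_comp_shift {T : C(X, H) →L[ℂ] C(X, H)} (hT : IsAdjointable C(X, ℂ) T)
    (hE : IsEquivariant ρ T) (μ : Γ) : rtimes C T ∘L shift C ρ μ = shift C ρ μ ∘L rtimes C T := by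
  refine clm_ext_single C fun ν a => ?_
  rw [ContinuousLinearMap.comp_apply, ContinuousLinearMap.comp_apply, shift_single,
    rtimes_single C hT, rtimes_single C hT, shift_single, hE]

theorem adjointPair_shift (μ : Γ) : AdjointPair C.carrier (shift C ρ μ) (shift C ρ μ⁻¹) := by
  refine adjointPair_of_single_single C fun ν a κ b => ?_
  have h : fip (translate ρ.U μ a) b = (actX Γ X).act μ (fip a (translate ρ.U μ⁻¹ b)) := by
    rw [← fip_translate ρ.U, ← translate_mul, mul_inv_cancel, translate_one]
  rw [shift_single, shift_single, ip_toFree_single, ip_toFree_single, h, ← CStarAction.act_mul,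
    show (μ * ν)⁻¹ * κ = ν⁻¹ * (μ⁻¹ * κ) by group, show (μ * ν)⁻¹ * μ = ν⁻¹ by group]

theorem norm_shift_le (μ : Γ) : ‖shift C ρ μ‖ ≤ 1 := by
  have h : shift C ρ μ⁻¹ ∘L shift C ρ μ = ContinuousLinearMap.id ℂ _ := by
    refine clm_ext_single C fun ν a => ?_
    rw [ContinuousLinearMap.comp_apply, shift_single, shift_single, ← translate_mul,
      inv_mul_cancel, translate_one, inv_mul_cancel_left]
    rfl
  have h1 := (adjointPair_shift C ρ μ).norm_sq_le
  rw [h] at h1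
  have h2 := h1.trans ContinuousLinearMap.norm_id_le
  nlinarith [norm_nonneg (shift C ρ μ)]

/-! ### Contractivity of the representation `π` -/

/-- A representation of `C₀(Z × X)` is contractive: if `N = ‖g‖` and `b = N - (N² - |g|²)^(1/2)`,
then `N² - |g|² = (N - b)²` and `b` again vanishes at infinity, so that
`N² ⟨ξ, ξ⟩ - ⟨π(g) ξ, π(g) ξ⟩ = ⟨ζ, ζ⟩` for `ζ = N ξ - π(b) ξ`. -/
theorem norm_π_le (g : C₀(Z × X, ℂ)) : ‖ρ.π g‖ ≤ ‖g‖ := by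
  refine (ρ.π g).opNorm_le_bound (norm_nonneg _) fun ξ => ?_
  set N := ‖g‖ with hN
  let b : C₀(Z × X, ℂ) :=
    { toFun := fun p => ((N - √(N ^ 2 - ‖g p‖ ^ 2) : ℝ) : ℂ)
      continuous_toFun := by fun_prop
      zero_at_infty' := by
        have h1 := (zero_at_infty g).norm
        have h2 : Continuous fun t : ℝ => ((N - √(N ^ 2 - t ^ 2) : ℝ) : ℂ) := by fun_prop
        have h3 := (h2.tendsto ‖(0 : ℂ)‖).comp h1
        simpa [Real.sqrt_sq (norm_nonneg g), hN, Function.comp_def] using h3 }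
  have hle : ∀ p, ‖g p‖ ≤ N := fun p => by
    rw [hN, ← ZeroAtInftyContinuousMap.norm_toBCF_eq_norm]
    exact g.toBCF.norm_coe_le_norm p
  have hb : star b = b := by
    ext p
    change star ((N - √(N ^ 2 - ‖g p‖ ^ 2) : ℝ) : ℂ) = ((N - √(N ^ 2 - ‖g p‖ ^ 2) : ℝ) : ℂ)
    simp
  have hbg : star g * g = (2 * N : ℂ) • b - star b * b := by
    rw [hb]
    ext p
    change star (g p) * g p = (2 * N : ℂ) * ((N - √(N ^ 2 - ‖g p‖ ^ 2) : ℝ) : ℂ) -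
      ((N - √(N ^ 2 - ‖g p‖ ^ 2) : ℝ) : ℂ) * ((N - √(N ^ 2 - ‖g p‖ ^ 2) : ℝ) : ℂ)
    have hsq := Real.sq_sqrt (show 0 ≤ N ^ 2 - ‖g p‖ ^ 2 by
      have := hle p
      have := norm_nonneg (g p)
      nlinarith)
    have h1 : star (g p) * g p = ((‖g p‖ ^ 2 : ℝ) : ℂ) := by
      rw [mul_comm, Complex.star_def, Complex.mul_conj, Complex.normSq_eq_norm_sq]
    rw [h1]
    norm_cast
    nlinarith
  set ζ := (N : ℂ) • ξ - ρ.π b ξ with hζ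
  have hstar : ∀ f : C₀(Z × X, ℂ), fip (ρ.π f ξ) (ρ.π f ξ) = fip ξ (ρ.π (star f * f) ξ) := by
    intro f
    have h := ρ.π_star (star f) ξ (ρ.π f ξ)
    rwa [star_star, ← mul_apply_eq_comp, ← map_mul] at h
  have key : fip (ρ.π g ξ) (ρ.π g ξ) = ((N : ℂ) ^ 2) • fip ξ ξ - fip ζ ζ := by
    have h1 : fip (ρ.π b ξ) ξ = fip ξ (ρ.π b ξ) := by rw [← ρ.π_star, hb]
    have h2 := hstar b
    have h3 : fip ζ ζ = ((N : ℂ) ^ 2) • fip ξ ξ - (2 * N : ℂ) • fip ξ (ρ.π b ξ) +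
        fip (ρ.π b ξ) (ρ.π b ξ) := by
      ext x
      have h1x := congrArg (fun F : C(X, ℂ) => F x) h1
      simp only [fip_apply] at h1x
      simp only [hζ, fip_apply, ContinuousMap.sub_apply, ContinuousMap.smul_apply,
        ContinuousMap.add_apply, inner_sub_left, inner_sub_right, inner_smul_left,
        inner_smul_right, h1x, Complex.conj_ofReal, smul_eq_mul]
      ring
    have h4 : fip ξ (ρ.π (star g * g) ξ) =
        (2 * N : ℂ) • fip ξ (ρ.π b ξ) - fip (ρ.π b ξ) (ρ.π b ξ) := by
      rw [hbg, map_sub, map_smul, sub_apply, smul_apply, h2]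
      ext x
      simp
    rw [hstar g, h4, h3]
    abel
  refine (ContinuousMap.norm_le _ (by positivity)).mpr fun x => ?_
  have hx := congrArg (fun F : C(X, ℂ) => F x) key
  simp only [fip_apply, ContinuousMap.sub_apply, ContinuousMap.smul_apply,
    inner_self_eq_norm_sq_to_K, smul_eq_mul] at hx
  have hx' : ‖ρ.π g ξ x‖ ^ 2 = N ^ 2 * ‖ξ x‖ ^ 2 - ‖ζ x‖ ^ 2 := by
    apply Complex.ofReal_injective
    push_cast
    exact hx
  have h5 : ‖ρ.π g ξ x‖ ≤ N * ‖ξ x‖ := by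
    refine le_of_sq_le_sq ?_ (by positivity)
    nlinarith [sq_nonneg ‖ζ x‖]
  exact h5.trans (by gcongr; exact ξ.norm_coe_le_norm x)

end Operators

/-! ### Coefficients in a crossed product -/

section Coefficients

variable {Γ : Type v} {A : Type u} [Group Γ] [NonUnitalCStarAlgebra A] {α : CStarAction Γ A}

theorem CStarAction.conv_apply (f g : Γ →₀ A) (γ : Γ) :
    α.conv f g γ = f.sum fun μ a => a * α.act μ (g (μ⁻¹ * γ)) := by
  classical
  induction f using Finsupp.induction_linear with
  | zero => simp
  | add f f' h h' =>
    rw [conv_add_left, Finsupp.add_apply, h, h']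
    refine (Finsupp.sum_add_index' (fun μ => ?_) fun μ a b => ?_).symm
    · simp
    · simp [add_mul]
  | single μ a =>
    rw [Finsupp.sum_single_index (by simp)]
    induction g using Finsupp.induction_linear with
    | zero => simp
    | add g g' h h' => simp [conv_add_right, h, h', mul_add]
    | single ν b =>
      rw [conv_single, Finsupp.single_apply, Finsupp.single_apply]
      by_cases h : ν = μ⁻¹ * γ
      · subst h; simp
      · have : ¬ μ * ν = γ := fun h' => h (by rw [← h']; group)
        simp [h, this]

theorem CStarAction.conv_invol_one (f : Γ →₀ A) :
    α.conv (α.invol f) f 1 = ∑ μ ∈ f.support, α.act μ⁻¹ (star (f μ) * f μ) := by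
  classical
  have h : ∀ g : Γ →₀ A, α.conv (α.invol f) g 1 =
      ∑ μ ∈ f.support, α.act μ⁻¹ (star (f μ) * g μ) := by
    intro g
    induction f using Finsupp.induction_linear with
    | zero => simp
    | add f f' h h' =>
      have hs : ∀ (k : Γ →₀ A) (s : Finset Γ), k.support ⊆ s →
          ∑ μ ∈ k.support, α.act μ⁻¹ (star (k μ) * g μ) =
            ∑ μ ∈ s, α.act μ⁻¹ (star (k μ) * g μ) := by
        intro k s hks
        refine Finset.sum_subset hks fun μ _ hμ => ?_
        rw [Finsupp.notMem_support_iff.mp hμ, star_zero, zero_mul, map_zero]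
      rw [invol_add, conv_add_left, Finsupp.add_apply, h, h', hs f _ Finset.subset_union_left,
        hs f' _ Finset.subset_union_right, hs (f + f') _ Finsupp.support_add,
        ← Finset.sum_add_distrib]
      refine Finset.sum_congr rfl fun μ _ => ?_
      rw [Finsupp.add_apply, star_add, add_mul, map_add]
    | single μ a =>
      rw [invol_single, conv_apply, Finsupp.sum_single_index (by simp)]
      by_cases ha : a = 0
      · simp [ha]
      · rw [Finsupp.support_single _ ha, Finset.sum_singleton]
        simp
  exact h f

/-- Every `C⋆`-completion dominates the coefficients of the elements of `C_c(Γ, A)`. The estimate by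
the reduced norm is applied to the vector supported at `1` whose translate by `γ` is `f(γ)⋆`. -/
theorem norm_coeff_le (P : CrossedProduct.{u, v, t} α) (f : Γ →₀ A) (γ : Γ) :
    ‖f γ‖ ≤ ‖P.ι f‖ := by
  classical
  let _ := CStarAlgebra.spectralOrder A
  have := CStarAlgebra.spectralOrderedRing A
  have hiso : ∀ (μ : Γ) (a : A), ‖α.act μ a‖ = ‖a‖ := by
    intro μ a
    refine le_antisymm (norm_act_le α μ a) ?_
    conv_lhs => rw [← α.act_one a, ← inv_mul_cancel μ, α.act_mul]
    exact norm_act_le α _ _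
  set a := α.act γ⁻¹ (star (f γ)) with ha
  have hna : ‖a‖ = ‖f γ‖ := by rw [ha, hiso, norm_star]
  have haγ : α.act γ a = star (f γ) := by
    rw [ha, ← α.act_mul, mul_inv_cancel, α.act_one]
  have h := P.reduced_le f (.single 1 a)
  set η := α.conv f (.single 1 a) with hη
  have hηγ : η γ = f γ * star (f γ) := by
    rw [hη, CStarAction.conv_single_right_apply, inv_one, mul_one, haγ]
  have h1 : ‖α.conv (α.invol (.single 1 a)) (.single 1 a) 1‖ = ‖f γ‖ ^ 2 := by
    rw [CStarAction.invol_single, CStarAction.conv_single, inv_one, mul_one, α.act_one,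
      α.act_one, Finsupp.single_eq_same, CStarRing.norm_star_mul_self, hna, sq]
  have hpos : ∀ μ, 0 ≤ α.act μ⁻¹ (star (η μ) * η μ) := by
    intro μ
    rw [map_mul, map_star]
    exact star_mul_self_nonneg _
  have h2 : ‖f γ‖ ^ 4 ≤ ‖α.conv (α.invol η) η 1‖ := by
    have h3 : ‖α.act γ⁻¹ (star (η γ) * η γ)‖ = ‖f γ‖ ^ 4 := by
      rw [hiso, CStarRing.norm_star_mul_self, hηγ, CStarRing.norm_self_mul_star]
      ring
    rw [← h3, CStarAction.conv_invol_one]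
    by_cases hγ : γ ∈ η.support
    · exact CStarAlgebra.norm_le_norm_of_nonneg_of_le (hpos γ)
        (Finset.single_le_sum (f := fun μ => α.act μ⁻¹ (star (η μ) * η μ))
          (fun μ _ => hpos μ) hγ)
    · rw [Finsupp.notMem_support_iff.mp hγ]
      simp
  rw [h1] at h
  have h4 := h2.trans h
  rcases (norm_nonneg (f γ)).eq_or_lt with h0 | h0
  · rw [← h0]; exact norm_nonneg _
  · refine le_of_sq_le_sq ?_ (norm_nonneg _)
    refine le_of_mul_le_mul_right ?_ (pow_pos h0 2)
    calc _ = ‖f γ‖ ^ 4 := by ring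
      _ ≤ _ := h4

theorem ι_injective (P : CrossedProduct.{u, v, t} α) : Function.Injective P.ι := by
  intro a b hab
  rw [← sub_eq_zero]
  ext1 γ
  have := norm_coeff_le P (a - b) γ
  rw [map_sub, hab, sub_self, norm_zero] at this
  simpa using this

theorem continuous_ι_single (P : CrossedProduct.{u, v, t} α) (γ : Γ) :
    Continuous fun a : A => P.ι (.single γ a) :=
  (LinearMap.mkContinuous (P.ι ∘ₗ Finsupp.lsingle γ) 1 fun a => by
    rw [one_mul]; exact norm_ι_single_le P γ a).continuous

end Coefficients

/-- The functions of compact support are dense in `C₀(Y)`. -/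
theorem dense_hasCompactSupport (Y : Type*) [TopologicalSpace Y] [T2Space Y] :
    Dense {g : C₀(Y, ℂ) | HasCompactSupport g} := by
  refine fun g => Metric.mem_closure_iff.mpr fun ε hε => ?_
  -- `χ` vanishes on `[0, ε / 4]` and equals `1` on `[ε / 2, ∞)`
  let χ : ℝ → ℝ := fun s => min 1 (max 0 (4 * s / ε - 1))
  have hχ0 : ∀ s, 0 ≤ χ s := fun s => le_min zero_le_one (le_max_left _ _)
  have hχ1 : ∀ s, χ s ≤ 1 := fun s => min_le_left _ _
  have hg := (zero_at_infty g).norm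
  rw [norm_zero] at hg
  obtain ⟨K, hK, hKg⟩ := Filter.mem_cocompact.mp
    (hg.eventually_lt_const (show 0 < ε / 4 by positivity))
  have hsupp : HasCompactSupport fun p => (χ ‖g p‖ : ℂ) * g p := by
    refine HasCompactSupport.intro hK fun p hp => ?_
    have h : ‖g p‖ < ε / 4 := hKg hp
    have h1 : 4 * ‖g p‖ / ε - 1 ≤ 0 := by
      rw [sub_nonpos, div_le_one hε]
      linarith
    have h2 : χ ‖g p‖ = 0 := by
      simp only [χ, max_eq_left h1]
      exact min_eq_right zero_le_one
    rw [h2]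
    simp
  have hcont : Continuous fun p => (χ ‖g p‖ : ℂ) * g p := by fun_prop
  refine ⟨⟨⟨_, hcont⟩, hsupp.is_zero_at_infty⟩, hsupp, ?_⟩
  rw [dist_eq_norm, ← ZeroAtInftyContinuousMap.norm_toBCF_eq_norm]
  refine lt_of_le_of_lt (BoundedContinuousFunction.norm_le (C := ε / 2) (by positivity) |>.mpr
    fun p => ?_) (half_lt_self hε)
  change ‖g p - (χ ‖g p‖ : ℂ) * g p‖ ≤ ε / 2
  have h1 : g p - (χ ‖g p‖ : ℂ) * g p = ((1 - χ ‖g p‖ : ℝ) : ℂ) * g p := by push_cast; ring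
  rw [h1, norm_mul, Complex.norm_real, Real.norm_eq_abs, abs_of_nonneg (by linarith [hχ1 ‖g p‖])]
  rcases le_total ‖g p‖ (ε / 2) with h | h
  · nlinarith [hχ0 ‖g p‖, hχ1 ‖g p‖, norm_nonneg (g p)]
  · have h2 : 1 ≤ 4 * ‖g p‖ / ε - 1 := by
      rw [le_sub_iff_add_le, le_div_iff₀ hε]
      linarith
    have h3 : χ ‖g p‖ = 1 := min_eq_left (h2.trans (le_max_right _ _))
    rw [h3, sub_self, zero_mul]
    positivity

/-- A constant factor in an estimate disappears if the estimate holds for all powers `2 ^ k`. -/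
theorem le_of_forall_pow_two_pow_le {a b N : ℝ} (hb : 0 ≤ b)
    (h : ∀ k : ℕ, a ^ 2 ^ k ≤ N * b ^ 2 ^ k) : a ≤ b := by
  by_contra! hlt
  rcases hb.eq_or_lt with rfl | hb
  · have := h 0
    simp at this
    linarith
  have htend := (tendsto_pow_atTop_atTop_of_one_lt (r := a / b) (by rwa [one_lt_div hb])).comp
    (tendsto_pow_atTop_atTop_of_one_lt (r := (2 : ℕ)) one_lt_two)
  obtain ⟨k, hk⟩ := (htend.eventually_gt_atTop N).exists
  refine absurd (h k) (not_le.mpr ?_)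
  rwa [Function.comp_apply, div_pow, lt_div_iff₀ (by positivity)] at hk

section IntegratedForm

variable {Γ : Type v} {X Z : Type u} {H : Type w} [Group Γ]
  [TopologicalSpace X] [CompactSpace X] [T2Space X] [MulAction Γ X] [ContinuousConstSMul Γ X]
  [MetricSpace Z] [ProperSpace Z] [MulAction Γᵐᵒᵖ Z] [IsIsometricSMul Γᵐᵒᵖ Z]
  [NormedAddCommGroup H] [InnerProductSpace ℂ H] [CompleteSpace H]
  (C : CrossedProduct.{u, v, t} (actX Γ X)) (ρ : EquivariantRep Γ X Z H)
  (P : CrossedProduct.{u, v, t} (actZX Γ X Z))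

/-! ### The representation `π ⋊ Γ` on `C_c(Γ, C₀(Z × X))` -/

theorem preInt_single (μ : Γ) (g : C₀(Z × X, ℂ)) :
    preInt C ρ (.single μ g) = rtimes C (ρ.π g) ∘L shift C ρ μ := by
  rw [preInt, Finsupp.lsum_single]
  rfl

theorem preInt_single_single (μ ν : Γ) (g : C₀(Z × X, ℂ)) (a : C(X, H)) :
    preInt C ρ (.single μ g) (toFree C (.single ν a)) =
      toFree C (.single (μ * ν) (ρ.π g (translate ρ.U μ a))) := by
  rw [preInt_single, ContinuousLinearMap.comp_apply, shift_single,
    rtimes_single C (isAdjointable_π ρ g)]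

theorem preInt_conv (f g : Γ →₀ C₀(Z × X, ℂ)) :
    preInt C ρ ((actZX Γ X Z).conv f g) = preInt C ρ f ∘L preInt C ρ g := by
  induction f using Finsupp.induction_linear with
  | zero => simp
  | add f f' h h' =>
    refine (congrArg (preInt C ρ) (CStarAction.conv_add_left _ f f' g)).trans ?_
    refine ((preInt C ρ).map_add _ _).trans ((congrArg₂ (· + ·) h h').trans ?_)
    rw [map_add, ContinuousLinearMap.add_comp]
  | single μ a =>
    induction g using Finsupp.induction_linear with
    | zero => simp
    | add g g' h h' =>
      refine (congrArg (preInt C ρ) (CStarAction.conv_add_right _ _ g g')).trans ?_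
      refine ((preInt C ρ).map_add _ _).trans ((congrArg₂ (· + ·) h h').trans ?_)
      rw [map_add, ContinuousLinearMap.comp_add]
    | single ν b =>
      refine clm_ext_single C fun κ ξ => ?_
      rw [CStarAction.conv_single, ContinuousLinearMap.comp_apply, preInt_single_single,
        preInt_single_single, preInt_single_single, map_mul, mul_apply_eq_comp, translate_mul,
        ρ.equivariant, mul_assoc]

theorem adjointPair_preInt (f : Γ →₀ C₀(Z × X, ℂ)) :
    AdjointPair C.carrier (preInt C ρ f) (preInt C ρ ((actZX Γ X Z).invol f)) := by
  induction f using Finsupp.induction_linear with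
  | zero =>
    refine adjointPair_of_single_single C fun μ a ν b => ?_
    rw [CStarAction.invol_zero, map_zero, zero_apply, zero_apply, ip_zero_right, ← star_ip,
      ip_zero_right, star_zero]
  | add f g hf hg =>
    intro x y
    rw [CStarAction.invol_add, map_add, map_add, add_apply, add_apply, ip_add_left, ip_add_right,
      hf, hg]
  | single μ g =>
    refine adjointPair_of_single_single C fun ν a κ b => ?_
    have h1 : fip (ρ.π g (translate ρ.U μ a)) b =
        (actX Γ X).act μ (fip a (translate ρ.U μ⁻¹ (ρ.π (star g) b))) := by
      have h := ρ.π_star (star g) (translate ρ.U μ a) b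
      rw [star_star] at h
      rw [h, ← fip_translate ρ.U, ← translate_mul, mul_inv_cancel, translate_one]
    rw [CStarAction.invol_single, preInt_single_single, preInt_single_single, ip_toFree_single,
      ip_toFree_single, ρ.equivariant, h1, ← CStarAction.act_mul,
      show (μ * ν)⁻¹ * κ = ν⁻¹ * (μ⁻¹ * κ) by group, show (μ * ν)⁻¹ * μ = ν⁻¹ by group]

theorem norm_preInt_single_le (μ : Γ) (g : C₀(Z × X, ℂ)) :
    ‖preInt C ρ (.single μ g)‖ ≤ ‖g‖ := by
  rw [preInt_single]
  refine (ContinuousLinearMap.opNorm_comp_le _ _).trans ?_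
  have h1 := (norm_rtimes_le C (isAdjointable_π ρ g)).trans (norm_π_le ρ g)
  calc _ ≤ ‖g‖ * 1 := mul_le_mul h1 (norm_shift_le C ρ μ) (norm_nonneg _) (norm_nonneg _)
    _ = _ := mul_one _

theorem norm_preInt_le_sum (f : Γ →₀ C₀(Z × X, ℂ)) (s : Finset Γ) (hs : f.support ⊆ s) :
    ‖preInt C ρ f‖ ≤ ∑ γ ∈ s, ‖f γ‖ := by
  have h : preInt C ρ f = ∑ γ ∈ s, preInt C ρ (.single γ (f γ)) := by
    conv_lhs => rw [← f.sum_single, Finsupp.sum_of_support_subset _ hs _ (by simp), map_sum]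
  rw [h]
  exact (norm_sum_le _ _).trans (Finset.sum_le_sum fun γ _ => norm_preInt_single_le C ρ γ _)

theorem exists_of_conv_apply_ne_zero {f g : Γ →₀ C₀(Z × X, ℂ)} {γ : Γ} {z : Z} {x : X}
    (h : (actZX Γ X Z).conv f g γ (z, x) ≠ 0) :
    ∃ μ, f μ (z, x) ≠ 0 ∧ g (μ⁻¹ * γ) (MulOpposite.op μ • z, μ⁻¹ • x) ≠ 0 := by
  by_contra! hcon
  refine h ?_
  let ev : C₀(Z × X, ℂ) →+ ℂ := ⟨⟨fun f => f (z, x), rfl⟩, fun _ _ => rfl⟩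
  change ev _ = 0
  rw [CStarAction.conv_apply, Finsupp.sum, map_sum]
  refine Finset.sum_eq_zero fun μ _ => ?_
  change f μ (z, x) * g (μ⁻¹ * γ) (MulOpposite.op μ • z, μ⁻¹ • x) = 0
  by_cases h0 : f μ (z, x) = 0
  · rw [h0, zero_mul]
  · rw [hcon μ h0, mul_zero]

/-- The coefficients of `f` are supported over `K ∩ K γ⁻¹`. Such `f` form a subalgebra, namely the
corner of `C_c(Γ, C₀(Z × X))` cut out by `K`. -/
def SupportedOver (K : Set Z) (f : Γ →₀ C₀(Z × X, ℂ)) : Prop :=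
  ∀ γ z x, f γ (z, x) ≠ 0 → z ∈ K ∧ MulOpposite.op γ • z ∈ K

theorem SupportedOver.conv {K : Set Z} {f g : Γ →₀ C₀(Z × X, ℂ)} (hf : SupportedOver K f)
    (hg : SupportedOver K g) : SupportedOver K ((actZX Γ X Z).conv f g) := by
  intro γ z x h
  obtain ⟨μ, h1, h2⟩ := exists_of_conv_apply_ne_zero h
  refine ⟨(hf _ _ _ h1).1, ?_⟩
  have h3 := (hg _ _ _ h2).2
  rwa [smul_smul, ← MulOpposite.op_mul, mul_inv_cancel_left] at h3

theorem supportedOver_conv_invol {K : Set Z} {f : Γ →₀ C₀(Z × X, ℂ)}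
    (hf : ∀ γ z x, f γ (z, x) ≠ 0 → z ∈ K) :
    SupportedOver K ((actZX Γ X Z).conv f ((actZX Γ X Z).invol f)) := by
  intro γ z x h
  obtain ⟨μ, h1, h2⟩ := exists_of_conv_apply_ne_zero h
  refine ⟨hf _ _ _ h1, ?_⟩
  rw [CStarAction.invol_apply, actZX_apply, smul_smul, ← MulOpposite.op_mul,
    mul_inv_cancel_left] at h2
  exact hf _ _ _ fun h0 => h2 (by
    change star (f _ _) = 0
    rw [h0, star_zero])

variable [ProperlyDiscontinuousSMul Γᵐᵒᵖ Z]

/-- Since the action on `Z` is proper, the elements supported over a compact set `K` have their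
supports in a fixed finite subset of `Γ`, say of cardinality `N`, so that `‖(π ⋊ Γ)(f)‖ ≤ N ‖f‖`.
For self-adjoint `f` the same bound for the powers `f ^ (2 ^ k)` removes the factor `N`. -/
theorem norm_preInt_le_of_supportedOver {K : Set Z} (hK : IsCompact K) {f : Γ →₀ C₀(Z × X, ℂ)}
    (hf : SupportedOver K f) (hsa : (actZX Γ X Z).invol f = f) :
    ‖preInt C ρ f‖ ≤ ‖P.ι f‖ := by
  have hfin : {γ : Γ | ∃ z ∈ K, MulOpposite.op γ • z ∈ K}.Finite := by
    refine ((ProperlyDiscontinuousSMul.finite_disjoint_inter_image (Γ := Γᵐᵒᵖ) hK hK).preimage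
      (f := MulOpposite.op) MulOpposite.op_injective.injOn).subset ?_
    rintro γ ⟨z, hz, hz'⟩
    exact ⟨_, ⟨z, hz, rfl⟩, hz'⟩
  refine le_of_forall_pow_two_pow_le (N := hfin.toFinset.card) (norm_nonneg _)
    fun k => ?_
  induction k generalizing f with
  | zero =>
    rw [pow_zero, pow_one, pow_one]
    refine (norm_preInt_le_sum C ρ f hfin.toFinset fun γ hγ => ?_).trans ?_
    · obtain ⟨⟨z, x⟩, hp⟩ : ∃ p, f γ p ≠ 0 := by
        by_contra! hall
        exact Finsupp.mem_support_iff.mp hγ (ZeroAtInftyContinuousMap.ext hall)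
      exact hfin.mem_toFinset.mpr ⟨z, hf _ _ _ hp⟩
    · rw [← nsmul_eq_mul]
      exact Finset.sum_le_card_nsmul _ _ _ fun γ _ => norm_coeff_le P f γ
  | succ k ih =>
    have hadj := adjointPair_preInt C ρ f
    rw [hsa] at hadj
    have hff : (actZX Γ X Z).invol ((actZX Γ X Z).conv f f) = (actZX Γ X Z).conv f f := by
      apply ι_injective P
      rw [P.ι_invol, P.ι_conv, star_mul, ← P.ι_invol, hsa]
    have h := ih (hf.conv hf) hff
    have h1 : ‖P.ι f * P.ι f‖ = ‖P.ι f‖ ^ 2 := by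
      have h2 : star (P.ι f) = P.ι f := by rw [← P.ι_invol, hsa]
      rw [sq, ← CStarRing.norm_star_mul_self, h2]
    rw [preInt_conv, P.ι_conv, hadj.norm_comp, h1, ← pow_mul, ← pow_mul, ← pow_succ'] at h
    exact h

theorem norm_preInt_le_of_hasCompactSupport {f : Γ →₀ C₀(Z × X, ℂ)}
    (hf : ∀ γ, HasCompactSupport (f γ)) : ‖preInt C ρ f‖ ≤ ‖P.ι f‖ := by
  set h := (actZX Γ X Z).conv f ((actZX Γ X Z).invol f) with hh
  have hι : P.ι h = P.ι f * star (P.ι f) := by rw [hh, P.ι_conv, P.ι_invol]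
  have hsa : (actZX Γ X Z).invol h = h := by
    apply ι_injective P
    rw [P.ι_invol, hι, star_mul, star_star]
  have hK : IsCompact (⋃ γ ∈ f.support, Prod.fst '' tsupport (f γ)) :=
    f.support.finite_toSet.isCompact_biUnion fun γ _ => (hf γ).isCompact.image continuous_fst
  have hs : SupportedOver (⋃ γ ∈ f.support, Prod.fst '' tsupport (f γ)) h := by
    refine supportedOver_conv_invol fun γ z x hne => ?_
    refine Set.mem_biUnion (x := γ) ?_ ⟨(z, x), subset_tsupport _ hne, rfl⟩
    refine Finsupp.mem_support_iff.mpr fun h0 => hne ?_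
    rw [h0]; rfl
  have key := norm_preInt_le_of_supportedOver C ρ P hK hs hsa
  rw [hι, CStarRing.norm_self_mul_star, hh, preInt_conv,
    (adjointPair_preInt C ρ f).symm.norm_comp, ← (adjointPair_preInt C ρ f).norm_eq, ← sq] at key
  exact le_of_sq_le_sq key (norm_nonneg _)

/-- The integrated form is dominated by every `C⋆`-completion: on coefficients of compact support by
the properness of the action, and in general by density. -/
theorem norm_preInt_le (f : Γ →₀ C₀(Z × X, ℂ)) : ‖preInt C ρ f‖ ≤ ‖P.ι f‖ := by
  classical
  let S : (Γ → C₀(Z × X, ℂ)) → (Γ →₀ C₀(Z × X, ℂ)) := fun a => ∑ γ ∈ f.support, .single γ (a γ)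
  have hS : S f = f := f.sum_single
  have hdense : Dense (Set.pi Set.univ fun _ : Γ => {g : C₀(Z × X, ℂ) | HasCompactSupport g}) :=
    dense_pi _ fun _ _ => dense_hasCompactSupport (Z × X)
  have hcont1 : Continuous fun a => ‖preInt C ρ (S a)‖ := by
    simp only [S, map_sum]
    refine (continuous_finsetSum _ fun γ _ => ?_).norm
    have : Continuous fun g : C₀(Z × X, ℂ) => preInt C ρ (.single γ g) :=
      (LinearMap.mkContinuous (preInt C ρ ∘ₗ Finsupp.lsingle γ) 1 fun g => by
        rw [one_mul]; exact norm_preInt_single_le C ρ γ g).continuous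
    exact this.comp (continuous_apply γ)
  have hcont2 : Continuous fun a => ‖P.ι (S a)‖ := by
    simp only [S, map_sum]
    exact (continuous_finsetSum _ fun γ _ =>
      (continuous_ι_single P γ).comp (continuous_apply γ)).norm
  have hclosed : IsClosed {a | ‖preInt C ρ (S a)‖ ≤ ‖P.ι (S a)‖} := isClosed_le hcont1 hcont2
  have hsub : (Set.pi Set.univ fun _ : Γ => {g : C₀(Z × X, ℂ) | HasCompactSupport g}) ⊆
      {a | ‖preInt C ρ (S a)‖ ≤ ‖P.ι (S a)‖} := by
    intro a ha
    refine norm_preInt_le_of_hasCompactSupport C ρ P fun γ => ?_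
    have hSa : S a γ = if γ ∈ f.support then a γ else 0 := by
      simp only [S, Finsupp.finsetSum_apply, Finsupp.single_apply, Finset.sum_ite_eq']
    rw [hSa]
    split_ifs
    · exact ha γ trivial
    · exact HasCompactSupport.zero
  have hmem : ‖preInt C ρ (S f)‖ ≤ ‖P.ι (S f)‖ := closure_minimal hsub hclosed (hdense f)
  rwa [hS] at hmem

/-! ### The representation `π ⋊ Γ` on `C₀(Z × X) ⋊ Γ` -/

theorem intRep_coe (f : Γ →₀ C₀(Z × X, ℂ)) : intRep ρ C P (P.ι f) = preInt C ρ f :=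
  LinearMap.extendOfNorm_eq P.dense ⟨1, fun f => by
    rw [one_mul]; exact norm_preInt_le C ρ P f⟩ f

theorem intRep_mul (a b : P.carrier) :
    intRep ρ C P (a * b) = intRep ρ C P a ∘L intRep ρ C P b := by
  refine P.dense.induction_on₂ (p := fun a b =>
    intRep ρ C P (a * b) = intRep ρ C P a ∘L intRep ρ C P b) ?_ (fun f g => ?_) a b
  · exact isClosed_eq (by fun_prop) (by fun_prop)
  · rw [← P.ι_conv, intRep_coe, intRep_coe, intRep_coe, preInt_conv]

theorem adjointPair_intRep (a : P.carrier) :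
    AdjointPair C.carrier (intRep ρ C P a) (intRep ρ C P (star a)) := by
  intro x y
  refine P.dense.induction_on (p := fun a =>
    ip (B := C.carrier) (intRep ρ C P a x) y = ip x (intRep ρ C P (star a) y)) a ?_ fun f => ?_
  · exact isClosed_eq ((continuous_ip_left y).comp (by fun_prop))
      ((continuous_ip_right x).comp (by fun_prop))
  · rw [← P.ι_invol, intRep_coe, intRep_coe]
    exact adjointPair_preInt C ρ f x y

end IntegratedForm

section Isometry

variable {Γ : Type v} {X Z : Type u} {H : Type w} [Group Γ]
  [TopologicalSpace X] [CompactSpace X] [T2Space X] [MulAction Γ X] [ContinuousConstSMul Γ X]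
  [MetricSpace Z] [ProperSpace Z] [MulAction Γᵐᵒᵖ Z] [IsIsometricSMul Γᵐᵒᵖ Z]
  [ProperlyDiscontinuousSMul Γᵐᵒᵖ Z]
  [NormedAddCommGroup H] [InnerProductSpace ℂ H] [CompleteSpace H]
  (ρ : EquivariantRep Γ X Z H) (C : CrossedProduct.{u, v, t} (actX Γ X))
  (P : CrossedProduct.{u, v, t} (actZX Γ X Z))

/-! ### The isometries of the cut-off functions and their adjoints -/

/-- The function `γ ↦ c γ(d)` in `C_c(Γ, C₀(Z × X))` attached to two cut-off functions `c` and `d`;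
for `c = d` it is the Mishchenko projection. -/
noncomputable def mixedMishchenko (c d : Cutoff Γ Z) : Γ →₀ C₀(Z × X, ℂ) :=
  Finsupp.ofSupportFinite (fun γ => pullZ c.c * (actZX Γ X Z).act γ (pullZ d.c))
    (finite_mul_act_ne_zero (hasCompactSupport_pullZ c.c) (hasCompactSupport_pullZ d.c))

theorem mixedMishchenko_apply (c d : Cutoff Γ Z) (γ : Γ) :
    mixedMishchenko (X := X) c d γ = pullZ c.c * (actZX Γ X Z).act γ (pullZ d.c) := rfl

/-- The formal adjoint of `φ`, which maps `a` at the place `μ` to `U_{μ⁻¹} π(c) a`. -/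
noncomputable def preIsoAdj (c : Cutoff Γ Z) : (Γ →₀ C(X, H)) →ₗ[ℂ] ρ.coreSpace :=
  Finsupp.lsum ℂ fun μ => LinearMap.codRestrict ρ.coreSpace
    (translate ρ.U μ⁻¹ ∘ₗ (ρ.π (pullZ c.c) : C(X, H) →ₗ[ℂ] C(X, H)))
    fun a => ρ.translate_mem _ (Submodule.subset_span ⟨_, hasCompactSupport_pullZ c.c, a, rfl⟩)

theorem preIsoAdj_single (c : Cutoff Γ Z) (μ : Γ) (a : C(X, H)) :
    (preIsoAdj ρ c (.single μ a) : C(X, H)) = translate ρ.U μ⁻¹ (ρ.π (pullZ c.c) a) := by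
  rw [preIsoAdj, Finsupp.lsum_single]
  rfl

theorem freeForm_preIso_right (c : Cutoff Γ Z) (ξ : Γ →₀ C(X, H)) (v : ρ.coreSpace) :
    freeForm ξ (ρ.preIso c v) = ρ.coreForm (preIsoAdj ρ c ξ) v := by
  ext1 γ
  rw [ρ.coreForm_apply]
  induction ξ using Finsupp.induction_linear with
  | zero => simp
  | add ξ η hξ hη =>
    rw [freeForm_add_left, Finsupp.add_apply, hξ, hη, map_add, Submodule.coe_add, fip_add_left]
  | single μ a =>
    have h := ρ.π_star (pullZ c.c) a (translate ρ.U (μ * γ) v)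
    rw [EquivariantRep.star_pullZ_cutoff] at h
    rw [freeForm_apply, Finsupp.sum_single_index (by simp), ρ.preIso_apply, preIsoAdj_single, ← h,
      ← fip_translate ρ.U, ← translate_mul, inv_mul_cancel_left]

variable [CompactSpace (Quotient (MulAction.orbitRel Γᵐᵒᵖ Z))]

/-- The adjoint `φ⋆ : (C(X) ⊗ H) ⋊ Γ → ℰ^H` of the isometry `φ`. -/
noncomputable def isoAdj (c : Cutoff Γ Z) : FreeHilbert H C →L[ℂ] ConnesSkandalis ρ C :=
  ((corePreHilbert ρ C).toHilbert ∘ₗ preIsoAdj ρ c).extendOfNorm (toFree C)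

theorem isoAdj_coe (c : Cutoff Γ Z) (ξ : Γ →₀ C(X, H)) :
    isoAdj ρ C c (toFree C ξ) = (corePreHilbert ρ C).toHilbert (preIsoAdj ρ c ξ) := by
  refine LinearMap.extendOfNorm_eq (PreHilbertModule.denseRange_toHilbert _) ⟨1, fun ξ => ?_⟩ ξ
  rw [one_mul, LinearMap.comp_apply]
  -- `‖φ⋆ ξ‖² = ‖⟨ξ, φ φ⋆ ξ⟩‖ ≤ ‖ξ‖ ‖φ φ⋆ ξ‖ = ‖ξ‖ ‖φ⋆ ξ‖`
  set v := preIsoAdj ρ c ξ with hv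
  have h1 : ‖(corePreHilbert ρ C).toHilbert v‖ ^ 2 ≤
      ‖toFree C ξ‖ * ‖(corePreHilbert ρ C).toHilbert v‖ := by
    rw [PreHilbertModule.norm_sq_toHilbert]
    change ‖C.ι (ρ.coreForm v v)‖ ≤ _
    rw [← norm_toFree_preIso ρ C c v]
    conv_lhs => rw [hv, ← freeForm_preIso_right]
    exact (freePreHilbert (H := H) C).norm_form_le_toHilbert _ _
  rcases (norm_nonneg ((corePreHilbert ρ C).toHilbert v)).eq_or_lt with h0 | h0
  · rw [← h0]; exact norm_nonneg _
  · rw [sq] at h1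
    exact le_of_mul_le_mul_right h1 h0

theorem adjointPair_isoAdj (c : Cutoff Γ Z) :
    AdjointPair C.carrier (isoAdj ρ C c) (iso ρ C c) := by
  refine adjointPair_of_toHilbert _ _ fun ξ v => ?_
  change ip (isoAdj ρ C c (toFree C ξ)) _ = _
  rw [isoAdj_coe, iso_coe, ip_toHilbert, ip_toHilbert]
  exact congrArg C.ι (freeForm_preIso_right ρ c ξ v).symm

theorem isoAdj_comp_iso (c : Cutoff Γ Z) :
    isoAdj ρ C c ∘L iso ρ C c = ContinuousLinearMap.id ℂ _ := by
  have h : AdjointPair C.carrier (ContinuousLinearMap.id ℂ (ConnesSkandalis ρ C))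
      (isoAdj ρ C c ∘L iso ρ C c) := by
    refine adjointPair_of_toHilbert _ _ fun v w => ?_
    rw [ContinuousLinearMap.comp_apply, ← (adjointPair_isoAdj ρ C c).symm, iso_coe, iso_coe,
      ip_toHilbert, ContinuousLinearMap.id_apply, ip_toHilbert]
    exact congrArg C.ι (ρ.freeForm_preIso c v w).symm
  ext1 y
  exact ext_ip C.carrier fun x => (h x y).symm

theorem isoAdj_iso (c : Cutoff Γ Z) (y : ConnesSkandalis ρ C) :
    isoAdj ρ C c (iso ρ C c y) = y :=
  congrArg (fun S : ConnesSkandalis ρ C →L[ℂ] ConnesSkandalis ρ C => S y) (isoAdj_comp_iso ρ C c)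

theorem preInt_toFree_single (f : Γ →₀ C₀(Z × X, ℂ)) (μ : Γ) (a : C(X, H)) (ξ : Γ →₀ C(X, H))
    (hξ : ∀ γ, ξ γ = ρ.π (f (γ * μ⁻¹)) (translate ρ.U (γ * μ⁻¹) a)) :
    preInt C ρ f (toFree C (.single μ a)) = toFree C ξ := by
  classical
  induction f using Finsupp.induction_linear generalizing ξ with
  | zero =>
    have : ξ = 0 := Finsupp.ext fun γ => by rw [hξ]; simp
    rw [this, map_zero, map_zero, zero_apply]
  | add f g hf hg =>
    let η (h : Γ →₀ C₀(Z × X, ℂ)) : Γ →₀ C(X, H) := Finsupp.onFinset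
      (h.support.image (· * μ)) (fun γ => ρ.π (h (γ * μ⁻¹)) (translate ρ.U (γ * μ⁻¹) a))
      fun γ hγ => Finset.mem_image.mpr ⟨γ * μ⁻¹, Finsupp.mem_support_iff.mpr fun h0 => hγ (by
        rw [h0, map_zero, zero_apply]), inv_mul_cancel_right γ μ⟩
    have : ξ = η f + η g := by
      ext1 γ
      rw [hξ, Finsupp.add_apply, map_add, add_apply]
      rfl
    rw [map_add, add_apply, hf (η f) fun _ => rfl, hg (η g) fun _ => rfl, this, map_add]
  | single ν g =>
    rw [preInt_single_single]
    congr 1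
    ext1 γ
    rw [hξ, Finsupp.single_apply, Finsupp.single_apply]
    by_cases h : ν * μ = γ
    · subst h; simp
    · have : ¬ ν = γ * μ⁻¹ := fun h' => h (by rw [h']; group)
      simp [h, this]

/-- The operators `φ_c φ_d⋆` lie in the image of `π ⋊ Γ`. This is what ties the isometries of
different cut-off functions to the algebra with which `T ⋊ Γ` commutes up to compact operators. -/
theorem iso_comp_isoAdj (c d : Cutoff Γ Z) :
    iso ρ C c ∘L isoAdj ρ C d = intRep ρ C P (P.ι (mixedMishchenko c d)) := by
  rw [intRep_coe]
  refine clm_ext_single C fun μ a => ?_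
  rw [ContinuousLinearMap.comp_apply, isoAdj_coe, iso_coe]
  refine (preInt_toFree_single ρ C _ μ a _ fun γ => ?_).symm
  change ρ.preIso c _ γ = _
  rw [ρ.preIso_apply, preIsoAdj_single, ← translate_mul, ← ρ.equivariant, mixedMishchenko_apply,
    map_mul, mul_apply_eq_comp]

theorem iso_comp_isoAdj_self (c : Cutoff Γ Z) :
    iso ρ C c ∘L isoAdj ρ C c = intRep ρ C P (P.ι (mishchenko c)) :=
  iso_comp_isoAdj ρ C P c c

/-- On the ideal generated by the Mishchenko projection, `φ φ⋆` acts as the identity. -/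
theorem iso_comp_isoAdj_comp_intRep (c : Cutoff Γ Z) {f : P.carrier}
    (hf : f ∈ mishchenkoIdeal (X := X) P c) :
    iso ρ C c ∘L isoAdj ρ C c ∘L intRep ρ C P f = intRep ρ C P f := by
  obtain ⟨b, rfl⟩ := hf
  rw [intRep_mul, ← iso_comp_isoAdj_self]
  ext1 y
  simp only [ContinuousLinearMap.comp_apply, isoAdj_iso]

theorem leftOp_eq (c : Cutoff Γ Z) {f : P.carrier} (hf : f ∈ mishchenkoIdeal (X := X) P c) :
    leftOp ρ C P c f = isoAdj ρ C c ∘L intRep ρ C P f := by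
  rw [leftOp]
  conv_lhs => rw [← iso_comp_isoAdj_comp_intRep ρ C P c hf]
  exact isoInvComp_eq ρ C c _

theorem cutDown_comp_iso (c : Cutoff Γ Z) (T : C(X, H) →L[ℂ] C(X, H)) :
    cutDown ρ C P c T ∘L iso ρ C c = iso ρ C c ∘L isoAdj ρ C c ∘L rtimes C T ∘L iso ρ C c := by
  rw [cutDown, ← iso_comp_isoAdj_self]
  ext1 y
  simp only [ContinuousLinearMap.comp_apply, isoAdj_iso]

theorem compression_eq (c : Cutoff Γ Z) (T : C(X, H) →L[ℂ] C(X, H)) :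
    compression ρ C P c T = isoAdj ρ C c ∘L rtimes C T ∘L iso ρ C c := by
  rw [compression, cutDown_comp_iso]
  exact isoInvComp_eq ρ C c _

theorem iso_compression (c : Cutoff Γ Z) (T : C(X, H) →L[ℂ] C(X, H)) (ξ : ConnesSkandalis ρ C) :
    iso ρ C c (compression ρ C P c T ξ) = cutDown ρ C P c T (iso ρ C c ξ) := by
  rw [compression_eq]
  exact (congrArg (fun S => S ξ) (cutDown_comp_iso ρ C P c T)).symm

theorem isAdjointable_compression (c : Cutoff Γ Z) {T : C(X, H) →L[ℂ] C(X, H)}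
    (hT : IsAdjointable C(X, ℂ) T) : IsAdjointable C.carrier (compression ρ C P c T) := by
  obtain ⟨T', hT'⟩ := isAdjointable_rtimes C hT
  rw [compression_eq]
  exact ((adjointPair_isoAdj ρ C c).comp
    (AdjointPair.comp hT' (adjointPair_isoAdj ρ C c).symm)).isAdjointable

/-! ### Commutators with the representation `π ⋊ Γ` -/

theorem isEquivariant_and_isPseudolocal_of_mem_roeD {T : C(X, H) →L[ℂ] C(X, H)}
    (hT : T ∈ roeD ρ) : IsAdjointable C(X, ℂ) T ∧ IsEquivariant ρ T ∧ IsPseudolocal ρ T := by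
  refine closure_minimal (t := {T | IsAdjointable C(X, ℂ) T ∧ IsEquivariant ρ T ∧
    IsPseudolocal ρ T}) (fun T h => ⟨h.1, h.2.1, h.2.2.2⟩) ?_ hT
  refine isClosed_isAdjointable.inter (IsClosed.inter ?_ ?_)
  · have : {T : C(X, H) →L[ℂ] C(X, H) | IsEquivariant ρ T} =
        ⋂ (γ : Γ) (ξ : C(X, H)) (x : X),
          {T | T (translate ρ.U γ ξ) x = ρ.U γ (T ξ (γ⁻¹ • x))} := by
      ext T
      simp only [Set.mem_iInter, Set.mem_ofPred_eq, IsEquivariant]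
      exact forall₂_congr fun γ ξ => ContinuousMap.ext_iff
    change IsClosed {T : C(X, H) →L[ℂ] C(X, H) | IsEquivariant ρ T}
    rw [this]
    have hev (ξ : C(X, H)) (x : X) : Continuous fun T : C(X, H) →L[ℂ] C(X, H) => T ξ x :=
      (continuous_eval_const x).comp (by fun_prop)
    exact isClosed_iInter fun γ => isClosed_iInter fun ξ => isClosed_iInter fun x =>
      isClosed_eq (hev _ _) ((ρ.U γ).continuous.comp (hev _ _))
  · have : {T : C(X, H) →L[ℂ] C(X, H) | IsPseudolocal ρ T} =
        ⋂ g : C₀(Z × X, ℂ), (fun T => T ∘L ρ.π g - ρ.π g ∘L T) ⁻¹'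
          compactOps C(X, ℂ) C(X, H) C(X, H) := by
      ext T
      simp only [Set.mem_iInter, Set.mem_preimage, Set.mem_ofPred_eq, IsPseudolocal]
    change IsClosed {T : C(X, H) →L[ℂ] C(X, H) | IsPseudolocal ρ T}
    rw [this]
    exact isClosed_iInter fun g => isClosed_compactOps.preimage (by fun_prop)

theorem comp_π_mem_compactOps_of_mem_roeC {T : C(X, H) →L[ℂ] C(X, H)} (hT : T ∈ roeC ρ)
    (g : C₀(Z × X, ℂ)) : T ∘L ρ.π g ∈ compactOps C(X, ℂ) C(X, H) C(X, H) :=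
  closure_minimal (t := (fun T => T ∘L ρ.π g) ⁻¹' compactOps C(X, ℂ) C(X, H) C(X, H))
    (fun T h => (h.2.2.2 g).2) (isClosed_compactOps.preimage (by fun_prop)) hT

theorem roeC_subset_roeD : roeC ρ ⊆ roeD ρ :=
  closure_mono fun _ h => ⟨h.1, h.2.1, h.2.2.1, fun g =>
    sub_mem_compactOps (h.2.2.2 g).2 (h.2.2.2 g).1⟩

/-- The commutator of `T ⋊ Γ` with `π(g) U_μ` is `([T, π(g)] ⋊ Γ) U_μ`, for `T` equivariant. -/
theorem commutator_intRep_mem_compactOps {T : C(X, H) →L[ℂ] C(X, H)} (hT : T ∈ roeD ρ)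
    (a : P.carrier) : rtimes C T ∘L intRep ρ C P a - intRep ρ C P a ∘L rtimes C T ∈
      compactOps C.carrier (FreeHilbert H C) (FreeHilbert H C) := by
  obtain ⟨hadj, heq, hloc⟩ := isEquivariant_and_isPseudolocal_of_mem_roeD ρ hT
  refine P.dense.induction_on (p := fun a => rtimes C T ∘L intRep ρ C P a -
    intRep ρ C P a ∘L rtimes C T ∈ compactOps C.carrier (FreeHilbert H C) (FreeHilbert H C)) a
    (isClosed_compactOps.preimage (by fun_prop)) fun f => ?_
  rw [intRep_coe]
  induction f using Finsupp.induction_linear with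
  | zero =>
    rw [map_zero, ContinuousLinearMap.comp_zero, ContinuousLinearMap.zero_comp, sub_self]
    exact zero_mem_compactOps
  | add f g hf hg =>
    rw [map_add, ContinuousLinearMap.comp_add, ContinuousLinearMap.add_comp, add_sub_add_comm]
    exact add_mem_compactOps hf hg
  | single μ g =>
    have hg := isAdjointable_π ρ g
    have h1 : rtimes C T ∘L preInt C ρ (.single μ g) - preInt C ρ (.single μ g) ∘L rtimes C T =
        rtimes C (T ∘L ρ.π g - ρ.π g ∘L T) ∘L shift C ρ μ := by
      rw [preInt_single, rtimes_sub C (hadj.comp hg) (hg.comp hadj), rtimes_comp C hadj hg,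
        rtimes_comp C hg hadj, ContinuousLinearMap.sub_comp, ContinuousLinearMap.comp_assoc,
        ContinuousLinearMap.comp_assoc, ContinuousLinearMap.comp_assoc,
        rtimes_comp_shift C ρ hadj heq]
    rw [h1]
    exact mem_compactOps_comp (adjointPair_shift C ρ μ).isAdjointable
      (rtimes_mem_compactOps C (hloc g))

theorem rtimes_comp_preInt_mem_compactOps {T : C(X, H) →L[ℂ] C(X, H)} (hT : T ∈ roeC ρ)
    (f : Γ →₀ C₀(Z × X, ℂ)) : rtimes C T ∘L preInt C ρ f ∈
      compactOps C.carrier (FreeHilbert H C) (FreeHilbert H C) := by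
  have hadj := (isEquivariant_and_isPseudolocal_of_mem_roeD ρ (roeC_subset_roeD ρ hT)).1
  induction f using Finsupp.induction_linear with
  | zero =>
    rw [map_zero, ContinuousLinearMap.comp_zero]
    exact zero_mem_compactOps
  | add f g hf hg =>
    rw [map_add, ContinuousLinearMap.comp_add]
    exact add_mem_compactOps hf hg
  | single μ g =>
    rw [preInt_single, ← ContinuousLinearMap.comp_assoc,
      ← rtimes_comp C hadj (isAdjointable_π ρ g)]
    exact mem_compactOps_comp (adjointPair_shift C ρ μ).isAdjointable
      (rtimes_mem_compactOps C (comp_π_mem_compactOps_of_mem_roeC ρ hT g))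

/-! ### Lifts -/

theorem isLift_compression (c : Cutoff Γ Z) {T : C(X, H) →L[ℂ] C(X, H)} (hT : T ∈ roeD ρ) :
    IsLift ρ C P (compression ρ C P c T) T := by
  have hφ := adjointPair_isoAdj ρ C c
  refine ⟨isAdjointable_compression ρ C P c
    (isEquivariant_and_isPseudolocal_of_mem_roeD ρ hT).1, c, fun f hf => ⟨?_, ?_⟩⟩
  · have h1 := iso_comp_isoAdj_comp_intRep ρ C P c hf
    have h2 : compression ρ C P c T ∘L leftOp ρ C P c f - leftOp ρ C P c f ∘L rtimes C T =
        isoAdj ρ C c ∘L (rtimes C T ∘L intRep ρ C P f - intRep ρ C P f ∘L rtimes C T) := by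
      rw [compression_eq, leftOp_eq ρ C P c hf, ContinuousLinearMap.comp_sub]
      congr 1
      calc _ = isoAdj ρ C c ∘L rtimes C T ∘L
            (iso ρ C c ∘L isoAdj ρ C c ∘L intRep ρ C P f) := rfl
        _ = _ := by rw [h1]
    rw [h2]
    exact comp_mem_compactOps hφ.isAdjointable (commutator_intRep_mem_compactOps ρ C P hT f)
  · -- the adjoint of the identity `φ φ⋆ (π ⋊ Γ)(f) = (π ⋊ Γ)(f)`
    have h1 : intRep ρ C P (star f) ∘L iso ρ C c ∘L isoAdj ρ C c = intRep ρ C P (star f) := by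
      have h := (hφ.symm.comp (hφ.comp (adjointPair_intRep C ρ P f))).symm
      rw [iso_comp_isoAdj_comp_intRep ρ C P c hf] at h
      ext1 y
      exact ext_ip C.carrier fun x =>
        (h.symm x y).symm.trans (adjointPair_intRep C ρ P f x y)
    have h2 : leftOpAdjoint ρ C P c f ∘L compression ρ C P c T -
        rtimes C T ∘L leftOpAdjoint ρ C P c f =
        (intRep ρ C P (star f) ∘L rtimes C T - rtimes C T ∘L intRep ρ C P (star f)) ∘L
          iso ρ C c := by
      rw [compression_eq, leftOpAdjoint, ContinuousLinearMap.sub_comp]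
      congr 1
      calc _ = (intRep ρ C P (star f) ∘L iso ρ C c ∘L isoAdj ρ C c) ∘L rtimes C T ∘L
            iso ρ C c := rfl
        _ = _ := by rw [h1]; rfl
    rw [h2]
    exact mem_compactOps_comp hφ.symm.isAdjointable
      (sub_mem_compactOps_comm (commutator_intRep_mem_compactOps ρ C P hT (star f)))

/-- The compressions of `T` for two cut-off functions agree up to compact operators, since the
operator `φ_c φ_d⋆` commutes with `T ⋊ Γ` up to compact operators. -/
theorem compression_sub_compression_mem_compactOps (c d : Cutoff Γ Z)
    {T : C(X, H) →L[ℂ] C(X, H)} (hT : T ∈ roeD ρ) :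
    compression ρ C P c T - compression ρ C P d T ∈
      compactOps C.carrier (ConnesSkandalis ρ C) (ConnesSkandalis ρ C) := by
  have hK := commutator_intRep_mem_compactOps ρ C P hT (P.ι (mixedMishchenko c d))
  rw [← iso_comp_isoAdj] at hK
  have h : compression ρ C P c T - compression ρ C P d T =
      isoAdj ρ C c ∘L (rtimes C T ∘L (iso ρ C c ∘L isoAdj ρ C d) -
        (iso ρ C c ∘L isoAdj ρ C d) ∘L rtimes C T) ∘L iso ρ C d := by
    rw [compression_eq, compression_eq]
    ext1 y
    simp only [ContinuousLinearMap.comp_apply, sub_apply, map_sub, isoAdj_iso]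
  rw [h]
  exact comp_mem_compactOps (adjointPair_isoAdj ρ C c).isAdjointable
    (mem_compactOps_comp (adjointPair_isoAdj ρ C d).symm.isAdjointable hK)

theorem IsLift.sub_compression_mem_compactOps {S : ConnesSkandalis ρ C →L[ℂ] ConnesSkandalis ρ C}
    {T : C(X, H) →L[ℂ] C(X, H)} (hS : IsLift ρ C P S T) (hT : T ∈ roeD ρ) (c : Cutoff Γ Z) :
    S - compression ρ C P c T ∈
      compactOps C.carrier (ConnesSkandalis ρ C) (ConnesSkandalis ρ C) := by
  obtain ⟨-, d, hd⟩ := hS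
  -- for `f = e e` one has `L_f = φ⋆`
  have hmem : P.ι (mishchenko d) * P.ι (mishchenko d) ∈ mishchenkoIdeal (X := X) P d := ⟨_, rfl⟩
  have hL : leftOp ρ C P d (P.ι (mishchenko d) * P.ι (mishchenko d)) = isoAdj ρ C d := by
    rw [leftOp_eq ρ C P d hmem, intRep_mul, ← iso_comp_isoAdj_self]
    ext1 y
    simp only [ContinuousLinearMap.comp_apply, isoAdj_iso]
  have h1 := (hd _ hmem).1
  rw [hL] at h1
  have h2 := mem_compactOps_comp (adjointPair_isoAdj ρ C d).symm.isAdjointable h1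
  have h3 : (S ∘L isoAdj ρ C d - isoAdj ρ C d ∘L rtimes C T) ∘L iso ρ C d =
      S - compression ρ C P d T := by
    rw [compression_eq]
    ext1 y
    simp only [ContinuousLinearMap.comp_apply, sub_apply, isoAdj_iso]
  rw [h3] at h2
  have h4 := add_mem_compactOps h2 (compression_sub_compression_mem_compactOps ρ C P d c hT)
  rwa [sub_add_sub_cancel] at h4

theorem compression_mem_compactOps (c : Cutoff Γ Z) {T : C(X, H) →L[ℂ] C(X, H)}
    (hT : T ∈ roeC ρ) : compression ρ C P c T ∈
      compactOps C.carrier (ConnesSkandalis ρ C) (ConnesSkandalis ρ C) := by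
  have hK := rtimes_comp_preInt_mem_compactOps ρ C hT (mishchenko c)
  rw [← intRep_coe C ρ P, ← iso_comp_isoAdj_self] at hK
  have h : compression ρ C P c T =
      isoAdj ρ C c ∘L (rtimes C T ∘L iso ρ C c ∘L isoAdj ρ C c) ∘L iso ρ C c := by
    rw [compression_eq]
    ext1 y
    simp only [ContinuousLinearMap.comp_apply, isoAdj_iso]
  rw [h]
  exact comp_mem_compactOps (adjointPair_isoAdj ρ C c).isAdjointable
    (mem_compactOps_comp (adjointPair_isoAdj ρ C c).symm.isAdjointable hK)

theorem zero_mem_roeC : (0 : C(X, H) →L[ℂ] C(X, H)) ∈ roeC ρ := by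
  refine subset_closure ⟨isAdjointable_of_mem_compactOps zero_mem_compactOps, fun γ ξ => ?_,
    ⟨1, one_pos, fun φ ψ _ => ?_⟩, fun g => ?_⟩
  · simp
  · simp
  · rw [ContinuousLinearMap.comp_zero, ContinuousLinearMap.zero_comp]
    exact ⟨zero_mem_compactOps, zero_mem_compactOps⟩

theorem isLift_zero_of_mem_compactOps {S : ConnesSkandalis ρ C →L[ℂ] ConnesSkandalis ρ C}
    (hS : S ∈ compactOps C.carrier (ConnesSkandalis ρ C) (ConnesSkandalis ρ C)) :
    IsLift ρ C P S 0 := by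
  obtain ⟨c⟩ := exists_cutoff (Γ := Γ) (Z := Z)
  have h0 : rtimes C (0 : C(X, H) →L[ℂ] C(X, H)) = 0 := by
    refine clm_ext_single C fun μ a => ?_
    rw [rtimes_single C (isAdjointable_of_mem_compactOps zero_mem_compactOps), zero_apply,
      Finsupp.single_zero, map_zero, zero_apply]
  refine ⟨isAdjointable_of_mem_compactOps hS, c, fun f hf => ⟨?_, ?_⟩⟩
  · rw [h0, ContinuousLinearMap.comp_zero, sub_zero, leftOp_eq ρ C P c hf]
    exact mem_compactOps_comp
      ((adjointPair_isoAdj ρ C c).comp (adjointPair_intRep C ρ P f)).isAdjointable hS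
  · rw [h0, ContinuousLinearMap.zero_comp, sub_zero, leftOpAdjoint]
    exact comp_mem_compactOps
      ((adjointPair_intRep C ρ P (star f)).comp (adjointPair_isoAdj ρ C c).symm).isAdjointable hS

/-- The lift `T_e` of a locally compact operator `T` is compact, and hence so are all lifts of `T`.
Conversely the compact operators are lifts of `0`. -/
theorem roeIdeal_eq_compactOps : roeIdeal ρ C P =
    compactOps C.carrier (ConnesSkandalis ρ C) (ConnesSkandalis ρ C) := by
  obtain ⟨c⟩ := exists_cutoff (Γ := Γ) (Z := Z)
  refine Set.Subset.antisymm ?_ fun S hS =>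
    ⟨0, zero_mem_roeC ρ, isLift_zero_of_mem_compactOps ρ C P hS⟩
  rintro S ⟨T, hT, hS⟩
  have h := add_mem_compactOps (hS.sub_compression_mem_compactOps ρ C P (roeC_subset_roeD ρ hT) c)
    (compression_mem_compactOps ρ C P c hT)
  rwa [sub_add_cancel] at h

end Isometry

end RoeLift

theorem mainTheorem8 {Γ : Type v} [Group Γ] [Countable Γ]
    {X Z : Type u} [TopologicalSpace X] [CompactSpace X] [T2Space X]
    [MulAction Γ X] [ContinuousConstSMul Γ X]
    [MetricSpace Z] [ProperSpace Z] [MulAction Γᵐᵒᵖ Z] [IsIsometricSMul Γᵐᵒᵖ Z]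
    [ProperlyDiscontinuousSMul Γᵐᵒᵖ Z] [CompactSpace (Quotient (MulAction.orbitRel Γᵐᵒᵖ Z))]
    {H : Type w} [NormedAddCommGroup H] [InnerProductSpace ℂ H] [CompleteSpace H]
    [TopologicalSpace.SeparableSpace H]
    (F : CrossedProductFunctor.{u, v, t} Γ) (ρ : EquivariantRep Γ X Z H) :
    (∀ c : Cutoff Γ Z, ∀ T ∈ roeD ρ,
      (∀ ξ, iso ρ (F.obj (actX Γ X)) c (compression ρ (F.obj (actX Γ X)) (F.obj (actZX Γ X Z)) c T ξ) =
        cutDown ρ (F.obj (actX Γ X)) (F.obj (actZX Γ X Z)) c T (iso ρ (F.obj (actX Γ X)) c ξ)) ∧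
      IsLift ρ (F.obj (actX Γ X)) (F.obj (actZX Γ X Z))
        (compression ρ (F.obj (actX Γ X)) (F.obj (actZX Γ X Z)) c T) T ∧
      ∀ S, IsLift ρ (F.obj (actX Γ X)) (F.obj (actZX Γ X Z)) S T →
        S - compression ρ (F.obj (actX Γ X)) (F.obj (actZX Γ X Z)) c T ∈
          compactOps (F.obj (actX Γ X)).carrier
            (ConnesSkandalis ρ (F.obj (actX Γ X))) (ConnesSkandalis ρ (F.obj (actX Γ X)))) ∧
    roeIdeal ρ (F.obj (actX Γ X)) (F.obj (actZX Γ X Z)) =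
      compactOps (F.obj (actX Γ X)).carrier
        (ConnesSkandalis ρ (F.obj (actX Γ X))) (ConnesSkandalis ρ (F.obj (actX Γ X))) := by
  exact ⟨fun c T hT => ⟨iso_compression ρ _ _ c T, isLift_compression ρ _ _ c hT,
    fun S hS => hS.sub_compression_mem_compactOps ρ _ _ hT c⟩, roeIdeal_eq_compactOps ρ _ _⟩
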